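/- Let $m\ge 1$ and $N\ge 0$ be integers and $\bar{\mathfrak g}=\mathfrak{sl}_m(\mathbb C)$ with its Cartan subalgebra $\bar{\mathfrak h}$ of diagonal matrices, the trace form $(\ ,\ )$, and $\bar e_a\in\bar{\mathfrak h}^*$ the weight of the standard basis vector $u_a$ of $V=\mathbb C^m$. Let $\bar{\mathcal H}$ be the degenerate affine Hecke algebra of $\mathfrak{gl}_N$: it is generated by the group algebra of $\bar W=\mathfrak S_N$ and the polynomial algebra $S[\bar{\mathfrak t}]=\mathbb C[\epsilon_1^\vee,\dots,\epsilon_N^\vee]$, with relations $s_i\xi-s_i(\xi)s_i=-\alpha_i(\xi)$ for $1\le i<N$, $\xi\in\bar{\mathfrak t}=\bigoplus_j\mathbb C\epsilon_j^\vee$, where $\alpha_i=\epsilon_i-\epsilon_{i+1}$. Put $\varphi_i=1+s_i(\epsilon^\vee_i-\epsilon^\vee_{i+1})$ and, for a reduced expression $w=s_{j_1}\cdots s_{j_l}$, $\varphi_w=\varphi_{j_1}\cdots\varphi_{j_l}$. For $\bar{\mathfrak g}$-modules $A,B$ put $\bar{\mathcal F}(A,B)=(A\otimes V^{\otimes N}\otimes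 B)/\bar{\mathfrak g}(A\otimes V^{\otimes N}\otimes B)$. Number the tensor factors $0,\dots,N+1$, let $\theta_j$ be the action on the $j$-th factor and $\theta_{jk}=\theta_j\otimes\theta_k$, let $\bar r=\frac12\sum_a H_a\otimes H_a+\sum_{a<b}E_{ab}\otimes E_{ba}$ with $\{H_a\}$ an orthonormal basis of $\bar{\mathfrak h}$, and let $\rho^\vee$ be half the sum of the positive coroots. Let $\epsilon_i^\vee$ act by $$\bar{\mathcal D}_i=\sum_{0\le j<i}\Big(\theta_{ji}(\bar r)+\tfrac1{2m}\Big)-\sum_{i<j\le N+1}\Big(\theta_{ij}(\bar r)+\tfrac1{2m}\Big)+\theta_i(\rho^\vee)$$ and $w\in\bar W$ by $v_1\otimes\cdots\otimes v_N\mapsto v_{w^{-1}(1)}\otimes\cdots\otimes v_{w^{-1}(N)}$ on $V^{\otimes N}$. Put $\bar{\mathcal M}(\bar\lambda,\bar\mu)=\bar{\mathcal F}(\bar M(\bar\mu),\bar M^\dagger(\bar\lambda))$ and $\bar{\mathcal V}(\bar\lambda,\bar\mu)=\bar{\mathcal F}(\bar M(\bar\mu),\bar L^\dagger(\bar\lambda))$,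 where $\bar M(\bar\mu)$ is the highest-weight Verma module of highest weight $\bar\mu$, $\bar M^\dagger(\bar\lambda)$ is the lowest-weight Verma module of lowest weight $-\bar\lambda$, and $\bar L^\dagger(\bar\lambda)$ is the irreducible quotient of $\bar M^\dagger(\bar\lambda)$. Let $\bar\lambda,\bar\mu\in\bar{\mathfrak h}^*$ be dominant integral and suppose that $\bar\lambda-\bar\mu$ is a weight of $V^{\otimes N}$, i.e. $\bar\lambda-\bar\mu=\sum_{a=1}^m\beta_a\bar e_a$ with $\beta_a\in\mathbb Z_{\ge0}$ and $\sum_a\beta_a=N$. Put $\mu_a=(\bar\mu,\bar e_a)$ and $$Y=\{(a,p)\in\mathbb Z\times\mathbb C\mid 1\le a\le m,\ p=\mu_a+1,\dots,\mu_a+\beta_a\}.$$ A tableau is a bijection $T:Y\to\{1,\dots,N\}$; it is standard if $T(a,p)<T(a,p+1)$ and $T(a,p)<T(a+1,p)$ whenever both cells lie in $Y$. Let $T_0(a,p)=\sum_{k<a}\beta_k+p-\mu_a$, let $w_T\in\bar W$ be the permutation with $T=w_T\circ T_0$, and let $\bar W_\beta\subseteq\bar W$ be the Young subgroup preserving each set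 of values of $T_0$ on a row. Put $$\zeta=\sum_{(a,p)\in Y}(p-a)\,\epsilon_{T_0(a,p)}+\frac{m^2-N}{2m}\sum_{k=1}^N\epsilon_k ,$$ and let $\mathbf 1_\zeta\in\bar{\mathcal M}(\bar\lambda,\bar\mu)$ be the class of $v(\bar\mu)\otimes u_1^{\otimes\beta_1}\otimes\cdots\otimes u_m^{\otimes\beta_m}\otimes v^\dagger(\bar\lambda)$, where $v(\bar\mu)$ and $v^\dagger(\bar\lambda)$ are the highest- and lowest-weight vectors. Then the formulas above define $\bar{\mathcal H}$-module structures on $\bar{\mathcal M}(\bar\lambda,\bar\mu)$ and $\bar{\mathcal V}(\bar\lambda,\bar\mu)$; the vector $\mathbf 1_\zeta$ generates $\bar{\mathcal M}(\bar\lambda,\bar\mu)$, has weight $\zeta$ and is fixed by $\bar W_\beta$; and the following hold. 1. The map $\pi:\bar{\mathcal M}(\bar\lambda,\bar\mu)\to\bar{\mathcal V}(\bar\lambda,\bar\mu)$ induced by $\bar M^\dagger(\bar\lambda)\to\bar L^\dagger(\bar\lambda)$ is a surjective $\bar{\mathcal H}$-homomorphism, $\bar{\mathcal V}(\bar\lambda,\bar\mu)$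 is irreducible, and it is the unique irreducible quotient of $\bar{\mathcal M}(\bar\lambda,\bar\mu)$: if $K$ is a submodule with $\bar{\mathcal M}(\bar\lambda,\bar\mu)/K$ irreducible, then $K=\ker\pi$. 2. The images under $\pi$ of the vectors $\varphi_{w_T}\mathbf 1_\zeta$, $T$ running over the standard tableaux on $Y$, form a $\mathbb C$-basis of $\bar{\mathcal V}(\bar\lambda,\bar\mu)$, for any choice of reduced expressions of the $w_T$. 3. $S[\bar{\mathfrak t}]$ acts semisimply on $\bar{\mathcal V}(\bar\lambda,\bar\mu)$. -/

import Mathlib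

namespace SkewHecke

open scoped TensorProduct
open LieAlgebra

attribute [local instance 100] LieRing.ofAssociativeRing

noncomputable section

/-! ### The Lie algebra `sl_m(ℂ)`, its Cartan subalgebra and weights -/

/-- The Lie algebra `sl_m(ℂ)`. -/
abbrev Slm (m : ℕ) : Type := SpecialLinear.sl (Fin m) ℂ

/-- The Cartan subalgebra of diagonal matrices of trace zero. -/
def cartan (m : ℕ) : Submodule ℂ (Slm m) where
  carrier := {x | ∀ a b : Fin m, a ≠ b → x.1 a b = 0}
  add_mem' := fun {x y} hx hy a b h => by simp [hx a b h, hy a b h]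
  zero_mem' := fun a b _ => by simp
  smul_mem' := fun c x hx a b h => by simp [hx a b h]

/-- Strictly upper triangular matrices: the nilpotent subalgebra spanned by positive root vectors. -/
def nPos (m : ℕ) : Set (Slm m) := {x | ∀ a b : Fin m, b ≤ a → x.1 a b = 0}

/-- Strictly lower triangular matrices: the nilpotent subalgebra spanned by negative root vectors. -/
def nNeg (m : ℕ) : Set (Slm m) := {x | ∀ a b : Fin m, a ≤ b → x.1 a b = 0}

/-- Weights: linear functionals on the Cartan subalgebra. -/
abbrev Weight (m : ℕ) : Type := Module.Dual ℂ (cartan m)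

/-- The weight `ē_a` of the basis vector `u_a` of the vector representation: `h ↦ h_aa`. -/
def eBar {m : ℕ} (a : Fin m) : Weight m where
  toFun h := h.1.1 a a
  map_add' _ _ := by simp
  map_smul' _ _ := by simp

/-- The element `x_a = E_aa - (1/m) Id` of the Cartan subalgebra. It corresponds to the weight
`ē_a` under the trace form, since `tr (x_a h) = h_aa`. -/
def xCartan {m : ℕ} (a : Fin m) : cartan m :=
  ⟨⟨Matrix.diagonal fun b => (if b = a then (1 : ℂ) else 0) - 1 / (m : ℂ), by
      have hm : (m : ℂ) ≠ 0 := by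
        have := a.pos
        exact_mod_cast this.ne'
      change Matrix.trace (Matrix.diagonal fun b : Fin m =>
        (if b = a then (1 : ℂ) else 0) - 1 / (m : ℂ)) = 0
      simp [Matrix.trace_diagonal, hm]⟩,
    fun b c h => by simp [h]⟩

/-- The coordinate `μ_a = (μ, ē_a)`, for the form on weights induced by the trace form. -/
def wcoord {m : ℕ} (μ : Weight m) (a : Fin m) : ℂ := μ (xCartan a)

/-- A weight is dominant integral if it takes values in `ℤ_{≥ 0}` on all positive coroots
`E_aa - E_bb = x_a - x_b`, `a < b`. -/
def IsDominantIntegral {m : ℕ} (μ : Weight m) : Prop :=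
  ∀ a b : Fin m, a < b → ∃ n : ℕ, μ (xCartan a - xCartan b) = n

/-- Half the sum of the positive coroots. -/
def rhoCheck (m : ℕ) : Slm m :=
  ((1 / 2 : ℂ) • ∑ q : {q : Fin m × Fin m // q.1 < q.2}, (xCartan q.1.1 - xCartan q.1.2) :
    cartan m).1

/-! ### Verma modules -/

/-- The universal enveloping algebra `U(sl_m)`. An `sl_m`-module is the same as a
`U(sl_m)`-module. -/
abbrev Usl (m : ℕ) : Type := UniversalEnvelopingAlgebra ℂ (Slm m)

/-- The canonical map `sl_m → U(sl_m)`. -/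
def toU {m : ℕ} (x : Slm m) : Usl m := UniversalEnvelopingAlgebra.ι ℂ x

/-- The left ideal of `U(sl_m)` generated by `n` and by the elements `h - χ(h)`, `h` in the Cartan
subalgebra. -/
def vermaIdeal {m : ℕ} (n : Set (Slm m)) (χ : Weight m) : Submodule (Usl m) (Usl m) :=
  Submodule.span (Usl m)
    ({y | ∃ x ∈ n, y = toU x} ∪
      {y | ∃ h : cartan m, y = toU h.1 - algebraMap ℂ (Usl m) (χ h)})

/-- The highest-weight Verma module `M(μ)` of highest weight `μ`. -/
abbrev Verma {m : ℕ} (μ : Weight m) : Type := Usl m ⧸ vermaIdeal (nPos m) μ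

/-- The lowest-weight Verma module `M†(λ)`, of lowest weight `-λ`. -/
abbrev VermaLow {m : ℕ} (lam : Weight m) : Type := Usl m ⧸ vermaIdeal (nNeg m) (-lam)

/-- The sum of all proper submodules. -/
def sumProper (R M : Type) [Ring R] [AddCommGroup M] [Module R M] : Submodule R M :=
  sSup {K : Submodule R M | K ≠ ⊤}

/-- The irreducible quotient `L†(λ)` of `M†(λ)`: the quotient by the sum of all proper
submodules. -/
abbrev IrrLow {m : ℕ} (lam : Weight m) : Type :=
  VermaLow lam ⧸ sumProper (Usl m) (VermaLow lam)

/-- The highest-weight vector `v(μ)`. -/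
def hwVector {m : ℕ} (μ : Weight m) : Verma μ := Submodule.Quotient.mk 1

/-- The lowest-weight vector `v†(λ)`. -/
def lwVector {m : ℕ} (lam : Weight m) : VermaLow lam := Submodule.Quotient.mk 1

/-- The projection `M†(λ) → L†(λ)`, as a `ℂ`-linear map. -/
def toIrrLow {m : ℕ} (lam : Weight m) : VermaLow lam →ₗ[ℂ] IrrLow lam :=
  (sumProper (Usl m) (VermaLow lam)).mkQ.restrictScalars ℂ

/-! ### The degenerate affine Hecke algebra of `gl_N` -/

/-- For `i : Fin (N - 1)`, the index `i` in `Fin N`. -/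
def lo {N : ℕ} (i : Fin (N - 1)) : Fin N := ⟨i, by omega⟩

/-- For `i : Fin (N - 1)`, the index `i + 1` in `Fin N`. -/
def hi {N : ℕ} (i : Fin (N - 1)) : Fin N := ⟨i + 1, by omega⟩

/-- The simple transposition `s_i` exchanging `i` and `i + 1`. -/
def simpleRefl {N : ℕ} (i : Fin (N - 1)) : Equiv.Perm (Fin N) := Equiv.swap (lo i) (hi i)

/-- Free generators: `Sum.inl w` for a permutation `w`, `Sum.inr j` for the coordinate vector
`ε_j^∨` of the Cartan subalgebra of `gl_N`. -/
abbrev HeckeGen (N : ℕ) : Type := FreeAlgebra ℂ (Equiv.Perm (Fin N) ⊕ Fin N)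

/-- The defining relations of the degenerate affine Hecke algebra: those of the group algebra of
the symmetric group, those of the polynomial algebra in the `ε_j^∨`, and
`s_i ξ - s_i(ξ) s_i = -α_i(ξ)` for `ξ = ε_j^∨`, where `α_i = ε_i - ε_{i+1}`. -/
inductive HeckeRel (N : ℕ) : HeckeGen N → HeckeGen N → Prop
  | one : HeckeRel N (FreeAlgebra.ι ℂ (Sum.inl 1)) 1
  | mul (w w' : Equiv.Perm (Fin N)) : HeckeRel N (FreeAlgebra.ι ℂ (Sum.inl (w * w')))
      (FreeAlgebra.ι ℂ (Sum.inl w) * FreeAlgebra.ι ℂ (Sum.inl w'))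
  | comm (j k : Fin N) : HeckeRel N
      (FreeAlgebra.ι ℂ (Sum.inr j) * FreeAlgebra.ι ℂ (Sum.inr k))
      (FreeAlgebra.ι ℂ (Sum.inr k) * FreeAlgebra.ι ℂ (Sum.inr j))
  | cross (i : Fin (N - 1)) (j : Fin N) : HeckeRel N
      (FreeAlgebra.ι ℂ (Sum.inl (simpleRefl i)) * FreeAlgebra.ι ℂ (Sum.inr j) -
        FreeAlgebra.ι ℂ (Sum.inr (simpleRefl i j)) * FreeAlgebra.ι ℂ (Sum.inl (simpleRefl i)))
      (-algebraMap ℂ (HeckeGen N) ((if j = lo i then 1 else 0) - (if j = hi i then 1 else 0)))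

/-- The degenerate affine Hecke algebra of `gl_N`. -/
abbrev Hecke (N : ℕ) : Type := RingQuot (HeckeRel N)

/-- The element of the Hecke algebra given by a permutation. -/
def permH {N : ℕ} (w : Equiv.Perm (Fin N)) : Hecke N :=
  RingQuot.mkAlgHom ℂ (HeckeRel N) (FreeAlgebra.ι ℂ (Sum.inl w))

/-- The element of the Hecke algebra given by `ε_j^∨`. -/
def epsH {N : ℕ} (j : Fin N) : Hecke N :=
  RingQuot.mkAlgHom ℂ (HeckeRel N) (FreeAlgebra.ι ℂ (Sum.inr j))

/-- The commutative subalgebra `S[t]` generated by the `ε_j^∨`. -/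
def polyH (N : ℕ) : Subalgebra ℂ (Hecke N) := Algebra.adjoin ℂ (Set.range epsH)

/-- The intertwiner `φ_i = 1 + s_i α_i^∨`. -/
def simpleIntertwiner {N : ℕ} (i : Fin (N - 1)) : Hecke N :=
  1 + permH (simpleRefl i) * (epsH (lo i) - epsH (hi i))

/-- The length of a permutation: its number of inversions. -/
def permLength {N : ℕ} (w : Equiv.Perm (Fin N)) : ℕ :=
  (Finset.univ.filter fun q : Fin N × Fin N => q.1 < q.2 ∧ w q.2 < w q.1).card

/-- The word `[j_1, …, j_l]` is a reduced expression `w = s_{j_1} ⋯ s_{j_l}`. -/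
def IsReducedWord {N : ℕ} (l : List (Fin (N - 1))) (w : Equiv.Perm (Fin N)) : Prop :=
  (l.map simpleRefl).prod = w ∧ l.length = permLength w

lemma simpleRefl_lt_iff {N : ℕ} (i : Fin (N - 1)) (a b : Fin N) (h : ¬(a = lo i ∧ b = hi i))
    (hab : a < b) : simpleRefl i a < simpleRefl i b := by
  have hlo : (lo i : Fin N).val = i := rfl
  have hhi : (hi i : Fin N).val = i + 1 := rfl
  simp only [simpleRefl, Equiv.swap_apply_def]
  simp only [Fin.ext_iff, Fin.lt_def] at *
  split_ifs <;> omega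

lemma permLength_mul_simpleRefl {N : ℕ} (w : Equiv.Perm (Fin N)) (i : Fin (N - 1))
    (h : w (hi i) < w (lo i)) : permLength w = permLength (w * simpleRefl i) + 1 := by
  have hlh : (lo i : Fin N) < hi i := by simp [lo, hi, Fin.lt_def]
  have hmem : (lo i, hi i) ∈ Finset.univ.filter
      fun q : Fin N × Fin N => q.1 < q.2 ∧ w q.2 < w q.1 := by simp [hlh, h]
  have hss : ∀ x, simpleRefl i (simpleRefl i x) = x := fun x => by simp [simpleRefl]
  have h1 : simpleRefl i (lo i) = hi i := by simp [simpleRefl]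
  have h2 : simpleRefl i (hi i) = lo i := by simp [simpleRefl]
  rw [permLength, permLength, ← Finset.card_erase_add_one hmem]
  congr 1
  refine Finset.card_bij' (fun q _ => (simpleRefl i q.1, simpleRefl i q.2))
    (fun q _ => (simpleRefl i q.1, simpleRefl i q.2)) ?_ ?_ ?_ ?_
  · rintro ⟨a, b⟩ hq
    simp only [Finset.mem_erase, Finset.mem_filter, Finset.mem_univ, true_and, ne_eq,
      Prod.mk.injEq] at hq ⊢
    simp only [Equiv.Perm.mul_apply, hss]
    exact ⟨simpleRefl_lt_iff i a b hq.1 hq.2.1, hq.2.2⟩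
  · rintro ⟨a, b⟩ hq
    simp only [Finset.mem_erase, Finset.mem_filter, Finset.mem_univ, true_and, ne_eq,
      Prod.mk.injEq] at hq ⊢
    simp only [Equiv.Perm.mul_apply] at hq
    have hne : ¬(a = lo i ∧ b = hi i) := by
      rintro ⟨rfl, rfl⟩
      rw [h1, h2] at hq
      exact lt_asymm h hq.2
    refine ⟨?_, simpleRefl_lt_iff i a b hne hq.1, hq.2⟩
    rintro ⟨ha, hb⟩
    have ha' : a = hi i := by rw [← hss a, ha, h1]
    have hb' : b = lo i := by rw [← hss b, hb, h2]
    rw [ha', hb'] at hq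
    exact lt_asymm hlh hq.1
  · rintro ⟨a, b⟩ _
    simp [hss]
  · rintro ⟨a, b⟩ _
    simp [hss]

lemma eq_one_of_monotone {N : ℕ} (w : Equiv.Perm (Fin N))
    (h : ∀ i : Fin (N - 1), w (lo i) ≤ w (hi i)) : w = 1 := by
  have hm : StrictMono w := by
    cases N with
    | zero => exact fun a => a.elim0
    | succ n =>
      refine Fin.strictMono_iff_lt_succ.2 fun i => lt_of_le_of_ne (h i) ?_
      exact fun e => (Fin.castSucc_lt_succ (i := i)).ne (w.injective e)
  ext x
  have := congrArg (fun e => e x) (Subsingleton.elim (hm.orderIsoOfSurjective _ w.surjective)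
    (OrderIso.refl (Fin N)))
  exact congrArg Fin.val this

/-- Every permutation has a reduced expression. -/
theorem exists_isReducedWord {N : ℕ} (w : Equiv.Perm (Fin N)) : ∃ l, IsReducedWord l w := by
  induction hn : permLength w generalizing w with
  | zero =>
    refine ⟨[], ?_, by simp [hn]⟩
    refine (eq_one_of_monotone w fun i => ?_).symm
    by_contra hlt
    have := permLength_mul_simpleRefl w i (not_le.1 hlt)
    omega
  | succ n ih =>
    have : ∃ i : Fin (N - 1), w (hi i) < w (lo i) := by
      by_contra hcon
      push Not at hcon
      have h1 := eq_one_of_monotone w hcon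
      have h0 : permLength (1 : Equiv.Perm (Fin N)) = 0 := by
        simp only [permLength, Finset.card_eq_zero, Finset.filter_eq_empty_iff]
        rintro ⟨a, b⟩ _ ⟨h, h'⟩
        exact lt_asymm h h'
      rw [h1, h0] at hn
      omega
    obtain ⟨i, hi'⟩ := this
    have hl := permLength_mul_simpleRefl w i hi'
    obtain ⟨l, hl1, hl2⟩ := ih (w * simpleRefl i) (by omega)
    refine ⟨l ++ [i], ?_, ?_⟩
    · rw [List.map_append, List.prod_append, hl1]
      simp [simpleRefl, mul_assoc]
    · simp only [List.length_append, List.length_singleton]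
      omega

/-- The product `φ_{j_1} ⋯ φ_{j_l}`, which is the intertwiner `φ_w` if `[j_1, …, j_l]` is a
reduced expression of `w`. -/
def wordIntertwiner {N : ℕ} (l : List (Fin (N - 1))) : Hecke N := (l.map simpleIntertwiner).prod

/-! ### The functor `F(A, B) = (A ⊗ V^{⊗N} ⊗ B) / sl_m` -/

/-- `V^{⊗N}` for the vector representation `V = ℂ^m`. -/
abbrev VPow (m N : ℕ) : Type := PiTensorProduct ℂ fun _ : Fin N => (Fin m → ℂ)

section Functor

variable {m : ℕ} (N : ℕ) (A B : Type) [AddCommGroup A] [Module ℂ A] [Module (Usl m) A]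
  [IsScalarTower ℂ (Usl m) A] [AddCommGroup B] [Module ℂ B] [Module (Usl m) B]
  [IsScalarTower ℂ (Usl m) B]

/-- `A ⊗ V^{⊗N} ⊗ B`. -/
abbrev Tens (m N : ℕ) (A B : Type) [AddCommGroup A] [Module ℂ A] [AddCommGroup B] [Module ℂ B] :
    Type :=
  A ⊗[ℂ] (VPow m N ⊗[ℂ] B)

/-- The action of `x` on an `sl_m`-module. -/
def act (x : Slm m) : Module.End ℂ A := Algebra.lsmul ℂ ℂ A (toU x)

/-- The action of `x` on the `i`-th factor of `V^{⊗N}`. -/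
def actV (i : Fin N) (x : Slm m) : Module.End ℂ (VPow m N) :=
  PiTensorProduct.map (Function.update (fun _ => LinearMap.id) i (Matrix.mulVecLin x.1))

/-- The action `θ_j(x)` of `x` on the `j`-th factor of `A ⊗ V^{⊗N} ⊗ B`, `j = 0, …, N + 1`. -/
def theta (x : Slm m) : Fin (N + 2) → Module.End ℂ (Tens m N A B) :=
  Fin.cons (TensorProduct.map (act A x) LinearMap.id)
    (Fin.snoc
      (fun i : Fin N => TensorProduct.map LinearMap.id
        (TensorProduct.map (actV N i x) LinearMap.id))
      (TensorProduct.map LinearMap.id (TensorProduct.map LinearMap.id (act B x))))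

/-- The image `θ_{jk}(r)` of the classical `r`-matrix
`r = (1/2) ∑_a x_a ⊗ x_a + ∑_{a < b} E_ab ⊗ E_ba`.
Here `∑_a x_a ⊗ x_a` is the canonical element of the trace form on the Cartan subalgebra,
i.e. `∑ H ⊗ H` over any orthonormal basis. -/
def rMat (j k : Fin (N + 2)) : Module.End ℂ (Tens m N A B) :=
  (1 / 2 : ℂ) • ∑ a : Fin m, theta N A B (xCartan a).1 j * theta N A B (xCartan a).1 k +
  ∑ q : {q : Fin m × Fin m // q.1 < q.2},
    theta N A B (SpecialLinear.single q.1.1 q.1.2 q.2.ne 1) j *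
      theta N A B (SpecialLinear.single q.1.2 q.1.1 q.2.ne' 1) k

/-- The position of the `i`-th factor of `V^{⊗N}` among the `N + 2` factors `0, …, N + 1`. -/
def pos {N : ℕ} (i : Fin N) : Fin (N + 2) := i.castSucc.succ

/-- The operator
`D_i = ∑_{j < i} (θ_{ji}(r) + 1/(2m)) - ∑_{i < j} (θ_{ij}(r) + 1/(2m)) + θ_i(ρ^∨)`. -/
def opD (i : Fin N) : Module.End ℂ (Tens m N A B) :=
  ∑ j : {j : Fin (N + 2) // j < pos i}, (rMat N A B j.1 (pos i) + (1 / (2 * m : ℂ)) • 1) -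
  ∑ j : {j : Fin (N + 2) // pos i < j}, (rMat N A B (pos i) j.1 + (1 / (2 * m : ℂ)) • 1) +
  theta N A B (rhoCheck m) (pos i)

/-- The place permutation `v_1 ⊗ ⋯ ⊗ v_N ↦ v_{w⁻¹(1)} ⊗ ⋯ ⊗ v_{w⁻¹(N)}`, identity on `A`
and `B`. -/
def opPerm (m : ℕ) {N : ℕ} (A B : Type) [AddCommGroup A] [Module ℂ A] [AddCommGroup B]
    [Module ℂ B] (w : Equiv.Perm (Fin N)) : Module.End ℂ (Tens m N A B) :=
  TensorProduct.map LinearMap.id (TensorProduct.map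
    (PiTensorProduct.reindex ℂ (fun _ : Fin N => (Fin m → ℂ)) w).toLinearMap LinearMap.id)

/-- The subspace `sl_m (A ⊗ V^{⊗N} ⊗ B)`, for the diagonal action. -/
def diagImage : Submodule ℂ (Tens m N A B) :=
  Submodule.span ℂ {y | ∃ (x : Slm m) (v : Tens m N A B), y = ∑ j, theta N A B x j v}

/-- `F(A, B) = (A ⊗ V^{⊗N} ⊗ B) / sl_m`. -/
abbrev Func : Type := Tens m N A B ⧸ diagImage (m := m) N A B

/-- The class in `F(A, B)` of an element of `A ⊗ V^{⊗N} ⊗ B`. -/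
def cls (v : Tens m N A B) : Func (m := m) N A B := Submodule.Quotient.mk v

/-- The given module structure over the degenerate affine Hecke algebra on `F(A, B)` extends the
`ℂ`-structure and is the one in which `ε_i^∨` acts through `D_i` and a permutation acts by
permuting the factors of `V^{⊗N}`. There is at most one such structure. -/
structure IsHeckeAction [Module (Hecke N) (Func (m := m) N A B)] : Prop where
  tower : IsScalarTower ℂ (Hecke N) (Func (m := m) N A B)
  eps_smul : ∀ (i : Fin N) (v : Tens m N A B),
    epsH i • cls (m := m) N A B v = cls (m := m) N A B (opD N A B i v)
  perm_smul : ∀ (w : Equiv.Perm (Fin N)) (v : Tens m N A B),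
    permH w • cls (m := m) N A B v = cls (m := m) N A B (opPerm m A B w v)

end Functor

/-- `M(λ, μ) = F(M(μ), M†(λ))`. -/
abbrev MBar {m : ℕ} (N : ℕ) (lam μ : Weight m) : Type :=
  Func (m := m) N (Verma μ) (VermaLow lam)

/-- `V(λ, μ) = F(M(μ), L†(λ))`. -/
abbrev VBar {m : ℕ} (N : ℕ) (lam μ : Weight m) : Type :=
  Func (m := m) N (Verma μ) (IrrLow lam)

/-! ### Skew diagrams and tableaux -/

/-- Cells of the skew diagram: `⟨a, k⟩` stands for the cell `(a, μ_a + k)`, where `a = 1, …, m` and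
`k = 1, …, β_a` (both counted from `0` in the code). -/
abbrev Cell {m : ℕ} (β : Fin m → ℕ) : Type := (a : Fin m) × Fin (β a)

/-- The second coordinate `p = μ_a + k` of a cell. -/
def cellP {m : ℕ} (μ : Weight m) {β : Fin m → ℕ} (c : Cell β) : ℂ :=
  wcoord μ c.1 + ((c.2 : ℕ) + 1 : ℂ)

/-- A tableau: a bijection from the cells to `{1, …, N}` (counted from `0` in the code). -/
abbrev Tableau {m : ℕ} (N : ℕ) (β : Fin m → ℕ) : Type := Cell β ≃ Fin N

/-- Standard tableaux: `T(a, p) < T(a, p + 1)` and `T(a, p) < T(a + 1, p)` whenever both cells lie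
in the diagram. -/
def IsStandard {m N : ℕ} (μ : Weight m) {β : Fin m → ℕ} (T : Tableau N β) : Prop :=
  ∀ c c' : Cell β,
    (c'.1 = c.1 → cellP μ c' = cellP μ c + 1 → T c < T c') ∧
    ((c'.1 : ℕ) = c.1 + 1 → cellP μ c' = cellP μ c → T c < T c')

/-- The row reading tableau `T_0(a, p) = β_1 + ⋯ + β_{a-1} + p - μ_a`. -/
def rowTableau {m N : ℕ} (β : Fin m → ℕ) (hN : ∑ a, β a = N) : Tableau N β :=
  finSigmaFinEquiv.trans (finCongr hN)

/-- The permutation `w_T` with `T = w_T ∘ T_0`. -/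
def tabPerm {m N : ℕ} {β : Fin m → ℕ} (hN : ∑ a, β a = N) (T : Tableau N β) :
    Equiv.Perm (Fin N) :=
  (rowTableau β hN).symm.trans T

/-- The weight `ζ = ∑_{(a,p)} (p - a) ε_{T_0(a,p)} + (m² - N)/(2m) ∑_k ε_k`, in coordinates. -/
def zeta {m N : ℕ} (μ : Weight m) {β : Fin m → ℕ} (hN : ∑ a, β a = N) (k : Fin N) : ℂ :=
  (cellP μ ((rowTableau β hN).symm k) - ((((rowTableau β hN).symm k).1 : ℕ) + 1 : ℂ)) +
    ((m : ℂ) ^ 2 - N) / (2 * m)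

/-- The Young subgroup `W_β`: permutations preserving the rows of `T_0`. -/
def youngSubgroup {m N : ℕ} {β : Fin m → ℕ} (hN : ∑ a, β a = N) :
    Set (Equiv.Perm (Fin N)) :=
  {w | ∀ k, ((rowTableau β hN).symm (w k)).1 = ((rowTableau β hN).symm k).1}

/-- The cyclic vector `1_ζ` of `M(λ, μ)`: the class of
`v(μ) ⊗ u_1^{⊗β_1} ⊗ ⋯ ⊗ u_m^{⊗β_m} ⊗ v†(λ)`. -/
def cyclicVector {m N : ℕ} (lam μ : Weight m) {β : Fin m → ℕ} (hN : ∑ a, β a = N) :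
    MBar N lam μ :=
  cls (m := m) N (Verma μ) (VermaLow lam)
    (hwVector μ ⊗ₜ[ℂ]
      ((PiTensorProduct.tprod ℂ fun i : Fin N =>
        (Pi.single ((rowTableau β hN).symm i).1 1 : Fin m → ℂ)) ⊗ₜ[ℂ] lwVector lam))

/-- The map `A ⊗ V^{⊗N} ⊗ M†(λ) → A ⊗ V^{⊗N} ⊗ L†(λ)` induced by the projection
`M†(λ) → L†(λ)`, for `A = M(μ)`. -/
def tensProj {m : ℕ} (N : ℕ) (lam μ : Weight m) :
    Tens m N (Verma μ) (VermaLow lam) →ₗ[ℂ] Tens m N (Verma μ) (IrrLow lam) :=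
  TensorProduct.map LinearMap.id (TensorProduct.map LinearMap.id (toIrrLow lam))

end

end SkewHecke

namespace SkewHecke

open scoped TensorProduct
open LieAlgebra

attribute [local instance 100] LieRing.ofAssociativeRing

noncomputable section

/-! The operators are first put into invariant form. On coinvariants `∑_j r_{ji} = 0`, the term `j =
i` being half a Casimir scalar plus `ρ^∨`; eliminating the terms with `j < i` turns `D_i` into
`-∑_{i<j} P_ij - Ω_i` plus the scalar `(N - m²)/(2m)`, where `Ω_i` couples the `i`-th copy of `V` to
`B` through the canonical tensor (`mkQ_opD_wordTens`). These operators commute with `sl_m` and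
satisfy the relations of the degenerate affine Hecke algebra already on `A ⊗ V^{⊗N} ⊗ B`
(`opY_comm`, `opPerm_mul_opY`), so coinvariants carry the action.

Weights are studied on linear forms. Let `g` be a nonzero common eigenform of the `ε_i^∨` on
coinvariants. Absorb the last `V` into `B`, and take the largest letter `d` such that `u_d ⊗ b` is
outside the radical of `g`; this vector is of lowest weight modulo the radical, the last eigenvalue
can be read off, and induction applies. Thus `g` is nonzero on some `v(μ) ⊗ u_c ⊗ b`, and its
eigenvalues are those of the tableau of the word `c` (`exists_word_of_isEigenForm`,
`tabWeight_wordTableau`). For `B = L†(λ)` the raising operators are nilpotent on `b`, so `sl_2`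
theory makes every intermediate weight dominant, which says that this tableau is standard
(`isStandard_wordTableau`). For either choice of `B` only the row word has weight `ζ`, so a form of
weight `ζ` vanishing on `1_ζ` is zero (`form_eq_zero_of_zeta`).

The image of `1_ζ` in the quotient is nonzero because an explicit invariant form detects it. View
`μ` and `λ` as partitions. Column antisymmetrizers give extremal vectors in spaces of functions on
words, hence maps out of both Verma modules; the second map factors through `L†(λ)` because the
standard hermitian form on functions is definite (`map_eq_zero_of_notMem`). Contracting the letters
of the inner shape gives a form whose value on `1_ζ` is a count of words, hence nonzero
(`cls_ne_zero`).

The rest is the theory of intertwiners. One has `φ_i² = 1 - (ε_i^∨ - ε_{i+1}^∨)²`, and contents at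
two consecutive entries whose exchange keeps a tableau standard never differ by one, so `φ_i` is
invertible between the two weight spaces. Distinct standard tableaux have distinct weights
(`eq_of_tabWeight_eq`), whence independence of the `φ_{w_T} 1_ζ`. If they did not span, an eigenform
vanishing on their span would have the weight of a standard tableau, and its composite with
`φ_{w_T}` would be a nonzero form of weight `ζ` vanishing on `1_ζ` (`span_wordIntertwiner_eq_top`).
Simplicity and semisimplicity follow from this basis. Finally, every proper submodule of `M(λ, μ)`
is killed by a nonzero form of weight `ζ`; such forms are proportional, so two proper submodules
have a proper sum (`sup_ne_top`), and the maximal submodule is unique. -/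

/-! ### Matrix units of `sl_m` -/

/-- The projection `E_pq - (δ_pq / m) Id` of a matrix unit to `sl_m`. -/
def slUnit {m : ℕ} (p q : Fin m) : Slm m :=
  ⟨Matrix.single p q 1 - Matrix.scalar (Fin m) (if p = q then 1 / (m : ℂ) else 0), by
    have hm : (m : ℂ) ≠ 0 := by
      have := p.pos
      exact_mod_cast this.ne'
    change Matrix.trace (Matrix.single p q 1 -
      Matrix.scalar (Fin m) (if p = q then 1 / (m : ℂ) else 0)) = 0
    by_cases h : p = q
    · subst h
      simp [Matrix.trace_sub, Matrix.trace_single_eq_same, Matrix.scalar_apply,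
        Matrix.trace_diagonal, hm]
    · simp [h, Matrix.trace_single_eq_of_ne]⟩

lemma slUnit_apply {m : ℕ} (p q d e : Fin m) : (slUnit p q).1 d e =
    (if p = d ∧ q = e then 1 else 0) - (if p = q ∧ d = e then 1 / (m : ℂ) else 0) := by
  simp only [slUnit, Matrix.sub_apply, Matrix.scalar_apply, Matrix.diagonal_apply,
    Matrix.single_apply]
  by_cases h : p = q <;> by_cases h' : d = e <;> simp [h, h']

lemma slUnit_self {m : ℕ} (a : Fin m) : slUnit a a = (xCartan a).1 := by
  apply Subtype.ext
  ext d e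
  rw [slUnit_apply]
  change _ = Matrix.diagonal (fun b : Fin m => (if b = a then (1 : ℂ) else 0) - 1 / (m : ℂ)) d e
  rw [Matrix.diagonal_apply]
  by_cases h : d = e
  · subst h
    simp [eq_comm]
  · have : ¬(a = d ∧ a = e) := fun h' => h (h'.1.symm.trans h'.2)
    simp [h, this]

lemma slUnit_of_ne {m : ℕ} {a b : Fin m} (h : a ≠ b) :
    slUnit a b = SpecialLinear.single a b h (1 : ℂ) := by
  apply Subtype.ext
  ext d e
  rw [slUnit_apply, SpecialLinear.val_single, Matrix.single_apply]
  simp [h]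

lemma slm_ext {m : ℕ} {x y : Slm m} (h : ∀ d e, x.1 d e = y.1 d e) : x = y :=
  Subtype.ext (Matrix.ext h)

lemma sum_val {m : ℕ} {ι : Type*} (s : Finset ι) (f : ι → Slm m) (d e : Fin m) :
    (∑ i ∈ s, f i).1 d e = ∑ i ∈ s, (f i).1 d e := by
  rw [show (∑ i ∈ s, f i).1 = ∑ i ∈ s, (f i).1 from
    map_sum (LieSubalgebra.toSubmodule (SpecialLinear.sl (Fin m) ℂ)).subtype f s,
    Matrix.sum_apply]

lemma sum_slUnit_self {m : ℕ} : ∑ a : Fin m, slUnit a a = (0 : Slm m) := by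
  apply slm_ext
  intro d e
  rw [sum_val]
  simp only [slUnit_apply]
  rw [Finset.sum_sub_distrib]
  by_cases h : d = e
  · subst h
    have hm : (m : ℂ) ≠ 0 := by
      have := d.pos
      exact_mod_cast this.ne'
    simp [hm]
  · have : ∀ a, ¬(a = d ∧ a = e) := fun a h' => h (h'.1.symm.trans h'.2)
    simp [h, this]

lemma trace_eq_zero {m : ℕ} (x : Slm m) : ∑ p, x.1 p p = 0 := x.2

lemma eq_sum_slUnit {m : ℕ} (x : Slm m) : x = ∑ p, ∑ q, x.1 p q • slUnit p q := by
  apply slm_ext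
  intro d e
  simp only [sum_val]
  change _ = ∑ p, ∑ q, x.1 p q * (slUnit p q).1 d e
  simp only [slUnit_apply, mul_sub, Finset.sum_sub_distrib]
  have h1 : ∑ p, ∑ q, x.1 p q * (if p = d ∧ q = e then (1 : ℂ) else 0) = x.1 d e := by
    simp [ite_and]
  have h2 : ∑ p, ∑ q, x.1 p q * (if p = q ∧ d = e then 1 / (m : ℂ) else 0) = 0 := by
    simp only [ite_and, mul_ite, mul_zero, Finset.sum_ite_eq, Finset.mem_univ, if_true]
    split_ifs
    · rw [← Finset.sum_mul, trace_eq_zero, zero_mul]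
    · simp
  rw [h1, h2, sub_zero]

lemma lie_val {m : ℕ} (x y : Slm m) (d e : Fin m) :
    (⁅x, y⁆ : Slm m).1 d e = ∑ k, (x.1 d k * y.1 k e - y.1 d k * x.1 k e) := by
  rw [LieSubalgebra.coe_bracket, LieRing.of_associative_ring_bracket, Matrix.sub_apply,
    Matrix.mul_apply, Matrix.mul_apply, Finset.sum_sub_distrib]

/-- This is the formula for matrix units of `gl_m`: the trace corrections of the two sums on the
right are both `x_qp / m` times the identity and cancel. -/
lemma lie_slUnit {m : ℕ} (x : Slm m) (p q : Fin m) :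
    ⁅x, slUnit p q⁆ = ∑ e, x.1 e p • slUnit e q - ∑ e, x.1 q e • slUnit p e := by
  apply slm_ext
  intro d f
  rw [lie_val]
  change _ = (∑ e, x.1 e p • slUnit e q).1 d f - (∑ e, x.1 q e • slUnit p e).1 d f
  simp only [sum_val]
  change _ = ∑ e, x.1 e p * (slUnit e q).1 d f - ∑ e, x.1 q e * (slUnit p e).1 d f
  simp only [slUnit_apply, mul_sub, sub_mul, Finset.sum_sub_distrib, ite_and, ite_mul, mul_ite,
    zero_mul, mul_zero, Finset.sum_ite_eq, Finset.sum_ite_eq', Finset.mem_univ, if_true, mul_one,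
    one_mul, Finset.sum_ite_irrel, Finset.sum_const_zero]
  by_cases h : p = q <;> by_cases h1 : p = d <;> by_cases h2 : q = f <;> simp [h, h1, h2] <;> ring_nf

lemma lie_slUnit_slUnit {m : ℕ} (a b p q : Fin m) : ⁅(slUnit a b : Slm m), slUnit p q⁆ =
    (if b = p then slUnit a q else 0) - (if q = a then slUnit p b else 0) := by
  rw [lie_slUnit]
  simp only [slUnit_apply, sub_smul, Finset.sum_sub_distrib, ite_and, ite_smul, one_smul,
    zero_smul, Finset.sum_ite_eq, Finset.sum_ite_eq', Finset.mem_univ, if_true,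
    Finset.sum_ite_irrel, Finset.sum_const_zero]
  rcases eq_or_ne a b with rfl | h
  · simp only [if_true]
    rcases eq_or_ne q a with rfl | h2
    · simp
    · simp [h2, h2.symm]
  · rcases eq_or_ne q a with rfl | h2
    · simp [h]
    · simp [h, h2, h2.symm]

/-- `∑_{p,q} (E_pq)_{de} E_qp = E_ed` in `sl_m`. -/
lemma sum_slUnit_apply_smul {m : ℕ} (d e : Fin m) :
    ∑ p, ∑ q, (slUnit p q).1 d e • slUnit q p = (slUnit e d : Slm m) := by
  simp only [slUnit_apply, sub_smul, Finset.sum_sub_distrib, ite_and, ite_smul, one_smul,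
    zero_smul, Finset.sum_ite_eq, Finset.sum_ite_eq', Finset.mem_univ, if_true,
    Finset.sum_ite_irrel, Finset.sum_const_zero]
  -- The trace correction of the coefficients contributes a multiple of `∑_a (E_aa - 1/m)`, which is
  -- zero.
  rw [← Finset.smul_sum, sum_slUnit_self]
  simp

/-! ### Tensors attached to words -/

/-- The basis tensor `u_{c_1} ⊗ ⋯ ⊗ u_{c_N}` of `V^{⊗N}` attached to a word `c`. -/
def wordVec {m N : ℕ} (c : Fin N → Fin m) : VPow m N :=
  PiTensorProduct.tprod ℂ fun i : Fin N => (Pi.single (c i) 1 : Fin m → ℂ)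

lemma vpow_ext {m N : ℕ} {E : Type*} [AddCommGroup E] [Module ℂ E] {f g : VPow m N →ₗ[ℂ] E}
    (h : ∀ c, f (wordVec c) = g (wordVec c)) : f = g := by
  apply PiTensorProduct.ext
  refine Module.Basis.ext_multilinear (fun _ => Pi.basisFun ℂ (Fin m)) fun v => ?_
  simpa [wordVec] using h v

section

variable {m N : ℕ} {A B : Type} [AddCommGroup A] [Module ℂ A] [AddCommGroup B] [Module ℂ B]

/-- The tensor `a ⊗ u_c ⊗ b`. -/
def wordTens (a : A) (c : Fin N → Fin m) (b : B) : Tens m N A B := a ⊗ₜ[ℂ] (wordVec c ⊗ₜ[ℂ] b)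

/-- Tensors with a word in the middle span, so identities between operators reduce to manipulations
of words and of Lie algebra elements acting on the two ends. -/
lemma tens_ext {E : Type*} [AddCommGroup E] [Module ℂ E] {f g : Tens m N A B →ₗ[ℂ] E}
    (h : ∀ a c b, f (wordTens a c b) = g (wordTens a c b)) : f = g := by
  apply TensorProduct.ext
  ext1 a
  apply TensorProduct.ext
  apply vpow_ext
  intro c
  ext1 b
  exact h a c b

lemma wordTens_sum_right {ι : Type*} (s : Finset ι) (a : A) (c : Fin N → Fin m) (b : ι → B) :
    wordTens a c (∑ i ∈ s, b i) = ∑ i ∈ s, wordTens a c (b i) := by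
  simp only [wordTens, TensorProduct.tmul_sum]

lemma wordTens_smul_left (r : ℂ) (a : A) (c : Fin N → Fin m) (b : B) :
    wordTens (r • a) c b = r • wordTens a c b := by
  simp only [wordTens, TensorProduct.smul_tmul']

lemma wordTens_smul_right (r : ℂ) (a : A) (c : Fin N → Fin m) (b : B) :
    wordTens a c (r • b) = r • wordTens a c b := by
  simp only [wordTens, TensorProduct.tmul_smul]

lemma wordTens_add_left (a a' : A) (c : Fin N → Fin m) (b : B) :
    wordTens (a + a') c b = wordTens a c b + wordTens a' c b := by
  simp only [wordTens, TensorProduct.add_tmul]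

lemma wordTens_add_right (a : A) (c : Fin N → Fin m) (b b' : B) :
    wordTens a c (b + b') = wordTens a c b + wordTens a c b' := by
  simp only [wordTens, TensorProduct.tmul_add]

lemma wordTens_sub_right (a : A) (c : Fin N → Fin m) (b b' : B) :
    wordTens a c (b - b') = wordTens a c b - wordTens a c b' :=
  (congrArg _ (TensorProduct.tmul_sub _ b b')).trans (TensorProduct.tmul_sub a _ _)

lemma wordTens_zero_right (a : A) (c : Fin N → Fin m) : wordTens a c (0 : B) = 0 := by
  simp only [wordTens, TensorProduct.tmul_zero]

lemma opPerm_wordTens (w : Equiv.Perm (Fin N)) (a : A) (c : Fin N → Fin m) (b : B) :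
    opPerm m A B w (wordTens a c b) = wordTens a (c ∘ w.symm) b := by
  simp only [opPerm, wordTens, TensorProduct.map_tmul, wordVec, LinearMap.id_apply,
    LinearEquiv.coe_coe, PiTensorProduct.reindex_tprod]
  rfl

end

lemma actV_wordVec {m N : ℕ} (i : Fin N) (x : Slm m) (c : Fin N → Fin m) :
    actV N i x (wordVec c) = ∑ d, x.1 d (c i) • wordVec (Function.update c i d) := by
  rw [actV, wordVec, PiTensorProduct.map_tprod]
  have h1 : (fun j : Fin N => (Function.update (fun _ => LinearMap.id) i (Matrix.mulVecLin x.1) :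
      Fin N → (Fin m → ℂ) →ₗ[ℂ] (Fin m → ℂ)) j (Pi.single (c j) 1)) =
      Function.update (fun j => (Pi.single (c j) 1 : Fin m → ℂ)) i
        (∑ d, x.1 d (c i) • (Pi.single d 1 : Fin m → ℂ)) := by
    funext j
    by_cases h : j = i
    · subst h
      simp only [Function.update_self, Matrix.mulVecLin_apply]
      ext e
      simp [Finset.sum_apply, Pi.single_apply]
    · simp [Function.update_of_ne h]
  rw [h1, MultilinearMap.map_update_sum]
  refine Finset.sum_congr rfl fun d _ => ?_
  rw [MultilinearMap.map_update_smul, wordVec]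
  congr 2
  funext j
  by_cases h : j = i
  · subst h; simp
  · simp [Function.update_of_ne h]

/-! ### The diagonal action and the invariant operators `-∑_{i<j} P_ij - Ω_i` -/

section

variable {m : ℕ} (N : ℕ) (A B : Type) [AddCommGroup A] [Module ℂ A] [Module (Usl m) A]
  [IsScalarTower ℂ (Usl m) A] [AddCommGroup B] [Module ℂ B] [Module (Usl m) B]
  [IsScalarTower ℂ (Usl m) B]

/-- The action of `sl_m` on a module over its enveloping algebra, as a homomorphism of Lie
algebras. -/
def actHom : Slm m →ₗ⁅ℂ⁆ Module.End ℂ A :=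
  ((Algebra.lsmul ℂ ℂ A : Usl m →ₐ[ℂ] Module.End ℂ A) : Usl m →ₗ⁅ℂ⁆ Module.End ℂ A).comp
    (UniversalEnvelopingAlgebra.ι ℂ)

lemma act_eq (x : Slm m) : act A x = actHom A x := rfl

lemma actHom_apply (x : Slm m) (a : A) : actHom A x a = toU x • a := rfl

variable {N A B}

lemma theta_zero (x : Slm m) (a : A) (c : Fin N → Fin m) (b : B) :
    theta N A B x 0 (wordTens a c b) = wordTens (actHom A x a) c b := by
  simp only [theta, Fin.cons_zero, wordTens, TensorProduct.map_tmul, LinearMap.id_apply, act_eq]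

lemma theta_pos (x : Slm m) (i : Fin N) (a : A) (c : Fin N → Fin m) (b : B) :
    theta N A B x (pos i) (wordTens a c b) =
      ∑ d, x.1 d (c i) • wordTens a (Function.update c i d) b := by
  simp only [theta, pos, Fin.cons_succ, Fin.snoc_castSucc, wordTens, TensorProduct.map_tmul,
    LinearMap.id_apply, actV_wordVec, TensorProduct.sum_tmul, TensorProduct.tmul_sum,
    ← TensorProduct.smul_tmul', TensorProduct.tmul_smul]

lemma theta_last (x : Slm m) (a : A) (c : Fin N → Fin m) (b : B) :
    theta N A B x (Fin.last (N + 1)) (wordTens a c b) = wordTens a c (actHom B x b) := by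
  rw [← Fin.succ_last]
  simp only [theta, Fin.cons_succ, Fin.snoc_last, wordTens, TensorProduct.map_tmul,
    LinearMap.id_apply, act_eq]

lemma sum_positions {E : Type*} [AddCommMonoid E] (F : Fin (N + 2) → E) :
    ∑ j, F j = F 0 + ∑ i : Fin N, F (pos i) + F (Fin.last (N + 1)) := by
  rw [Fin.sum_univ_succ, Fin.sum_univ_castSucc, Fin.succ_last]
  exact (add_assoc _ _ _).symm

/-- The diagonal action of `sl_m` on `A ⊗ V^{⊗N} ⊗ B`. -/
def diagAct (x : Slm m) : Module.End ℂ (Tens m N A B) := ∑ j, theta N A B x j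

lemma diagAct_wordTens (x : Slm m) (a : A) (c : Fin N → Fin m) (b : B) :
    diagAct x (wordTens a c b) = wordTens (actHom A x a) c b +
      ∑ i, ∑ d, x.1 d (c i) • wordTens a (Function.update c i d) b +
      wordTens a c (actHom B x b) := by
  rw [diagAct, LinearMap.sum_apply, sum_positions, theta_zero, theta_last]
  simp only [theta_pos]

lemma diagAct_mem (x : Slm m) (v : Tens m N A B) : diagAct x v ∈ diagImage (m := m) N A B :=
  Submodule.subset_span ⟨x, v, by rw [diagAct, LinearMap.sum_apply]⟩

lemma diagImage_le {P : Submodule ℂ (Tens m N A B)} (h : ∀ (x : Slm m) v, diagAct x v ∈ P) :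
    diagImage (m := m) N A B ≤ P := by
  refine Submodule.span_le.2 ?_
  rintro _ ⟨x, v, rfl⟩
  have := h x v
  rwa [diagAct, LinearMap.sum_apply] at this

variable (N A B)

/-- The Casimir-type operator coupling the `i`-th factor of `V^{⊗N}` to `B`. -/
def opOmega (i : Fin N) : Module.End ℂ (Tens m N A B) :=
  ∑ p, ∑ q, theta N A B (slUnit p q) (pos i) * theta N A B (slUnit q p) (Fin.last (N + 1))

/-- The normalized operator `- ∑_{i < j} P_ij - Ω_i`. -/
def opY (i : Fin N) : Module.End ℂ (Tens m N A B) :=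
  - ∑ j ∈ Finset.univ.filter (i < ·), opPerm m A B (Equiv.swap i j) - opOmega N A B i

variable {N A B}

/-- Since `∑_{p,q} (E_pq)_{d,e} E_qp = E_ed` in `sl_m`, the double sum over matrix units collapses:
the letter `c_i` is replaced by `d` while `E_{c_i,d}` acts on `B`. Trace corrections then survive
only inside `slUnit`. -/
lemma opOmega_wordTens (i : Fin N) (a : A) (c : Fin N → Fin m) (b : B) :
    opOmega N A B i (wordTens a c b) =
      ∑ d, wordTens a (Function.update c i d) (actHom B (slUnit (c i) d) b) := by
  simp only [opOmega, LinearMap.sum_apply, Module.End.mul_apply, theta_last, theta_pos]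
  simp_rw [← wordTens_smul_right]
  have : ∀ p, ∑ q, ∑ d, wordTens a (Function.update c i d)
      ((slUnit p q).1 d (c i) • actHom B (slUnit q p) b) =
      ∑ d, ∑ q, wordTens a (Function.update c i d)
      ((slUnit p q).1 d (c i) • actHom B (slUnit q p) b) := fun p => Finset.sum_comm
  simp_rw [this]
  rw [Finset.sum_comm]
  refine Finset.sum_congr rfl fun d _ => ?_
  simp_rw [← wordTens_sum_right]
  congr 1
  rw [← sum_slUnit_apply_smul d (c i)]
  simp only [map_sum, map_smul, LinearMap.sum_apply, LinearMap.smul_apply]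

lemma opY_wordTens (i : Fin N) (a : A) (c : Fin N → Fin m) (b : B) :
    opY N A B i (wordTens a c b) =
      - ∑ j ∈ Finset.univ.filter (i < ·), wordTens a (c ∘ Equiv.swap i j) b -
      ∑ d, wordTens a (Function.update c i d) (actHom B (slUnit (c i) d) b) := by
  simp only [opY, LinearMap.sub_apply, LinearMap.neg_apply, LinearMap.sum_apply, opPerm_wordTens,
    opOmega_wordTens, Equiv.symm_swap]

end

/-! ### Relations between the operators on `A ⊗ V^{⊗N} ⊗ B` -/

lemma one_eq_neg_smul {R : Type*} [Ring R] [Module ℂ R] : (1 : R) = -((0 - 1 : ℂ) • (1 : R)) := by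
  rw [zero_sub, neg_smul, one_smul, neg_neg]

/-- Meant for `a = ∑_{i<j} P_ij`, `b = Ω_i`, `c = ∑_{k<j} P_kj`, `d = Ω_k`, `p = P_ik`: the
commutators `[a, d]` and `[b, d]` are opposite to each other, and the other two vanish. -/
lemma neg_sub_mul_comm {R : Type*} [Ring R] {a b c d p : R} (h1 : a * c = c * a)
    (h2 : b * c = c * b) (h3 : a * d - d * a = p * d - d * p)
    (h4 : b * d - d * b = d * p - p * d) : (-a - b) * (-c - d) = (-c - d) * (-a - b) := by
  rw [← sub_eq_zero] at h1 h2 h3 h4 ⊢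
  have h5 := congrArg₂ (· + ·) (congrArg₂ (· + ·) h1 h2) (congrArg₂ (· + ·) h3 h4)
  simp only [add_zero] at h5
  rw [← h5]
  noncomm_ring

lemma neg_sub_mul_comm' {R : Type*} [Ring R] {a b c : R} (h1 : a * c = c * a)
    (h2 : b * c = c * b) : (-a - b) * c = c * (-a - b) := by
  rw [sub_mul, mul_sub, neg_mul, mul_neg, h1, h2]

lemma mul_neg_sub_sub {R : Type*} [Ring R] {s a b a' b' z : R} (h1 : s * a = z + a' * s)
    (h2 : s * b = b' * s) : s * (-a - b) - (-a' - b') * s = -z := by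
  rw [mul_sub, mul_neg, h1, h2]
  noncomm_ring

lemma mul_sub_mul_of_involution {R : Type*} [Ring R] {s y y' : R} (hs : s * s = 1)
    (h : s * y - y' * s = -1) : s * y' - y * s = 1 := by
  have h2 := congrArg (fun T => s * T * s) h
  simp only [mul_sub, sub_mul, ← mul_assoc, hs, one_mul, mul_neg, neg_mul, mul_one] at h2
  rw [mul_assoc, mul_assoc, hs, mul_one] at h2
  rw [← neg_sub, h2, neg_neg]

section

variable {m N : ℕ} {A B : Type} [AddCommGroup A] [Module ℂ A] [AddCommGroup B] [Module ℂ B]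

lemma opPerm_one : opPerm m A B (1 : Equiv.Perm (Fin N)) = 1 := by
  apply tens_ext
  intro a c b
  rw [opPerm_wordTens]
  rfl

lemma opPerm_mul (w w' : Equiv.Perm (Fin N)) :
    opPerm m A B (w * w') = opPerm m A B w * opPerm m A B w' := by
  apply tens_ext
  intro a c b
  rw [Module.End.mul_apply, opPerm_wordTens, opPerm_wordTens, opPerm_wordTens]
  rfl

/-- The Jucys–Murphy type sum `∑_{i < j} P_ij`. -/
def opJM (m : ℕ) {N : ℕ} (A B : Type) [AddCommGroup A] [Module ℂ A] [AddCommGroup B]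
    [Module ℂ B] (i : Fin N) : Module.End ℂ (Tens m N A B) :=
  ∑ j ∈ Finset.univ.filter (i < ·), opPerm m A B (Equiv.swap i j)

lemma perm_mul_swap (w : Equiv.Perm (Fin N)) (i j : Fin N) :
    w * Equiv.swap i j = Equiv.swap (w i) (w j) * w := Equiv.mul_swap_eq_swap_mul w i j

lemma opPerm_mul_opJM (w : Equiv.Perm (Fin N)) (i : Fin N) (h1 : w i = i)
    (h2 : ∀ j, i < j ↔ i < w j) :
    opPerm m A B w * opJM m A B i = opJM m A B i * opPerm m A B w := by
  rw [opJM, Finset.mul_sum, Finset.sum_mul]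
  refine Finset.sum_equiv w (by simpa using h2) fun j _ => ?_
  rw [← opPerm_mul, ← opPerm_mul, perm_mul_swap, h1]

lemma swap_lt_iff {i k l : Fin N} (hk : i < k) (hl : i < l) (j : Fin N) :
    i < j ↔ i < Equiv.swap k l j := by
  rw [Equiv.swap_apply_def]
  split_ifs with h1 h2
  · subst h1; exact iff_of_true hk hl
  · subst h2; exact iff_of_true hl hk
  · rfl

/-- For `i < k < l` the transposition of `k` and `l` fixes `i` and permutes the positions after `i`,
so every term of the `k`-th sum commutes with the whole `i`-th sum. -/
lemma opJM_comm {i k : Fin N} (h : i < k) :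
    opJM m A B i * opJM m A B k = opJM m A B k * opJM m A B i := by
  conv_lhs => rw [opJM.eq_def m A B k]
  conv_rhs => rw [opJM.eq_def m A B k]
  rw [Finset.mul_sum, Finset.sum_mul]
  refine Finset.sum_congr rfl fun l hl => ?_
  have hl : k < l := by simpa using hl
  exact (opPerm_mul_opJM _ _ (Equiv.swap_apply_of_ne_of_ne h.ne (h.trans hl).ne)
    (swap_lt_iff h (h.trans hl))).symm

end

section

variable {m N : ℕ} {A B : Type} [AddCommGroup A] [Module ℂ A] [Module (Usl m) A]
  [IsScalarTower ℂ (Usl m) A] [AddCommGroup B] [Module ℂ B] [Module (Usl m) B]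
  [IsScalarTower ℂ (Usl m) B]

lemma update_comp_perm (w : Equiv.Perm (Fin N)) (c : Fin N → Fin m) (i : Fin N) (d : Fin m) :
    Function.update c i d ∘ w.symm = Function.update (c ∘ w.symm) (w i) d := by
  funext j
  by_cases h : j = w i
  · subst h; simp
  · have : w.symm j ≠ i := fun h' => h (by rw [← h', Equiv.apply_symm_apply])
    simp [Function.update_of_ne h, Function.update_of_ne this]

lemma opPerm_mul_diagAct (w : Equiv.Perm (Fin N)) (x : Slm m) :
    opPerm m A B w * diagAct x = diagAct x * opPerm m A B w := by
  apply tens_ext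
  intro a c b
  simp only [Module.End.mul_apply, diagAct_wordTens, opPerm_wordTens, map_add, map_sum, map_smul]
  congr 2
  refine Finset.sum_equiv w (by simp) fun i _ => ?_
  simp [update_comp_perm]

lemma opPerm_mul_opOmega (w : Equiv.Perm (Fin N)) (i : Fin N) :
    opPerm m A B w * opOmega N A B i = opOmega N A B (w i) * opPerm m A B w := by
  apply tens_ext
  intro a c b
  simp only [Module.End.mul_apply, opOmega_wordTens, opPerm_wordTens, map_sum]
  simp [update_comp_perm]

lemma opOmega_mul_opJM {i k : Fin N} (h : i < k) :
    opOmega N A B i * opJM m A B k = opJM m A B k * opOmega N A B i := by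
  rw [opJM, Finset.mul_sum, Finset.sum_mul]
  refine Finset.sum_congr rfl fun l hl => ?_
  have hl : k < l := by simpa using hl
  rw [opPerm_mul_opOmega, Equiv.swap_apply_of_ne_of_ne h.ne (h.trans hl).ne]

/-- Only the summand `P_ik` moves the position `k`; all the others commute with `Ω_k`. -/
lemma opJM_mul_opOmega {i k : Fin N} (h : i < k) :
    opJM m A B i * opOmega N A B k - opOmega N A B k * opJM m A B i =
      opPerm m A B (Equiv.swap i k) * opOmega N A B k -
        opOmega N A B k * opPerm m A B (Equiv.swap i k) := by
  rw [opJM, Finset.mul_sum, Finset.sum_mul, ← Finset.sum_sub_distrib]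
  refine Finset.sum_eq_single_of_mem k (by simpa using h) fun j _ hj => ?_
  rw [opPerm_mul_opOmega, Equiv.swap_apply_of_ne_of_ne h.ne' hj.symm, sub_self]

lemma comp_swap_update_left {i k : Fin N} (h : i ≠ k) (c : Fin N → Fin m) (d : Fin m) :
    Function.update (c ∘ Equiv.swap i k) k d =
      Function.update (Function.update c k d) i (c k) := by
  funext j
  by_cases h1 : j = k
  · subst h1; simp [h.symm]
  · by_cases h2 : j = i
    · subst h2; simp [h]
    · simp [h1, h2, Equiv.swap_apply_of_ne_of_ne h2 h1]

lemma update_comp_swap_right {i k : Fin N} (h : i ≠ k) (c : Fin N → Fin m) (d : Fin m) :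
    Function.update c k d ∘ Equiv.swap i k =
      Function.update (Function.update c k (c i)) i d := by
  funext j
  by_cases h1 : j = k
  · subst h1; simp [h, h.symm]
  · by_cases h2 : j = i
    · subst h2; simp
    · simp [h1, h2, Equiv.swap_apply_of_ne_of_ne h2 h1]

/-- The infinitesimal braid relation. The two products differ by a bracket of matrix units acting on
`B`; each of its two terms contracts an index, which amounts to one `Ω_k` composed with the exchange
of the positions `i` and `k`. -/
lemma opOmega_mul_opOmega {i k : Fin N} (h : i ≠ k) :
    opOmega N A B i * opOmega N A B k - opOmega N A B k * opOmega N A B i =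
      opOmega N A B k * opPerm m A B (Equiv.swap i k) -
        opPerm m A B (Equiv.swap i k) * opOmega N A B k := by
  apply tens_ext
  intro a c b
  simp only [Module.End.mul_apply, LinearMap.sub_apply, opOmega_wordTens, opPerm_wordTens, map_sum,
    Equiv.symm_swap, comp_swap_update_left h, update_comp_swap_right h, Function.comp_apply,
    Equiv.swap_apply_right, Function.update_of_ne h, Function.update_of_ne h.symm]
  have h1 : ∑ d, ∑ e, wordTens a (Function.update (Function.update c i d) k e)
      (actHom B (slUnit (c k) e) (actHom B (slUnit (c i) d) b)) =
      ∑ d, ∑ e, wordTens a (Function.update (Function.update c k d) i e)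
      (actHom B (slUnit (c k) d) (actHom B (slUnit (c i) e) b)) := by
    rw [Finset.sum_comm]
    refine Finset.sum_congr rfl fun d _ => Finset.sum_congr rfl fun e _ => ?_
    rw [Function.update_comm h]
  rw [h1, ← Finset.sum_sub_distrib]
  have h2 : ∀ d e, wordTens a (Function.update (Function.update c k d) i e)
        (actHom B (slUnit (c i) e) (actHom B (slUnit (c k) d) b)) -
      wordTens a (Function.update (Function.update c k d) i e)
        (actHom B (slUnit (c k) d) (actHom B (slUnit (c i) e) b)) =
      (if e = c k then wordTens a (Function.update (Function.update c k d) i e)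
        (actHom B (slUnit (c i) d) b) else 0) -
      (if d = c i then wordTens a (Function.update (Function.update c k d) i e)
        (actHom B (slUnit (c k) e) b) else 0) := by
    intro d e
    have h3 := congrArg (fun T => T b) ((actHom B).map_lie (slUnit (c i) e) (slUnit (c k) d))
    simp only [LieRing.of_associative_ring_bracket, LinearMap.sub_apply, Module.End.mul_apply,
      lie_slUnit_slUnit] at h3
    rw [← wordTens_sub_right, ← h3, map_sub, LinearMap.sub_apply, wordTens_sub_right]
    split_ifs <;> simp only [map_zero, LinearMap.zero_apply, wordTens_zero_right]
  simp_rw [← Finset.sum_sub_distrib, h2]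
  simp [Finset.sum_sub_distrib]

lemma opY_comm (i k : Fin N) :
    opY (m := m) N A B i * opY N A B k = opY N A B k * opY N A B i := by
  have key : ∀ i k : Fin N, i < k →
      opY (m := m) N A B i * opY N A B k = opY N A B k * opY N A B i := by
    intro i k h
    exact neg_sub_mul_comm (opJM_comm h) (opOmega_mul_opJM h) (opJM_mul_opOmega h)
      (opOmega_mul_opOmega h.ne)
  rcases lt_trichotomy i k with h | h | h
  · exact key i k h
  · rw [h]
  · exact (key k i h).symm

/-- Invariance of the canonical tensor: the bracket of `x` with `E_{c_i,d}` in `B` compensates the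
action of `x` on the `i`-th factor, and `Ω_i` does not involve `A` or the other copies of `V`. -/
lemma opOmega_mul_diagAct (i : Fin N) (x : Slm m) :
    opOmega N A B i * diagAct x = diagAct x * opOmega N A B i := by
  apply tens_ext
  intro a c b
  have hL : ∀ (d : Fin m), actHom B (slUnit (c i) d) (actHom B x b) =
      actHom B x (actHom B (slUnit (c i) d) b) -
      ((∑ e, x.1 e (c i) • actHom B (slUnit e d) b) -
        ∑ e, x.1 d e • actHom B (slUnit (c i) e) b) := by
    intro d
    have h3 := congrArg (fun T => T b) ((actHom B).map_lie x (slUnit (c i) d))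
    simp only [LieRing.of_associative_ring_bracket, LinearMap.sub_apply, Module.End.mul_apply,
      lie_slUnit, map_sub, map_sum, map_smul, LinearMap.sum_apply, LinearMap.smul_apply] at h3
    rw [h3]
    abel
  simp only [Module.End.mul_apply, diagAct_wordTens, opOmega_wordTens, map_add, map_sum, map_smul,
    Finset.sum_add_distrib, hL, wordTens_sub_right, wordTens_sum_right, wordTens_smul_right]
  rw [add_assoc, add_assoc]
  congr 1
  have split : ∀ F : Fin N → Tens m N A B, ∑ j, F j = F i + ∑ j ∈ Finset.univ.erase i, F j :=
    fun F => (Finset.add_sum_erase _ _ (Finset.mem_univ i)).symm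
  rw [split]
  -- The position `i` is split off from the others, since the letter there has already been changed
  -- by `Ω_i`.
  have hR : ∑ d, ∑ j, ∑ e, x.1 e (Function.update c i d j) • wordTens a
      (Function.update (Function.update c i d) j e) (actHom B (slUnit (c i) d) b) =
      (∑ d, ∑ e, x.1 e d • wordTens a (Function.update c i e) (actHom B (slUnit (c i) d) b)) +
      ∑ j ∈ Finset.univ.erase i, ∑ e, ∑ d, x.1 e (c j) • wordTens a
        (Function.update (Function.update c j e) i d) (actHom B (slUnit (c i) d) b) := by
    simp_rw [split]
    rw [Finset.sum_add_distrib]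
    congr 1
    · simp
    · rw [Finset.sum_comm]
      refine Finset.sum_congr rfl fun j hj => ?_
      have hj : j ≠ i := by simpa using hj
      rw [Finset.sum_comm]
      refine Finset.sum_congr rfl fun e _ => Finset.sum_congr rfl fun d _ => ?_
      rw [Function.update_of_ne hj, Function.update_comm hj]
  rw [hR]
  have hL2 : ∑ j ∈ Finset.univ.erase i, ∑ e, x.1 e (c j) • ∑ d, wordTens a
        (Function.update (Function.update c j e) i d)
        (actHom B (slUnit (Function.update c j e i) d) b) =
      ∑ j ∈ Finset.univ.erase i, ∑ e, ∑ d, x.1 e (c j) • wordTens a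
        (Function.update (Function.update c j e) i d) (actHom B (slUnit (c i) d) b) := by
    refine Finset.sum_congr rfl fun j hj => Finset.sum_congr rfl fun e _ => ?_
    have hj : j ≠ i := by simpa using hj
    rw [Function.update_of_ne hj.symm, Finset.smul_sum]
  rw [hL2]
  simp only [Function.update_self, Function.update_idem, Finset.sum_sub_distrib, Finset.smul_sum]
  rw [Finset.sum_comm (f := fun d e => x.1 d (c i) • wordTens a _ _),
    Finset.sum_comm (f := fun d e => x.1 d e • wordTens a (Function.update c i d) _)]
  abel

lemma opY_mul_diagAct (i : Fin N) (x : Slm m) :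
    opY N A B i * diagAct x = diagAct x * opY N A B i := by
  refine neg_sub_mul_comm' ?_ (opOmega_mul_diagAct i x)
  rw [Finset.sum_mul, Finset.mul_sum]
  simp_rw [opPerm_mul_diagAct]

lemma simpleRefl_lo (i : Fin (N - 1)) : simpleRefl i (lo i) = hi i := Equiv.swap_apply_left _ _

lemma simpleRefl_hi (i : Fin (N - 1)) : simpleRefl i (hi i) = lo i := Equiv.swap_apply_right _ _

lemma lo_lt_hi (i : Fin (N - 1)) : lo i < (hi i : Fin N) := by simp [lo, hi, Fin.lt_def]

lemma hi_lt_iff (i : Fin (N - 1)) (k : Fin N) : hi i < k ↔ lo i < k ∧ k ≠ hi i := by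
  simp only [lo, hi, Fin.lt_def, ne_eq, Fin.ext_iff]
  omega

lemma simpleRefl_mul_self (i : Fin (N - 1)) : simpleRefl i * simpleRefl i = (1 : Equiv.Perm (Fin N)) :=
  Equiv.swap_mul_self _ _

/-- The sum over positions after `i` contains `s_i` itself, and `s_i s_i = 1` is the constant term
of the cross relation; conjugation by `s_i` carries the remaining terms to those of the next
position. -/
lemma opPerm_mul_opY_lo (i : Fin (N - 1)) :
    opPerm m A B (simpleRefl i) * opY N A B (lo i) -
      opY N A B (hi i) * opPerm m A B (simpleRefl i) = -1 := by
  have h1 : opPerm m A B (simpleRefl i) * opJM m A B (lo i) =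
      1 + opJM m A B (hi i) * opPerm m A B (simpleRefl i) := by
    rw [opJM, Finset.mul_sum, ← Finset.add_sum_erase _ _
      (show hi i ∈ Finset.univ.filter (lo i < ·) by simpa using lo_lt_hi i), ← opPerm_mul]
    congr 1
    · rw [show Equiv.swap (lo i) (hi i) = simpleRefl i from rfl, simpleRefl_mul_self, opPerm_one]
    · rw [opJM, Finset.sum_mul]
      refine Finset.sum_congr ?_ fun k hk => ?_
      · ext k
        simp [hi_lt_iff, and_comm]
      · have hk := (hi_lt_iff i k).1 (by simpa using hk)
        rw [← opPerm_mul, ← opPerm_mul, perm_mul_swap, simpleRefl_lo, simpleRefl,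
          Equiv.swap_apply_of_ne_of_ne hk.1.ne' hk.2]
  refine mul_neg_sub_sub h1 ?_
  rw [opPerm_mul_opOmega, simpleRefl_lo]

lemma opPerm_mul_opY_hi (i : Fin (N - 1)) :
    opPerm m A B (simpleRefl i) * opY N A B (hi i) -
      opY N A B (lo i) * opPerm m A B (simpleRefl i) = 1 := by
  refine mul_sub_mul_of_involution ?_ (opPerm_mul_opY_lo i)
  rw [← opPerm_mul, simpleRefl_mul_self, opPerm_one]

lemma opPerm_mul_opY (i : Fin (N - 1)) (j : Fin N) :
    opPerm m A B (simpleRefl i) * opY N A B j -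
      opY N A B (simpleRefl i j) * opPerm m A B (simpleRefl i) =
      -(((if j = lo i then 1 else 0) - (if j = hi i then 1 else 0) : ℂ) • 1) := by
  by_cases h1 : j = lo i
  · subst h1
    rw [simpleRefl_lo, opPerm_mul_opY_lo]
    simp [(lo_lt_hi i).ne]
  · by_cases h2 : j = hi i
    · subst h2
      rw [simpleRefl_hi, opPerm_mul_opY_hi, if_neg h1, if_pos rfl]
      exact one_eq_neg_smul
    · have h3 : simpleRefl i j = j := Equiv.swap_apply_of_ne_of_ne h1 h2
      have h4 : opPerm m A B (simpleRefl i) * opJM m A B j =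
          opJM m A B j * opPerm m A B (simpleRefl i) := by
        refine opPerm_mul_opJM _ _ h3 fun k => ?_
        rw [simpleRefl, Equiv.swap_apply_def]
        simp only [lo, hi, Fin.ext_iff, Fin.lt_def] at *
        split_ifs <;> simp only [] <;> omega
      rw [h3, if_neg h1, if_neg h2, sub_zero, zero_smul]
      refine mul_neg_sub_sub (h4.trans (zero_add _).symm) ?_
      rw [opPerm_mul_opOmega, h3]

end

/-! ### The operators `D_i` on coinvariants -/

/-- The coefficients of the classical `r`-matrix. -/
def rCoeff {m : ℕ} (p q : Fin m) : ℂ := (if p = q then 1 / 2 else 0) + if p < q then 1 else 0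

/-- On coefficients, this is the fact that `r` plus its flip is the canonical tensor of the trace
form. -/
lemma rCoeff_add {m : ℕ} (p q : Fin m) : rCoeff p q + rCoeff q p = 1 := by
  rcases lt_trichotomy p q with h | h | h
  · simp [rCoeff, h, h.ne, h.ne', h.not_gt]
  · subst h
    norm_num [rCoeff]
  · simp [rCoeff, h, h.ne, h.ne', h.not_gt]

lemma sum_rCoeff {m : ℕ} (p : Fin m) : ∑ q, rCoeff p q = 1 / 2 + ((m : ℂ) - 1 - (p : ℕ)) := by
  simp only [rCoeff, Finset.sum_add_distrib, Finset.sum_ite_eq, Finset.mem_univ, if_true]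
  congr 1
  rw [Finset.sum_boole, Finset.filter_lt_eq_Ioi, Fin.card_Ioi, Nat.sub_sub,
    Nat.cast_sub (by have := p.2; omega)]
  push_cast
  ring

lemma sum_subtype_pairs {m : ℕ} {E : Type*} [AddCommMonoid E] (F : Fin m → Fin m → E) :
    ∑ q : {q : Fin m × Fin m // q.1 < q.2}, F q.1.1 q.1.2 =
      ∑ p, ∑ q, if p < q then F p q else 0 := by
  rw [← Finset.sum_subtype (Finset.univ.filter fun q : Fin m × Fin m => q.1 < q.2) (by simp)
    (fun q => F q.1 q.2), Finset.sum_filter, Fintype.sum_prod_type]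

lemma cartan_sub_val {m : ℕ} (a b : Fin m) (d e : Fin m) : (xCartan a - xCartan b).1.1 d e =
    if d = e then (if a = d then 1 else 0) - (if b = d then 1 else 0) else 0 := by
  change (xCartan a).1.1 d e - (xCartan b).1.1 d e = _
  rw [← slUnit_self, ← slUnit_self, slUnit_apply, slUnit_apply]
  by_cases h : d = e
  · subst h
    simp
  · have h1 : ∀ a : Fin m, ¬(a = d ∧ a = e) := fun a h' => h (h'.1.symm.trans h'.2)
    simp [h, h1]

lemma rhoCheck_val {m : ℕ} (d e : Fin m) : (rhoCheck m).1 d e =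
    if d = e then ((m : ℂ) - 1 - 2 * (d : ℕ)) / 2 else 0 := by
  have h1 : (rhoCheck m).1 d e =
      1 / 2 * ∑ q : {q : Fin m × Fin m // q.1 < q.2}, (xCartan q.1.1 - xCartan q.1.2).1.1 d e := by
    have h2 : (∑ q : {q : Fin m × Fin m // q.1 < q.2}, (xCartan q.1.1 - xCartan q.1.2)).1 =
        ∑ q : {q : Fin m × Fin m // q.1 < q.2}, (xCartan q.1.1 - xCartan q.1.2).1 :=
      map_sum (cartan m).subtype _ _
    rw [← sum_val, ← h2]
    rfl
  rw [h1]
  simp only [cartan_sub_val]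
  by_cases h : d = e
  · subst h
    simp only [if_true]
    rw [sum_subtype_pairs (fun a b => (if a = d then (1 : ℂ) else 0) - if b = d then 1 else 0)]
    have h3 : ∀ p q : Fin m, (if p < q then ((if p = d then (1 : ℂ) else 0) -
        if q = d then 1 else 0) else 0) =
        (if p = d then (if d < q then 1 else 0) else 0) -
        (if q = d then (if p < d then 1 else 0) else 0) := by
      intro p q
      by_cases hp : p = d <;> by_cases hq : q = d <;> by_cases hpq : p < d <;> simp [hp, hq, hpq]
    simp_rw [h3, Finset.sum_sub_distrib]
    simp only [Finset.sum_ite_irrel, Finset.sum_ite_eq', Finset.mem_univ, if_true,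
      Finset.sum_const_zero]
    rw [Finset.sum_boole, Finset.sum_boole, Finset.filter_lt_eq_Ioi, Finset.filter_gt_eq_Iio,
      Fin.card_Ioi, Fin.card_Iio, Nat.sub_sub, Nat.cast_sub (by have := d.2; omega)]
    push_cast
    ring
  · simp [h]

lemma sum_slUnit_mul {m : ℕ} (p q d c : Fin m) :
    ∑ e, (slUnit p q).1 d e * (slUnit q p).1 e c =
      if d = c then (if p = d then 1 else 0) +
        (if p = q then (if p = d then -2 / (m : ℂ) else 0) + 1 / (m : ℂ) ^ 2 else 0) else 0 := by
  simp only [slUnit_apply, mul_sub, sub_mul, Finset.sum_sub_distrib, ite_and, ite_mul, mul_ite,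
    zero_mul, mul_zero, mul_one, one_mul, Finset.sum_ite_irrel, Finset.sum_ite_eq,
    Finset.sum_ite_eq', Finset.sum_const_zero, Finset.mem_univ, if_true]
  by_cases h : d = c
  · subst h
    by_cases h1 : p = q
    · subst h1
      by_cases h2 : p = d
      · simp [h2]
        ring
      · simp [h2]
        ring
    · simp [h1, Ne.symm h1]
  · by_cases h1 : p = q
    · subst h1
      by_cases h2 : p = d
      · have : p ≠ c := fun h3 => h (h2.symm.trans h3)
        simp [h, h2]
      · simp [h, h2, Ne.symm h2]
    · by_cases h2 : p = d
      · have : p ≠ c := fun h3 => h (h2.symm.trans h3)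
        simp [h, Ne.symm h1, this]
      · simp [h, h1, Ne.symm h1, h2]

/-- Multiplying the two legs of `r` in `V` gives half of the Casimir, that is the scalar `(m -
1/m)/2`, plus the half sum of `[E_pq, E_qp]` over `p < q`, which is `ρ^∨`. -/
lemma sum_rCoeff_slUnit_mul {m : ℕ} (d c : Fin m) :
    ∑ p, ∑ q, rCoeff p q * ∑ e, (slUnit p q).1 d e * (slUnit q p).1 e c =
      if d = c then ((m : ℂ) - 1 / m) / 2 + (rhoCheck m).1 d d else 0 := by
  have hm : (m : ℂ) ≠ 0 := by
    have := d.pos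
    exact_mod_cast this.ne'
  simp only [sum_slUnit_mul]
  by_cases h : d = c
  · simp only [h, if_true, mul_add, Finset.sum_add_distrib, mul_ite, mul_one, mul_zero,
      Finset.sum_ite_irrel, Finset.sum_ite_eq, Finset.sum_ite_eq', Finset.mem_univ,
      Finset.sum_const_zero, sum_rCoeff, rhoCheck_val]
    have h2 : ∀ p : Fin m, rCoeff p p = 1 / 2 := fun p => by simp [rCoeff]
    simp only [h2, Finset.sum_const, Finset.card_univ, Fintype.card_fin, nsmul_eq_mul]
    field_simp
    ring
  · simp [h]

lemma sum_smul_sum_smul {ι E : Type*} [Fintype ι] [AddCommMonoid E] [Module ℂ E]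
    (x y : ι → ι → ι → ℂ) (w : ι → ι → E) :
    ∑ p, ∑ q, ∑ d, y p q d • ∑ e, x p q e • w d e =
      ∑ d, ∑ e, (∑ p, ∑ q, x p q e * y p q d) • w d e := by
  simp_rw [Finset.smul_sum, Finset.sum_smul, smul_smul, mul_comm]
  exact (Finset.sum_congr rfl fun p _ => Finset.sum_comm).trans (Finset.sum_comm.trans
    (Finset.sum_congr rfl fun d _ => (Finset.sum_congr rfl fun p _ => Finset.sum_comm).trans
      Finset.sum_comm))

lemma sum_smul_sum_smul_sum {ι E : Type*} [Fintype ι] [AddCommMonoid E] [Module ℂ E]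
    (r : ι → ι → ℂ) (x : ι → ι → ι → ι → ℂ) (y : ι → ι → ι → ℂ) (w : ι → E) :
    ∑ p, ∑ q, r p q • ∑ e, y p q e • ∑ d, x p q d e • w d =
      ∑ d, (∑ p, ∑ q, r p q * ∑ e, x p q d e * y p q e) • w d := by
  simp_rw [Finset.mul_sum, Finset.smul_sum, Finset.sum_smul, smul_smul]
  refine (Finset.sum_congr rfl fun p _ => Finset.sum_congr rfl fun q _ =>
    Finset.sum_comm).trans ((Finset.sum_congr rfl fun p _ => Finset.sum_comm).trans
      (Finset.sum_comm.trans ?_))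
  refine Finset.sum_congr rfl fun d _ => Finset.sum_congr rfl fun p _ =>
    Finset.sum_congr rfl fun q _ => Finset.sum_congr rfl fun e _ => ?_
  rw [mul_comm (y p q e)]

lemma sum_slUnit_smul {m : ℕ} {E : Type*} [AddCommGroup E] [Module ℂ E] (p q : Fin m)
    (w : Fin m → Fin m → E) :
    ∑ d, ∑ e, (slUnit p e).1 d q • w d e + (1 / m : ℂ) • w q p = w p q := by
  simp only [slUnit_apply, sub_smul, Finset.sum_sub_distrib, ite_and, ite_smul, one_smul,
    zero_smul, Finset.sum_ite_irrel, Finset.sum_ite_eq, Finset.sum_ite_eq',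
    Finset.sum_const_zero, Finset.mem_univ, if_true]
  abel

section

variable {m N : ℕ} {A B : Type} [AddCommGroup A] [Module ℂ A] [Module (Usl m) A]
  [IsScalarTower ℂ (Usl m) A] [AddCommGroup B] [Module ℂ B] [Module (Usl m) B]
  [IsScalarTower ℂ (Usl m) B]

lemma rMat_eq (j k : Fin (N + 2)) : rMat (m := m) N A B j k =
    ∑ p, ∑ q, rCoeff p q • (theta N A B (slUnit p q) j * theta N A B (slUnit q p) k) := by
  simp only [rMat, rCoeff, add_smul, Finset.sum_add_distrib, ite_smul, zero_smul, one_smul,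
    Finset.sum_ite_eq, Finset.mem_univ, if_true, Finset.smul_sum, ← slUnit_self]
  congr 1
  rw [← sum_subtype_pairs (fun p q => theta N A B (slUnit p q) j * theta N A B (slUnit q p) k)]
  refine Finset.sum_congr rfl fun q _ => ?_
  rw [← slUnit_of_ne, ← slUnit_of_ne]

lemma theta_comm_of_lt (x y : Slm m) {j k : Fin (N + 2)} (h : j < k) :
    theta N A B x j * theta N A B y k = theta N A B y k * theta N A B x j := by
  apply tens_ext
  intro a c b
  induction j using Fin.cases with
  | zero =>
    induction k using Fin.cases with
    | zero => exact absurd h (lt_irrefl _)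
    | succ k =>
      induction k using Fin.lastCases with
      | last => simp [theta_zero, theta_last, Fin.succ_last]
      | cast k =>
        change theta N A B x 0 (theta N A B y (pos k) _) = theta N A B y (pos k) (theta N A B x 0 _)
        simp [theta_zero, theta_pos]
  | succ j =>
    induction j using Fin.lastCases with
    | last => exact absurd h (not_lt.2 (Fin.succ_last _ ▸ Fin.le_last k))
    | cast j =>
      change theta N A B x (pos j) (theta N A B y k _) = theta N A B y k (theta N A B x (pos j) _)
      induction k using Fin.cases with
      | zero => exact absurd h (Fin.not_lt_zero _)
      | succ k =>
        induction k using Fin.lastCases with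
        | last => simp [theta_pos, theta_last, Fin.succ_last]
        | cast k =>
          have hjk : j ≠ k := by
            rintro rfl
            exact lt_irrefl _ h
          change theta N A B x (pos j) (theta N A B y (pos k) _) =
            theta N A B y (pos k) (theta N A B x (pos j) _)
          simp only [theta_pos, map_sum, map_smul, Finset.smul_sum,
            Function.update_of_ne hjk, Function.update_of_ne hjk.symm]
          rw [Finset.sum_comm]
          refine Finset.sum_congr rfl fun d _ => Finset.sum_congr rfl fun e _ => ?_
          rw [Function.update_comm hjk, smul_comm]

lemma rMat_add_of_lt {j k : Fin (N + 2)} (h : j < k) :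
    rMat (m := m) N A B j k + rMat N A B k j =
      ∑ p, ∑ q, theta N A B (slUnit p q) j * theta N A B (slUnit q p) k := by
  rw [rMat_eq, rMat_eq, Finset.sum_comm (f := fun p q => rCoeff p q •
    (theta N A B (slUnit p q) k * theta N A B (slUnit q p) j)), ← Finset.sum_add_distrib]
  refine Finset.sum_congr rfl fun p _ => ?_
  rw [← Finset.sum_add_distrib]
  refine Finset.sum_congr rfl fun q _ => ?_
  rw [← theta_comm_of_lt _ _ h, ← add_smul, rCoeff_add, one_smul]

/-- On `V ⊗ V` the canonical tensor of `gl_m` is the flip, and that of `sl_m` is the flip minus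
`1/m`. This is the origin of the terms `1/(2m)` in `D_i`. -/
lemma theta_mul_theta_pos (i k : Fin N) (h : i ≠ k) (a : A) (c : Fin N → Fin m) (b : B) :
    (∑ p, ∑ q, theta N A B (slUnit p q) (pos i) * theta N A B (slUnit q p) (pos k))
      (wordTens a c b) + (1 / m : ℂ) • wordTens a c b = wordTens a (c ∘ Equiv.swap i k) b := by
  simp only [LinearMap.sum_apply, Module.End.mul_apply, theta_pos, map_sum, map_smul,
    Function.update_of_ne h]
  rw [sum_smul_sum_smul (fun p q e => (slUnit p q).1 e (c i))
    (fun p q d => (slUnit q p).1 d (c k))]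
  have h1 : ∀ d e, ∑ p, ∑ q, (slUnit p q).1 e (c i) * (slUnit q p).1 d (c k) =
      (slUnit (c i) e).1 d (c k) := by
    intro d e
    rw [← sum_slUnit_apply_smul e (c i), sum_val]
    simp only [sum_val]
    rfl
  simp only [h1]
  have h2 := sum_slUnit_smul (c i) (c k)
    (fun d e => wordTens a (Function.update (Function.update c k d) i e) b)
  rw [Function.update_eq_self, Function.update_eq_self] at h2
  refine h2.trans ?_
  rw [← update_comp_swap_right h, Function.update_eq_self]

lemma rMat_pos_pos (i : Fin N) (a : A) (c : Fin N → Fin m) (b : B) :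
    rMat N A B (pos i) (pos i) (wordTens a c b) =
      (((m : ℂ) - 1 / m) / 2) • wordTens a c b +
        theta N A B (rhoCheck m) (pos i) (wordTens a c b) := by
  simp only [rMat_eq, LinearMap.sum_apply, LinearMap.smul_apply, Module.End.mul_apply, theta_pos,
    map_sum, map_smul, Function.update_self, Function.update_idem]
  rw [sum_smul_sum_smul_sum rCoeff (fun p q d e => (slUnit p q).1 d e)
    (fun p q e => (slUnit q p).1 e (c i)) (fun d => wordTens a (Function.update c i d) b)]
  simp only [sum_rCoeff_slUnit_mul, rhoCheck_val]
  simp [add_smul]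

lemma mkQ_diagAct (x : Slm m) (v : Tens m N A B) :
    (diagImage (m := m) N A B).mkQ (diagAct x v) = 0 :=
  (Submodule.Quotient.mk_eq_zero _).2 (diagAct_mem x v)

/-- The sum over all `j`, including `j = i`, makes the first leg of `r` act diagonally and after the
second leg, so the result lies in the diagonal image. -/
lemma sum_rMat (i : Fin (N + 2)) (v : Tens m N A B) :
    ∑ j, (diagImage (m := m) N A B).mkQ (rMat N A B j i v) = 0 := by
  have h : ∑ j, rMat N A B j i v =
      ∑ p, ∑ q, rCoeff p q • diagAct (slUnit p q) (theta N A B (slUnit q p) i v) := by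
    simp only [rMat_eq, LinearMap.sum_apply, LinearMap.smul_apply, Module.End.mul_apply, diagAct,
      Finset.smul_sum]
    rw [Finset.sum_comm]
    exact Finset.sum_congr rfl fun p _ => Finset.sum_comm
  rw [← map_sum, h]
  simp only [map_sum, map_smul, mkQ_diagAct, smul_zero, Finset.sum_const_zero]

lemma sum_subtype_filter {ι E : Type*} [Fintype ι] [AddCommMonoid E] (P : ι → Prop)
    [DecidablePred P] (F : ι → E) :
    ∑ j : {j // P j}, F j = ∑ j ∈ Finset.univ.filter P, F j :=
  (Finset.sum_subtype _ (by simp) F).symm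

/-- On coinvariants `∑_{j<i} r_ji = -r_ii - ∑_{j>i} r_ji`. The `ρ^∨` inside `r_ii` cancels the one
in `D_i`, and `r_ij + r_ji` is the canonical tensor, which is `P_ij - 1/m` between two copies of `V`
and `Ω_i` towards `B`. What is left besides these is a scalar. -/
lemma mkQ_opD_wordTens (i : Fin N) (a : A) (c : Fin N → Fin m) (b : B) :
    (diagImage (m := m) N A B).mkQ (opD N A B i (wordTens a c b)) =
      (diagImage (m := m) N A B).mkQ (opY N A B i (wordTens a c b)) +
        (((N : ℂ) - m ^ 2) / (2 * m)) • (diagImage (m := m) N A B).mkQ (wordTens a c b) := by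
  set v := wordTens a c b with hv
  set Q := (diagImage (m := m) N A B).mkQ with hQ
  have hm : (m : ℂ) ≠ 0 := by
    have := (c i).pos
    exact_mod_cast this.ne'
  have hD : Q (opD N A B i v) =
      ∑ j ∈ Finset.univ.filter (· < pos i), (Q (rMat N A B j (pos i) v) + (1 / (2 * m : ℂ)) • Q v) -
      ∑ j ∈ Finset.univ.filter (pos i < ·),
        (Q (rMat N A B (pos i) j v) + (1 / (2 * m : ℂ)) • Q v) +
      Q (theta N A B (rhoCheck m) (pos i) v) := by
    rw [← sum_subtype_filter, ← sum_subtype_filter]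
    simp only [← map_smul, ← map_add, ← map_sum]
    rw [← map_sub, ← map_add]
    congr 1
    simp only [opD, LinearMap.add_apply]
    congr 1
    refine (LinearMap.sub_apply _ _ _).trans ?_
    simp only [LinearMap.sum_apply, LinearMap.add_apply, LinearMap.smul_apply, Module.End.one_apply]
  have h1 := sum_rMat (pos i) v
  rw [← Finset.sum_filter_add_sum_filter_not _ (· < pos i)] at h1
  have h2 : (Finset.univ.filter fun j : Fin (N + 2) => ¬ j < pos i) =
      insert (pos i) (Finset.univ.filter (pos i < ·)) := by
    ext j
    simp [le_iff_eq_or_lt, eq_comm]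
  -- The term `j = i`, absent from `D_i`, has to be evaluated because the vanishing sum runs over
  -- all positions.
  rw [h2, Finset.sum_insert (by simp), hv, rMat_pos_pos, ← hv, map_add, map_smul] at h1
  have h3 : ∀ j, pos i < j → Q (rMat N A B (pos i) j v) + Q (rMat N A B j (pos i) v) =
      Q ((∑ p, ∑ q, theta N A B (slUnit p q) (pos i) * theta N A B (slUnit q p) j) v) := by
    intro j hj
    rw [← map_add, ← LinearMap.add_apply, rMat_add_of_lt hj]
  have h4 : ∑ j ∈ Finset.univ.filter (pos i < ·), (Q (rMat N A B (pos i) j v) +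
      Q (rMat N A B j (pos i) v)) =
      ∑ k ∈ Finset.univ.filter (i < ·), (Q (wordTens a (c ∘ Equiv.swap i k) b) -
        (1 / m : ℂ) • Q v) + Q (opOmega N A B i v) := by
    rw [Finset.sum_congr rfl fun j hj => h3 j (by simpa using hj), Finset.sum_filter,
      sum_positions, if_neg (Fin.not_lt_zero _), zero_add, if_pos, Finset.sum_filter]
    · congr 1
      refine Finset.sum_congr rfl fun k _ => ?_
      have hlt : pos i < pos k ↔ i < k := by simp [pos]
      simp only [hlt]
      split_ifs with h
      · rw [eq_sub_iff_add_eq, ← map_smul, ← map_add, hv, theta_mul_theta_pos i k h.ne]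
      · rfl
    · simp [pos, Fin.lt_def]
  -- With `i` counted from zero there are `i + 1` positions before it including `A`, `N - i` after
  -- it including `B`, and `N - 1 - i` later copies of `V`. The scalar is `(i+1)/(2m) - (N-i)/(2m) -
  -- (m - 1/m)/2 + (N-1-i)/m = (N - m²)/(2m)`.
  have c1 : (Finset.univ.filter fun j : Fin (N + 2) => j < pos i).card = i + 1 := by
    rw [Finset.filter_gt_eq_Iio, Fin.card_Iio]
    rfl
  have c2 : (Finset.univ.filter fun j : Fin (N + 2) => pos i < j).card = N - i := by
    rw [Finset.filter_lt_eq_Ioi, Fin.card_Ioi]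
    have : (pos i : ℕ) = i + 1 := rfl
    omega
  have c3 : (Finset.univ.filter fun j : Fin N => i < j).card = N - 1 - i := by
    rw [Finset.filter_lt_eq_Ioi, Fin.card_Ioi]
  have c2' : ((N - i : ℕ) : ℂ) = N - i := by
    rw [Nat.cast_sub i.2.le]
  have c3' : ((N - 1 - i : ℕ) : ℂ) = N - 1 - i := by
    rw [Nat.sub_sub, Nat.cast_sub (by have := i.2; omega)]
    push_cast
    ring
  have hY : Q (opY N A B i v) = - ∑ k ∈ Finset.univ.filter (i < ·),
      Q (wordTens a (c ∘ Equiv.swap i k) b) - Q (opOmega N A B i v) := by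
    rw [← map_sum, ← map_neg, ← map_sub]
    congr 1
    rw [hv, opY_wordTens, ← opOmega_wordTens]
  rw [hD, hY]
  simp only [Finset.sum_add_distrib, Finset.sum_sub_distrib, Finset.sum_const, c1, c2, c3,
    ← Nat.cast_smul_eq_nsmul ℂ, smul_smul, c2', c3'] at h1 h4 ⊢
  have h5 : ∑ j ∈ Finset.univ.filter (· < pos i), Q (rMat N A B j (pos i) v) =
      -((((m : ℂ) - 1 / m) / 2) • Q v) - Q (theta N A B (rhoCheck m) (pos i) v) -
        ∑ j ∈ Finset.univ.filter (pos i < ·), Q (rMat N A B j (pos i) v) := by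
    rw [eq_sub_iff_add_eq, eq_sub_iff_add_eq, eq_neg_iff_add_eq_zero, ← h1]
    abel
  rw [h5, eq_sub_of_add_eq h4]
  push_cast
  match_scalars <;> field_simp <;> ring

end

/-! ### The action of the degenerate affine Hecke algebra on coinvariants -/

section

variable {m : ℕ} (N : ℕ) (A B : Type) [AddCommGroup A] [Module ℂ A] [Module (Usl m) A]
  [IsScalarTower ℂ (Usl m) A] [AddCommGroup B] [Module ℂ B] [Module (Usl m) B]
  [IsScalarTower ℂ (Usl m) B]

variable {N A B} in
lemma diagImage_le_comap {T : Module.End ℂ (Tens m N A B)}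
    (hT : ∀ x : Slm m, T * diagAct x = diagAct x * T) :
    diagImage (m := m) N A B ≤ (diagImage (m := m) N A B).comap T := by
  refine diagImage_le fun x v => ?_
  rw [Submodule.mem_comap, ← Module.End.mul_apply, hT, Module.End.mul_apply]
  exact diagAct_mem x _

/-- The shift between the operators `D_i` and `- ∑_{i < j} P_ij - Ω_i`. -/
def yShift (m N : ℕ) : ℂ := ((N : ℂ) - m ^ 2) / (2 * m)

/-- The operator on coinvariants induced by a permutation. -/
def funcPerm (w : Equiv.Perm (Fin N)) : Module.End ℂ (Func (m := m) N A B) :=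
  Submodule.mapQ _ _ (opPerm m A B w) (diagImage_le_comap (opPerm_mul_diagAct w))

/-- The operator on coinvariants induced by `D_i`. -/
def funcY (i : Fin N) : Module.End ℂ (Func (m := m) N A B) :=
  Submodule.mapQ _ _ (opY N A B i) (diagImage_le_comap (opY_mul_diagAct i)) + yShift m N • 1

variable {N A B}

lemma func_hom_ext {E : Type*} [AddCommGroup E] [Module ℂ E]
    {f g : Func (m := m) N A B →ₗ[ℂ] E} (h : ∀ v, f (cls N A B v) = g (cls N A B v)) : f = g :=
  LinearMap.ext fun v => Submodule.Quotient.induction_on _ v h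

lemma cls_eq (v : Tens m N A B) :
    cls (m := m) N A B v = (diagImage (m := m) N A B).mkQ v := rfl

lemma funcPerm_cls (w : Equiv.Perm (Fin N)) (v : Tens m N A B) :
    funcPerm N A B w (cls (m := m) N A B v) = cls N A B (opPerm m A B w v) := rfl

lemma funcY_cls (i : Fin N) (v : Tens m N A B) : funcY N A B i (cls (m := m) N A B v) =
    cls N A B (opY N A B i v) + yShift m N • cls N A B v := rfl

lemma funcPerm_one : funcPerm (m := m) N A B 1 = 1 := by
  apply func_hom_ext
  intro v
  rw [funcPerm_cls, opPerm_one]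
  rfl

lemma funcPerm_mul (w w' : Equiv.Perm (Fin N)) :
    funcPerm (m := m) N A B (w * w') = funcPerm N A B w * funcPerm N A B w' := by
  apply func_hom_ext
  intro v
  rw [Module.End.mul_apply, funcPerm_cls, funcPerm_cls, funcPerm_cls, opPerm_mul]
  rfl

lemma funcY_comm (i k : Fin N) :
    funcY (m := m) N A B i * funcY N A B k = funcY N A B k * funcY N A B i := by
  apply func_hom_ext
  intro v
  have h := congrArg (fun T => cls (m := m) N A B (T v)) (opY_comm (m := m) (A := A) (B := B) i k)
  simp only [Module.End.mul_apply] at h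
  simp only [Module.End.mul_apply, funcY_cls, map_add, map_smul, h]
  module

lemma funcPerm_mul_funcY (i : Fin (N - 1)) (j : Fin N) :
    funcPerm (m := m) N A B (simpleRefl i) * funcY N A B j -
      funcY N A B (simpleRefl i j) * funcPerm N A B (simpleRefl i) =
      -algebraMap ℂ _ ((if j = lo i then 1 else 0) - (if j = hi i then 1 else 0)) := by
  apply func_hom_ext
  intro v
  have h := congrArg (fun T => (diagImage (m := m) N A B).mkQ (T v))
    (opPerm_mul_opY (m := m) (A := A) (B := B) i j)
  have h1 : (diagImage (m := m) N A B).mkQ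
      ((opPerm m A B (simpleRefl i) * opY N A B j -
        opY N A B (simpleRefl i j) * opPerm m A B (simpleRefl i) :
          Module.End ℂ (Tens m N A B)) v) =
      cls N A B (opPerm m A B (simpleRefl i) (opY N A B j v)) -
        cls N A B (opY N A B (simpleRefl i j) (opPerm m A B (simpleRefl i) v)) :=
    map_sub _ _ _
  have h2 : ∀ r : ℂ, (diagImage (m := m) N A B).mkQ ((-(r • 1) : Module.End ℂ (Tens m N A B)) v) =
      - (r • cls N A B v) := fun r => (map_neg _ _).trans
    (congrArg Neg.neg (show (diagImage (m := m) N A B).mkQ (r • v) = r • cls N A B v from rfl))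
  rw [h1, h2] at h
  simp only [LinearMap.sub_apply, Module.End.mul_apply, funcY_cls, funcPerm_cls, map_add, map_smul,
    LinearMap.neg_apply, Module.algebraMap_end_apply]
  rw [← h]
  abel

variable (m N A B) in
/-- The action of the degenerate affine Hecke algebra on coinvariants. -/
def heckeHom : Hecke N →ₐ[ℂ] Module.End ℂ (Func (m := m) N A B) :=
  RingQuot.liftAlgHom ℂ ⟨FreeAlgebra.lift ℂ (Sum.elim (funcPerm N A B) (funcY N A B)), by
    intro x y h
    induction h with
    | one => simp [funcPerm_one]
    | mul w w' => simp [funcPerm_mul]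
    | comm j k => simp [funcY_comm j k]
    | cross i j =>
      simp only [map_sub, map_mul, FreeAlgebra.lift_ι_apply, Sum.elim_inl, Sum.elim_inr, map_neg,
        AlgHom.commutes, funcPerm_mul_funcY]⟩

lemma heckeHom_permH (w : Equiv.Perm (Fin N)) :
    heckeHom m N A B (permH w) = funcPerm N A B w := by
  rw [heckeHom, permH, RingQuot.liftAlgHom_mkAlgHom_apply, FreeAlgebra.lift_ι_apply]
  rfl

lemma heckeHom_epsH (i : Fin N) : heckeHom m N A B (epsH i) = funcY N A B i := by
  rw [heckeHom, epsH, RingQuot.liftAlgHom_mkAlgHom_apply, FreeAlgebra.lift_ι_apply]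
  rfl

variable (m N A B) in
/-- The module structure over the degenerate affine Hecke algebra on coinvariants. -/
abbrev heckeModule : Module (Hecke N) (Func (m := m) N A B) :=
  Module.compHom _ (heckeHom m N A B).toRingHom

/-- `D_i` itself is never shown to commute with `sl_m`; it descends to coinvariants because there it
agrees with an operator that does. -/
lemma cls_opD (i : Fin N) (v : Tens m N A B) :
    cls (m := m) N A B (opD N A B i v) = funcY N A B i (cls N A B v) := by
  have : (diagImage (m := m) N A B).mkQ ∘ₗ opD N A B i =
      funcY N A B i ∘ₗ (diagImage (m := m) N A B).mkQ := by
    apply tens_ext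
    intro a c b
    exact mkQ_opD_wordTens i a c b
  exact congrArg (fun f => f v) this

lemma isHeckeAction_heckeModule :
    letI := heckeModule m N A B
    IsHeckeAction (m := m) N A B := by
  let _ := heckeModule m N A B
  have hs : ∀ (h : Hecke N) (v : Func (m := m) N A B), h • v = heckeHom m N A B h v :=
    fun _ _ => rfl
  refine ⟨⟨fun r h v => ?_⟩, fun i v => ?_, fun w v => ?_⟩
  · rw [hs, hs, map_smul, LinearMap.smul_apply]
  · rw [hs, heckeHom_epsH, cls_opD]
  · rw [hs, heckeHom_permH, funcPerm_cls]

end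

/-! ### Eigenforms and words -/

/-- If `b` is a lowest weight vector of weight `-n` modulo a submodule `K`, and some power of the
raising operator maps `b` into `K`, then `n` is a natural number. -/
lemma exists_nat_of_nilpotent_mod {B : Type*} [AddCommGroup B] [Module ℂ B]
    {E F H : Module.End ℂ B} (hEF : E * F - F * E = H) (hHE : H * E - E * H = (2 : ℂ) • E)
    (K : Submodule ℂ B) (hE : ∀ b ∈ K, E b ∈ K) (hF : ∀ b ∈ K, F b ∈ K)
    {b : B} (hb : b ∉ K) (hFb : F b ∈ K) {n : ℂ} (hHb : H b + n • b ∈ K)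
    {k : ℕ} (hk : (E ^ k) b ∈ K) : ∃ l : ℕ, n = l := by
  -- Modulo `K`, the vector `E^k b` has weight `2k - n`.
  have h1 : ∀ k : ℕ, H ((E ^ k) b) + (n - 2 * k) • (E ^ k) b ∈ K := by
    intro k
    induction k with
    | zero => simpa using hHb
    | succ k ih =>
      have := congrArg (fun T => T ((E ^ k) b)) hHE
      simp only [LinearMap.sub_apply, Module.End.mul_apply, LinearMap.smul_apply] at this
      rw [pow_succ', Module.End.mul_apply, sub_eq_iff_eq_add.1 this]
      have h2 := hE _ ih
      rw [map_add, map_smul] at h2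
      convert h2 using 1
      push_cast
      module
  have h2 : ∀ k : ℕ, F ((E ^ (k + 1)) b) - (((k : ℂ) + 1) * (n - k)) • (E ^ k) b ∈ K := by
    intro k
    induction k with
    | zero =>
      have := congrArg (fun T => T b) hEF
      simp only [LinearMap.sub_apply, Module.End.mul_apply] at this
      have h3 := K.sub_mem (hE _ hFb) hHb
      rw [← this] at h3
      convert h3 using 1
      simp only [zero_add, pow_one, Nat.cast_zero, sub_zero, one_mul, pow_zero, Module.End.one_apply]
      abel
    | succ k ih =>
      have := congrArg (fun T => T ((E ^ (k + 1)) b)) hEF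
      simp only [LinearMap.sub_apply, Module.End.mul_apply] at this
      have h3 := K.sub_mem (hE _ ih) (h1 (k + 1))
      rw [← this, map_sub, map_smul] at h3
      rw [pow_succ' E (k + 1), Module.End.mul_apply]
      have h4 : E ((E ^ k) b) = (E ^ (k + 1)) b := by rw [pow_succ', Module.End.mul_apply]
      rw [h4] at h3
      convert h3 using 1
      push_cast
      module
  -- Let `j + 1` be the least power taking `b` into `K`. Applying `F` shows that `(j + 1)(n - j) E^j
  -- b` lies in `K` while `E^j b` does not, so `n = j`.
  have hex : ∃ k, (E ^ k) b ∈ K := ⟨k, hk⟩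
  classical
  obtain ⟨j, hj⟩ : ∃ j, Nat.find hex = j + 1 := by
    refine Nat.exists_eq_succ_of_ne_zero fun h0 => hb ?_
    have := Nat.find_spec hex
    rw [h0] at this
    simpa using this
  have h3 : (E ^ (j + 1)) b ∈ K := hj ▸ Nat.find_spec hex
  have h4 : (E ^ j) b ∉ K := Nat.find_min hex (by omega)
  have h5 := K.sub_mem (hF _ h3) (h2 j)
  rw [sub_sub_cancel] at h5
  refine ⟨j, ?_⟩
  by_contra hne
  refine h4 ((K.smul_mem_iff ?_).1 h5)
  exact mul_ne_zero (by exact_mod_cast Nat.succ_ne_zero j) (sub_ne_zero.2 hne)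

/-- A family of bilinear forms indexed by words, that is, a linear form on `A ⊗ V^{⊗N} ⊗ B`. -/
abbrev WordForm (m N : ℕ) (A B : Type*) [AddCommGroup A] [Module ℂ A] [AddCommGroup B]
    [Module ℂ B] : Type _ := (Fin N → Fin m) → A →ₗ[ℂ] B →ₗ[ℂ] ℂ

section

variable {m N : ℕ} {A B : Type*} [AddCommGroup A] [Module ℂ A] [AddCommGroup B] [Module ℂ B]
  (ρA : Slm m →ₗ⁅ℂ⁆ Module.End ℂ A) (ρB : Slm m →ₗ⁅ℂ⁆ Module.End ℂ B)

/-- Invariance of a linear form on `A ⊗ V^{⊗N} ⊗ B` under the diagonal action of `sl_m`. -/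
def IsInvForm (f : WordForm m N A B) : Prop :=
  ∀ x c a b, f c (ρA x a) b + ∑ i, ∑ d, x.1 d (c i) * f (Function.update c i d) a b +
    f c a (ρB x b) = 0

/-- The form is an eigenvector of the operators `- ∑_{i < j} P_ij - Ω_i`. -/
def IsEigenForm (f : WordForm m N A B) (χ : Fin N → ℂ) : Prop :=
  ∀ i c a b, - ∑ j ∈ Finset.univ.filter (i < ·), f (c ∘ Equiv.swap i j) a b -
    ∑ d, f (Function.update c i d) a (ρB (slUnit (c i) d) b) = χ i * f c a b

/-- The radical of a form in the last factor. -/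
def formRad (f : WordForm m N A B) : Submodule ℂ B := ⨅ c, ⨅ a, LinearMap.ker (f c a)

lemma mem_formRad {f : WordForm m N A B} {b : B} : b ∈ formRad f ↔ ∀ c a, f c a b = 0 := by
  simp [formRad, Submodule.mem_iInf]

variable {ρA ρB} in
lemma IsInvForm.apply_mem_formRad {f : WordForm m N A B} (hf : IsInvForm ρA ρB f) (x : Slm m)
    {b : B} (hb : b ∈ formRad f) : ρB x b ∈ formRad f := by
  rw [mem_formRad] at hb ⊢
  intro c a
  have := hf x c a b
  simpa [hb] using this

/-- The action of `sl_m` on `V ⊗ B`, realized on functions. -/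
def vecAct (x : Slm m) : Module.End ℂ (Fin m → B) :=
  LinearMap.pi fun d => ρB x ∘ₗ LinearMap.proj d + ∑ e, x.1 d e • LinearMap.proj e

lemma vecAct_apply (x : Slm m) (g : Fin m → B) (d : Fin m) :
    vecAct ρB x g d = ρB x (g d) + ∑ e, x.1 d e • g e := by
  simp [vecAct]

/-- The representation `V ⊗ B`, realized on functions. -/
def vecRep : Slm m →ₗ⁅ℂ⁆ Module.End ℂ (Fin m → B) where
  toFun x := vecAct ρB x
  map_add' x y := by
    refine LinearMap.ext fun g => funext fun d => ?_
    have h : ∀ d e, (x + y).1 d e = x.1 d e + y.1 d e := fun _ _ => rfl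
    simp only [LinearMap.add_apply, Pi.add_apply, vecAct_apply, map_add, h, add_smul,
      Finset.sum_add_distrib]
    abel
  map_smul' r x := by
    refine LinearMap.ext fun g => funext fun d => ?_
    have h : ∀ d e, (r • x).1 d e = r * x.1 d e := fun _ _ => rfl
    simp only [LinearMap.smul_apply, Pi.smul_apply, vecAct_apply, map_smul, h, mul_smul, smul_add,
      Finset.smul_sum, RingHom.id_apply]
  map_lie' {x y} := by
    refine LinearMap.ext fun g => funext fun d => ?_
    rw [LieRing.of_associative_ring_bracket, LinearMap.sub_apply, Pi.sub_apply,
      Module.End.mul_apply, Module.End.mul_apply]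
    simp only [vecAct_apply, map_add, map_sum, map_smul, lie_val, LieHom.map_lie,
      LieRing.of_associative_ring_bracket, LinearMap.sub_apply, Module.End.mul_apply, smul_add,
      Finset.sum_add_distrib, Finset.smul_sum, Finset.sum_smul, sub_smul, smul_smul,
      Finset.sum_sub_distrib]
    rw [Finset.sum_comm (f := fun e k => (x.1 d k * y.1 k e) • g e),
      Finset.sum_comm (f := fun e k => (y.1 d k * x.1 k e) • g e)]
    abel

lemma vecRep_apply (x : Slm m) (g : Fin m → B) (d : Fin m) :
    vecRep ρB x g d = ρB x (g d) + ∑ e, x.1 d e • g e := vecAct_apply ρB x g d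

lemma vecRep_single (x : Slm m) (a : Fin m) (b : B) (d : Fin m) :
    vecRep ρB x (Pi.single a b) d =
      (Pi.single a (ρB x b) : Fin m → B) d + x.1 d a • b := by
  rw [vecRep_apply]
  congr 1
  · by_cases h : d = a
    · subst h; simp
    · simp [h]
  · rw [Finset.sum_eq_single a]
    · simp
    · intro e _ he
      simp [he]
    · simp

lemma vecRep_slUnit_single {p q : Fin m} (h : p ≠ q) (a : Fin m) (b : B) :
    vecRep ρB (slUnit p q) (Pi.single a b) = Pi.single a (ρB (slUnit p q) b) +
      if a = q then Pi.single p b else 0 := by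
  funext d
  rw [vecRep_single, Pi.add_apply, slUnit_apply]
  congr 1
  by_cases h1 : a = q
  · subst h1
    by_cases h2 : d = p
    · subst h2; simp [h]
    · simp [h, h2, Ne.symm h2]
  · simp [h, h1, Ne.symm h1]

lemma vecRep_slUnit_self_single (p : Fin m) (a : Fin m) (b : B) :
    vecRep ρB (slUnit p p) (Pi.single a b) = Pi.single a (ρB (slUnit p p) b) +
      ((if p = a then 1 else 0) - 1 / (m : ℂ)) • (Pi.single a b : Fin m → B) := by
  funext d
  rw [vecRep_single, Pi.add_apply, slUnit_apply, Pi.smul_apply]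
  congr 1
  by_cases h1 : d = a
  · subst h1
    simp
  · have : ¬ (p = d ∧ p = a) := fun h => h1 (h.1.symm.trans h.2)
    simp [h1, this]

/-- `E_pq` squares to zero on `V`, so only two terms of the binomial expansion on `u_a ⊗ b` remain.
This carries nilpotency from `B` to `V ⊗ B`. -/
lemma vecRep_pow_single {p q : Fin m} (h : p ≠ q) (a : Fin m) (b : B) (k : ℕ) :
    (vecRep ρB (slUnit p q) ^ (k + 1)) (Pi.single a b) =
      Pi.single a ((ρB (slUnit p q) ^ (k + 1)) b) +
      if a = q then ((k : ℂ) + 1) • (Pi.single p ((ρB (slUnit p q) ^ k) b) : Fin m → B) else 0 := by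
  induction k with
  | zero => simp [vecRep_slUnit_single ρB h]
  | succ k ih =>
    rw [pow_succ', Module.End.mul_apply, ih, map_add, vecRep_slUnit_single ρB h,
      ← Module.End.mul_apply, ← pow_succ']
    by_cases h1 : a = q
    · simp only [h1, if_true]
      rw [map_smul, vecRep_slUnit_single ρB h, if_neg h, add_zero, ← Module.End.mul_apply,
        ← pow_succ']
      push_cast
      module
    · simp [h1]

/-- Merge the last factor `V` of `V^{⊗(N+1)}` with `B`. -/
def peel (f : WordForm m (N + 1) A B) : WordForm m N A (Fin m → B) :=
  fun c => ∑ d, (f (Fin.snoc c d)).compl₂ (LinearMap.proj d)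

lemma peel_apply (f : WordForm m (N + 1) A B) (c : Fin N → Fin m) (a : A) (g : Fin m → B) :
    peel f c a g = ∑ d, f (Fin.snoc c d) a (g d) := by
  simp [peel, LinearMap.sum_apply]

lemma peel_single (f : WordForm m (N + 1) A B) (c : Fin N → Fin m) (a : A) (d : Fin m) (b : B) :
    peel f c a (Pi.single d b) = f (Fin.snoc c d) a b := by
  rw [peel_apply, Finset.sum_eq_single d]
  · simp
  · intro e _ he
    simp [he]
  · simp

variable {ρA ρB}

lemma IsInvForm.peel {f : WordForm m (N + 1) A B} (hf : IsInvForm ρA ρB f) :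
    IsInvForm ρA (vecRep ρB) (peel f) := by
  intro x c a g
  have h' := Finset.sum_eq_zero fun d (_ : d ∈ Finset.univ) => hf x (Fin.snoc c d) a (g d)
  simp only [Fin.sum_univ_castSucc, Fin.snoc_castSucc, Fin.snoc_last, Fin.update_snoc_last,
    ← Fin.snoc_update, Finset.sum_add_distrib] at h'
  simp only [peel_apply, vecRep_apply, map_add, map_sum, map_smul, Finset.sum_add_distrib,
    smul_eq_mul, Finset.mul_sum]
  rw [← h', Finset.sum_comm (f := fun i d => x.1 i d * f (Fin.snoc c i) a (g d))]
  have h1 : ∑ i, ∑ d, ∑ e, x.1 d (c i) * f (Fin.snoc (Function.update c i d) e) a (g e) =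
      ∑ e, ∑ i, ∑ d, x.1 d (c i) * f (Fin.snoc (Function.update c i d) e) a (g e) :=
    (Finset.sum_congr rfl fun i _ => Finset.sum_comm).trans Finset.sum_comm
  rw [h1]
  ring

lemma snoc_comp_swap_castSucc (c : Fin N → Fin m) (d : Fin m) (i j : Fin N) :
    (Fin.snoc c d : Fin (N + 1) → Fin m) ∘ Equiv.swap i.castSucc j.castSucc =
      Fin.snoc (c ∘ Equiv.swap i j) d := by
  funext k
  induction k using Fin.lastCases with
  | last =>
    rw [Function.comp_apply, Equiv.swap_apply_of_ne_of_ne (Fin.castSucc_lt_last i).ne'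
      (Fin.castSucc_lt_last j).ne', Fin.snoc_last, Fin.snoc_last]
  | cast k =>
    rw [Function.comp_apply, Fin.snoc_castSucc, Function.comp_apply,
      ← (Fin.castSucc_injective N).map_swap, Fin.snoc_castSucc]

lemma snoc_comp_swap_last (c : Fin N → Fin m) (d : Fin m) (i : Fin N) :
    (Fin.snoc c d : Fin (N + 1) → Fin m) ∘ Equiv.swap i.castSucc (Fin.last N) =
      Fin.snoc (Function.update c i d) (c i) := by
  funext k
  induction k using Fin.lastCases with
  | last => simp
  | cast k =>
    rw [Function.comp_apply, Fin.snoc_castSucc]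
    by_cases h : k = i
    · subst h; simp
    · rw [Equiv.swap_apply_of_ne_of_ne (fun h' => h (Fin.castSucc_injective N h'))
        (Fin.castSucc_lt_last k).ne, Fin.snoc_castSucc, Function.update_of_ne h]

lemma sum_filter_castSucc_lt {E : Type*} [AddCommMonoid E] (i : Fin N) (F : Fin (N + 1) → E) :
    ∑ j ∈ Finset.univ.filter (i.castSucc < ·), F j =
      ∑ j ∈ Finset.univ.filter (i < ·), F j.castSucc + F (Fin.last N) := by
  rw [Finset.sum_filter, Fin.sum_univ_castSucc, if_pos (Fin.castSucc_lt_last i), Finset.sum_filter]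
  simp only [Fin.castSucc_lt_castSucc_iff]

/-- The coupling of the `i`-th factor to `V ⊗ B` is its coupling to `B` plus the canonical tensor on
`V ⊗ V`, which is the exchange with the last position minus `1/m`. The exchange is thereby absorbed,
and the eigenvalue shifts by `1/m`. -/
lemma IsEigenForm.peel {f : WordForm m (N + 1) A B} {χ : Fin (N + 1) → ℂ}
    (hf : IsEigenForm ρB f χ) :
    IsEigenForm (vecRep ρB) (peel f) (fun i => χ i.castSucc + 1 / m) := by
  intro i c a g
  have h' := Finset.sum_congr rfl fun d (_ : d ∈ Finset.univ) =>
    hf i.castSucc (Fin.snoc c d) a (g d)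
  simp only [sum_filter_castSucc_lt, snoc_comp_swap_castSucc, snoc_comp_swap_last,
    Fin.snoc_castSucc, ← Fin.snoc_update, Finset.sum_sub_distrib, Finset.sum_neg_distrib,
    Finset.sum_add_distrib, ← Finset.mul_sum] at h'
  simp only [peel_apply, vecRep_apply, map_add, map_sum, map_smul, Finset.sum_add_distrib,
    smul_eq_mul, add_mul, ← h']
  have h1 : ∑ e, ∑ d, ∑ d', (slUnit (c i) e).1 d d' * f (Fin.snoc (Function.update c i e) d) a
      (g d') = ∑ d, f (Fin.snoc (Function.update c i d) (c i)) a (g d) -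
        1 / m * ∑ d, f (Fin.snoc c d) a (g d) := by
    simp only [slUnit_apply, sub_mul, Finset.sum_sub_distrib, ite_and, ite_mul, one_mul, zero_mul,
      Finset.sum_ite_irrel, Finset.sum_ite_eq, Finset.sum_const_zero, Finset.mem_univ, if_true,
      Function.update_eq_self, Finset.mul_sum]
  rw [h1, Finset.sum_comm (f := fun j d => f (Fin.snoc (c ∘ Equiv.swap i j) d) a (g d)),
    Finset.sum_comm (f := fun e d => f (Fin.snoc (Function.update c i e) d) a
      (ρB (slUnit (c i) e) (g d)))]
  ring

end

section

variable {m : ℕ}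

/-- The number of occurrences of the letter `p` in the word `c`, from position `t` on. -/
def tailCount {N : ℕ} (c : Fin N → Fin m) (t : ℕ) (p : Fin m) : ℕ :=
  (Finset.univ.filter fun j : Fin N => t ≤ j ∧ c j = p).card

lemma tailCount_snoc {N : ℕ} (c : Fin N → Fin m) (d : Fin m) {t : ℕ} (ht : t ≤ N) (p : Fin m) :
    tailCount (Fin.snoc c d : Fin (N + 1) → Fin m) t p =
      tailCount c t p + if p = d then 1 else 0 := by
  simp only [tailCount, Finset.card_filter, Fin.sum_univ_castSucc, Fin.snoc_castSucc,
    Fin.snoc_last, Fin.val_castSucc, Fin.val_last, ht, true_and, eq_comm]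

lemma tailCount_length {N : ℕ} (c : Fin N → Fin m) (p : Fin m) : tailCount c N p = 0 := by
  rw [tailCount, Finset.card_eq_zero, Finset.filter_eq_empty_iff]
  exact fun j _ h => absurd h.1 (by have := j.2; omega)

variable {A B : Type*} [AddCommGroup A] [Module ℂ A] [AddCommGroup B] [Module ℂ B]

lemma exists_nat_weight {ρB : Slm m →ₗ⁅ℂ⁆ Module.End ℂ B} (K : Submodule ℂ B)
    (hK : ∀ x, ∀ b ∈ K, ρB x b ∈ K) {b : B} (hb : b ∉ K) {lam : Fin m → ℂ}
    (h1 : ∀ p q, q < p → ρB (slUnit p q) b ∈ K) (h2 : ∀ p, ρB (slUnit p p) b + lam p • b ∈ K)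
    {p q : Fin m} (hpq : p < q) {k : ℕ} (hk : (ρB (slUnit p q) ^ k) b ∈ K) :
    ∃ n : ℕ, lam p - lam q = n := by
  have hbr : ∀ x y, ρB x * ρB y - ρB y * ρB x = ρB ⁅x, y⁆ := fun x y => by
    rw [LieHom.map_lie, LieRing.of_associative_ring_bracket]
  refine exists_nat_of_nilpotent_mod (E := ρB (slUnit p q)) (F := ρB (slUnit q p))
    (H := ρB (slUnit p p) - ρB (slUnit q q)) ?_ ?_ K (hK _) (hK _) hb (h1 _ _ hpq) ?_ hk
  · rw [hbr, lie_slUnit_slUnit]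
    simp
  · rw [sub_mul, mul_sub, sub_sub_sub_comm, hbr, hbr, lie_slUnit_slUnit, lie_slUnit_slUnit]
    simp [hpq.ne', two_smul]
  · convert K.sub_mem (h2 p) (h2 q) using 1
    rw [LinearMap.sub_apply]
    module

end

/-- An eigenform on `A ⊗ V^{⊗N} ⊗ B`, where `A` is a highest weight module, is nonzero on some
tensor `v ⊗ u_c ⊗ b` of extremal vectors, and its eigenvalues are then determined by the word `c`.
If the simple raising operators act nilpotently on `b`, then all the weights obtained from that of
`b` by removing the letters of `c` one by one, starting with the last one, are dominant. -/
theorem exists_word_of_isEigenForm {m : ℕ} {A : Type*} [AddCommGroup A] [Module ℂ A]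
    (ρA : Slm m →ₗ⁅ℂ⁆ Module.End ℂ A) (v : A)
    (hA : ∀ D : Submodule ℂ A, v ∈ D → (∀ p q, q < p → ∀ a ∈ D, ρA (slUnit p q) a ∈ D) → D = ⊤)
    {N : ℕ} {B : Type*} [AddCommGroup B] [Module ℂ B] (ρB : Slm m →ₗ⁅ℂ⁆ Module.End ℂ B)
    (f : WordForm m N A B) (χ : Fin N → ℂ) (lam : Fin m → ℂ) (b : B)
    (hf : IsInvForm ρA ρB f) (he : IsEigenForm ρB f χ)
    (h1 : ∀ p q, q < p → ρB (slUnit p q) b ∈ formRad f)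
    (h2 : ∀ p, ρB (slUnit p p) b + lam p • b ∈ formRad f) (hb : b ∉ formRad f) :
    ∃ c : Fin N → Fin m, f c v b ≠ 0 ∧
      (∀ i, χ i = lam (c i) - (Finset.univ.filter fun j => i < j ∧ c j = c i).card +
        ((m : ℂ) - 1 - (c i : ℕ))) ∧
      ((∀ p q : Fin m, (p : ℕ) + 1 = q → ∃ k, (ρB (slUnit p q) ^ k) b ∈ formRad f) →
        ∀ t ≤ N, ∀ p q : Fin m, (p : ℕ) + 1 = q →
          ∃ n : ℕ, (lam p - tailCount c t p) - (lam q - tailCount c t q) = n) := by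
  induction N generalizing B lam with
  | zero =>
    obtain ⟨c, a, hca⟩ : ∃ c a, f c a b ≠ 0 := by
      by_contra! h
      exact hb (mem_formRad.2 h)
    refine ⟨c, fun h0 => hca ?_, fun i => i.elim0, fun hk t ht p q hpq => ?_⟩
    -- Without vector factors, `b` being of lowest weight modulo the radical makes the vectors of
    -- `A` pairing to zero with `b` a subspace stable under lowering operators; if it contains `v`,
    -- it is everything.
    · have := hA (LinearMap.ker (f c |>.flip b)) h0 fun p q hpq a _ => by
        have h3 := hf (slUnit p q) c a b
        rw [mem_formRad.1 (h1 p q hpq) c a] at h3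
        simpa using h3
      have ha : a ∈ LinearMap.ker (f c |>.flip b) := this ▸ Submodule.mem_top
      exact ha
    · obtain rfl : t = 0 := by omega
      obtain ⟨k, hk⟩ := hk p q hpq
      simp only [tailCount_length c, Nat.cast_zero, sub_zero]
      exact exists_nat_weight (formRad f) (fun x b hb => hf.apply_mem_formRad x hb) hb h1 h2
        (by rw [Fin.lt_def]; omega) hk
  | succ N ih =>
    set K := formRad (peel f) with hK
    have hKs : ∀ x, ∀ g ∈ K, vecRep ρB x g ∈ K := fun x g hg => hf.peel.apply_mem_formRad x hg
    have hsingle : ∀ d, ∀ b ∈ formRad f, (Pi.single d b : Fin m → B) ∈ K := by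
      intro d b hb
      rw [hK, mem_formRad]
      intro c a
      rw [peel_single]
      exact mem_formRad.1 hb _ a
    have hex : ∃ d, (Pi.single d b : Fin m → B) ∉ K := by
      by_contra! h
      refine hb (mem_formRad.2 fun c a => ?_)
      have := mem_formRad.1 (h (c (Fin.last N))) (Fin.init c) a
      rwa [peel_single, Fin.snoc_init_self] at this
    classical
    -- Lowering operators send `u_d` to letters beyond `d`. Taking `d` maximal therefore makes `u_d
    -- ⊗ b` of lowest weight modulo the radical, as the induction requires.
    obtain ⟨d, hd, hmax⟩ : ∃ d, (Pi.single d b : Fin m → B) ∉ K ∧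
        ∀ e, d < e → (Pi.single e b : Fin m → B) ∈ K := by
      have hne : (Finset.univ.filter fun d => (Pi.single d b : Fin m → B) ∉ K).Nonempty := by
        obtain ⟨d, hd⟩ := hex
        exact ⟨d, by simpa using hd⟩
      refine ⟨_, (Finset.mem_filter.1 (Finset.max'_mem _ hne)).2, fun e he => ?_⟩
      by_contra hcon
      exact absurd (Finset.le_max' _ e (by simpa using hcon)) (not_le.2 he)
    have h1' : ∀ p q, q < p → vecRep ρB (slUnit p q) (Pi.single d b) ∈ K := by
      intro p q hpq
      rw [vecRep_slUnit_single ρB hpq.ne']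
      refine K.add_mem (hsingle _ _ (h1 p q hpq)) ?_
      split_ifs with h
      · exact hmax p (h ▸ hpq)
      · exact K.zero_mem
    -- The weight of `u_d ⊗ b` is `-lam` plus the weight of `u_d`, whose coordinates are `δ_pd -
    -- 1/m`. The `1/m` matches the shift of the eigenvalues under peeling.
    have h2' : ∀ p, vecRep ρB (slUnit p p) (Pi.single d b) +
        (lam p - (if p = d then 1 else 0) + 1 / m) • (Pi.single d b : Fin m → B) ∈ K := by
      intro p
      rw [vecRep_slUnit_self_single]
      convert hsingle d _ (h2 p) using 1
      rw [Pi.single_add, Pi.single_smul']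
      module
    obtain ⟨c, hc1, hc2, hc3⟩ := ih (vecRep ρB) (peel f) _ _ (Pi.single d b) hf.peel he.peel
      h1' h2' hd
    rw [peel_single] at hc1
    have hcount : ∀ i : Fin N, (Finset.univ.filter fun j => i.castSucc < j ∧
        (Fin.snoc c d : Fin (N + 1) → Fin m) j = c i).card =
        (Finset.univ.filter fun j => i < j ∧ c j = c i).card + if c i = d then 1 else 0 := by
      intro i
      simp only [Finset.card_filter, Fin.sum_univ_castSucc, Fin.snoc_castSucc, Fin.snoc_last,
        Fin.castSucc_lt_castSucc_iff, Fin.castSucc_lt_last, true_and, eq_comm]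
    refine ⟨Fin.snoc c d, hc1, fun i => ?_, fun hnil t ht p q hpq => ?_⟩
    · induction i using Fin.lastCases with
      | cast i =>
        have := hc2 i
        rw [Fin.snoc_castSucc, hcount]
        push_cast
        linear_combination this
      | last =>
        rw [Fin.snoc_last]
        have h3 := he (Fin.last N) (Fin.snoc c d) v b
        have h4 : (Finset.univ.filter fun j => Fin.last N < j) = ∅ :=
          Finset.filter_eq_empty_iff.2 fun j _ => not_lt.2 (Fin.le_last j)
        have h5 : (Finset.univ.filter fun j => Fin.last N < j ∧
            (Fin.snoc c d : Fin (N + 1) → Fin m) j = d) = ∅ :=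
          Finset.filter_eq_empty_iff.2 fun j _ h => not_lt.2 (Fin.le_last j) h.1
        simp only [h4, Finset.sum_empty, neg_zero, zero_sub, Fin.update_snoc_last,
          Fin.snoc_last] at h3
        rw [h5, Finset.card_empty, Nat.cast_zero, sub_zero]
        -- For `e < d` the operator lowers and kills `b` modulo the radical; `e = d` gives the
        -- weight; for `e > d` both `u_e ⊗ b` and `E_de (u_e ⊗ b) = u_e ⊗ E_de b + u_d ⊗ b` lie in
        -- the radical, so the term is `-f`. There are `m - 1 - d` such `e`.
        have h6 : ∀ e, f (Fin.snoc c e) v (ρB (slUnit d e) b) =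
            (if d = e then -lam d * f (Fin.snoc c d) v b else 0) +
              if d < e then -f (Fin.snoc c d) v b else 0 := by
          intro e
          rcases lt_trichotomy e d with hed | rfl | hde
          · rw [mem_formRad.1 (h1 d e hed), if_neg hed.ne', if_neg hed.not_gt, add_zero]
          · have := mem_formRad.1 (h2 e) (Fin.snoc c e) v
            rw [map_add, map_smul, smul_eq_mul] at this
            rw [if_pos rfl, if_neg (lt_irrefl _), add_zero]
            linear_combination this
          · have h7 := hKs (slUnit d e) _ (hmax e hde)
            rw [vecRep_slUnit_single ρB hde.ne, if_pos rfl] at h7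
            have h8 := mem_formRad.1 h7 c v
            rw [map_add, peel_single, peel_single] at h8
            rw [if_neg hde.ne, if_pos hde, zero_add]
            linear_combination h8
        simp only [h6, Finset.sum_add_distrib, Finset.sum_ite_eq, Finset.mem_univ, if_true] at h3
        rw [← Finset.sum_filter, Finset.sum_const, Finset.filter_lt_eq_Ioi, Fin.card_Ioi,
          nsmul_eq_mul, Nat.sub_sub, Nat.cast_sub (by have := d.2; omega)] at h3
        push_cast at h3
        refine mul_right_cancel₀ hc1 ?_
        linear_combination -h3
    · rcases ht.lt_or_eq with ht' | rfl
      · have ht' : t ≤ N := by omega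
        obtain ⟨n, hn⟩ := hc3 (fun p q hpq => by
          obtain ⟨k, hk⟩ := hnil p q hpq
          have hne : p ≠ q := by
            rintro rfl
            omega
          refine ⟨k + 1, ?_⟩
          rw [vecRep_pow_single ρB hne]
          refine K.add_mem (hsingle _ _ ?_) ?_
          · rw [pow_succ', Module.End.mul_apply]
            exact hf.apply_mem_formRad _ hk
          · split_ifs
            · exact K.smul_mem _ (hsingle _ _ hk)
            · exact K.zero_mem) t ht' p q hpq
        refine ⟨n, ?_⟩
        rw [← hn, tailCount_snoc c d ht', tailCount_snoc c d ht']
        push_cast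
        ring
      -- At `t = N + 1` no letter is removed, and dominance is that of the weight of `b` itself;
      -- smaller `t` are covered by the induction.
      · obtain ⟨k, hk⟩ := hnil p q hpq
        simp only [tailCount_length, Nat.cast_zero, sub_zero]
        exact exists_nat_weight (formRad f) (fun x b hb => hf.apply_mem_formRad x hb) hb h1 h2
          (by rw [Fin.lt_def]; omega) hk

/-! ### Cyclic modules -/

/-- If a cyclic vector spans a line stable under `T`, and `S` and `T` span the Lie algebra, then the
module is generated by this vector under `S`. -/
lemma eq_top_of_stable {L M : Type*} [LieRing L] [LieAlgebra ℂ L] [AddCommGroup M] [Module ℂ M]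
    (ρ : L →ₗ⁅ℂ⁆ Module.End ℂ M) (S : Set L) (T : Set L)
    (hST : Submodule.span ℂ (S ∪ T) = ⊤) (v : M) (hT : ∀ t ∈ T, ∃ r : ℂ, ρ t v = r • v)
    (hgen : ∀ D : Submodule ℂ M, v ∈ D → (∀ x, ∀ a ∈ D, ρ x a ∈ D) → D = ⊤)
    (D : Submodule ℂ M) (hv : v ∈ D) (hD : ∀ s ∈ S, ∀ a ∈ D, ρ s a ∈ D) : D = ⊤ := by
  set D' : Submodule ℂ M := sInf {D | v ∈ D ∧ ∀ s ∈ S, ∀ a ∈ D, ρ s a ∈ D} with hD'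
  have hv' : v ∈ D' := Submodule.mem_sInf.2 fun E hE => hE.1
  have hS' : ∀ s ∈ S, ∀ a ∈ D', ρ s a ∈ D' := fun s hs a ha =>
    Submodule.mem_sInf.2 fun E hE => hE.2 s hs a (Submodule.mem_sInf.1 ha E hE)
  -- `D'` is the least `S`-stable subspace containing `v`. The vectors that the whole Lie algebra
  -- keeps inside `D'` form a subspace containing `v`, and `x s = s x + [x, s]` shows that it is
  -- `S`-stable; so it is all of `D'`. This replaces the Poincaré–Birkhoff–Witt theorem.
  let P : Submodule ℂ M :=
    { carrier := {d | d ∈ D' ∧ ∀ x, ρ x d ∈ D'}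
      add_mem' := fun {a b} ha hb => ⟨D'.add_mem ha.1 hb.1, fun x => by
        rw [map_add]; exact D'.add_mem (ha.2 x) (hb.2 x)⟩
      zero_mem' := ⟨D'.zero_mem, fun x => by rw [map_zero]; exact D'.zero_mem⟩
      smul_mem' := fun r a ha => ⟨D'.smul_mem r ha.1, fun x => by
        rw [map_smul]; exact D'.smul_mem r (ha.2 x)⟩ }
  have hP : D' ≤ P := by
    refine sInf_le ⟨⟨hv', fun x => ?_⟩, fun s hs a ha => ⟨hS' s hs a ha.1, fun x => ?_⟩⟩
    · have hx : x ∈ Submodule.span ℂ (S ∪ T) := hST ▸ Submodule.mem_top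
      induction hx using Submodule.span_induction with
      | mem x hx =>
        rcases hx with hx | hx
        · exact hS' x hx v hv'
        · obtain ⟨r, hr⟩ := hT x hx
          exact hr ▸ D'.smul_mem r hv'
      | zero => rw [map_zero]; exact D'.zero_mem
      | add x y _ _ hx hy => rw [map_add]; exact D'.add_mem hx hy
      | smul r x _ hx => rw [map_smul]; exact D'.smul_mem r hx
    · have h : ρ x (ρ s a) = ρ s (ρ x a) + ρ ⁅x, s⁆ a := by
        rw [LieHom.map_lie, LieRing.of_associative_ring_bracket, LinearMap.sub_apply,
          Module.End.mul_apply, Module.End.mul_apply, add_sub_cancel]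
      rw [h]
      exact D'.add_mem (hS' s hs _ (ha.2 x)) (ha.2 _)
  have htop : D' = ⊤ := hgen D' hv' fun x a ha => (hP ha).2 x
  exact top_le_iff.1 (htop ▸ sInf_le ⟨hv, hD⟩)

/-! ### Verma modules and lowest weight modules as cyclic modules -/

section

variable {m : ℕ}

lemma span_slUnit_union (r : Fin m → Fin m → Prop) (r' : Fin m → Fin m → Prop)
    (h : ∀ p q, r p q ∨ r' p q) :
    Submodule.span ℂ ({x : Slm m | ∃ p q, r p q ∧ x = slUnit p q} ∪
      {x | ∃ p q, r' p q ∧ x = slUnit p q}) = ⊤ := by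
  rw [eq_top_iff]
  intro x _
  rw [eq_sum_slUnit x]
  refine Submodule.sum_mem _ fun p _ => Submodule.sum_mem _ fun q _ => Submodule.smul_mem _ _
    (Submodule.subset_span ?_)
  rcases h p q with h | h
  · exact Or.inl ⟨p, q, h, rfl⟩
  · exact Or.inr ⟨p, q, h, rfl⟩

/-- A subspace stable under the Lie algebra is stable under the enveloping algebra. -/
lemma smul_mem_of_stable {A : Type} [AddCommGroup A] [Module ℂ A] [Module (Usl m) A]
    [IsScalarTower ℂ (Usl m) A] (D : Submodule ℂ A) (hD : ∀ x : Slm m, ∀ a ∈ D, actHom A x a ∈ D)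
    (u : Usl m) : ∀ a ∈ D, u • a ∈ D := by
  let S : Subalgebra ℂ (Usl m) :=
    { carrier := {u | ∀ a ∈ D, u • a ∈ D}
      mul_mem' := fun {u w} hu hw a ha => by rw [mul_smul]; exact hu _ (hw a ha)
      add_mem' := fun {u w} hu hw a ha => by rw [add_smul]; exact D.add_mem (hu a ha) (hw a ha)
      algebraMap_mem' := fun r a ha => by rw [algebraMap_smul]; exact D.smul_mem r ha }
  let j : Slm m →ₗ⁅ℂ⁆ S :=
    { toFun := fun x => ⟨toU x, hD x⟩
      map_add' := fun x y => Subtype.ext (map_add (UniversalEnvelopingAlgebra.ι ℂ) x y)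
      map_smul' := fun r x => Subtype.ext (map_smul (UniversalEnvelopingAlgebra.ι ℂ) r x)
      map_lie' := fun {x y} => Subtype.ext (LieHom.map_lie (UniversalEnvelopingAlgebra.ι ℂ) x y) }
  have h : S.val.comp (UniversalEnvelopingAlgebra.lift ℂ j) = AlgHom.id ℂ (Usl m) := by
    apply UniversalEnvelopingAlgebra.hom_ext
    ext x
    exact congrArg Subtype.val (UniversalEnvelopingAlgebra.lift_ι_apply ℂ j x)
  have hu : u = S.val (UniversalEnvelopingAlgebra.lift ℂ j u) :=
    (congrArg (fun F => F u) h).symm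
  rw [hu]
  exact (UniversalEnvelopingAlgebra.lift ℂ j u).2

/-- A lowest weight vector of weight `-lam` generating the module. -/
structure IsLowest (B : Type) [AddCommGroup B] [Module ℂ B] [Module (Usl m) B]
    [IsScalarTower ℂ (Usl m) B] (lam : Fin m → ℂ) (b : B) : Prop where
  gen : ∀ u : B, ∃ x : Usl m, x • b = u
  low : ∀ p q : Fin m, q < p → actHom B (slUnit p q) b = 0
  weight : ∀ p : Fin m, actHom B (slUnit p p) b = -lam p • b

lemma IsLowest.eq_top {B : Type} [AddCommGroup B] [Module ℂ B] [Module (Usl m) B]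
    [IsScalarTower ℂ (Usl m) B] {lam : Fin m → ℂ} {b : B} (h : IsLowest B lam b)
    (D : Submodule ℂ B) (hb : b ∈ D) (hD : ∀ x : Slm m, ∀ a ∈ D, actHom B x a ∈ D) : D = ⊤ := by
  rw [eq_top_iff]
  intro u _
  obtain ⟨x, rfl⟩ := h.gen u
  exact smul_mem_of_stable D hD x b hb

lemma IsLowest.eq_top_of_raising {B : Type} [AddCommGroup B] [Module ℂ B] [Module (Usl m) B]
    [IsScalarTower ℂ (Usl m) B] {lam : Fin m → ℂ} {b : B} (h : IsLowest B lam b)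
    (D : Submodule ℂ B) (hb : b ∈ D)
    (hD : ∀ p q : Fin m, p < q → ∀ a ∈ D, actHom B (slUnit p q) a ∈ D) : D = ⊤ := by
  refine eq_top_of_stable (actHom B) _ _ (span_slUnit_union (· < ·) (fun p q => q ≤ p) lt_or_ge)
    b ?_ h.eq_top D hb ?_
  · rintro _ ⟨p, q, hpq, rfl⟩
    rcases hpq.lt_or_eq with hpq | rfl
    · exact ⟨0, by rw [h.low p q hpq, zero_smul]⟩
    · exact ⟨_, h.weight _⟩
  · rintro _ ⟨p, q, hpq, rfl⟩
    exact hD p q hpq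

lemma slUnit_mem_nPos {p q : Fin m} (h : p < q) : slUnit p q ∈ nPos m := by
  intro a b hab
  rw [slUnit_apply, if_neg, if_neg, sub_zero]
  · exact fun h' => h.ne h'.1
  · rintro ⟨rfl, rfl⟩
    exact absurd h (not_lt.2 hab)

lemma slUnit_mem_nNeg {p q : Fin m} (h : q < p) : slUnit p q ∈ nNeg m := by
  intro a b hab
  rw [slUnit_apply, if_neg, if_neg, sub_zero]
  · exact fun h' => h.ne' h'.1
  · rintro ⟨rfl, rfl⟩
    exact absurd h (not_lt.2 hab)

lemma toU_smul_mk_one (n : Set (Slm m)) (χ : Weight m) {x : Slm m} (hx : x ∈ n) :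
    toU x • (Submodule.Quotient.mk 1 : Usl m ⧸ vermaIdeal n χ) = 0 := by
  rw [← Submodule.Quotient.mk_smul, smul_eq_mul, mul_one, Submodule.Quotient.mk_eq_zero]
  exact Submodule.subset_span (Or.inl ⟨x, hx, rfl⟩)

lemma toU_cartan_smul_mk_one (n : Set (Slm m)) (χ : Weight m) (h : cartan m) :
    toU h.1 • (Submodule.Quotient.mk 1 : Usl m ⧸ vermaIdeal n χ) =
      χ h • Submodule.Quotient.mk 1 := by
  rw [← sub_eq_zero, ← Submodule.Quotient.mk_smul, ← Submodule.Quotient.mk_smul,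
    ← Submodule.Quotient.mk_sub, Submodule.Quotient.mk_eq_zero, smul_eq_mul, mul_one,
    ← Algebra.algebraMap_eq_smul_one]
  exact Submodule.subset_span (Or.inr ⟨h, rfl⟩)

lemma smul_mk_one_surjective (n : Set (Slm m)) (χ : Weight m) (v : Usl m ⧸ vermaIdeal n χ) :
    ∃ u : Usl m, u • (Submodule.Quotient.mk 1 : Usl m ⧸ vermaIdeal n χ) = v := by
  obtain ⟨u, rfl⟩ := Submodule.Quotient.mk_surjective _ v
  exact ⟨u, by rw [← Submodule.Quotient.mk_smul, smul_eq_mul, mul_one]⟩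

lemma isLowest_lwVector (lam : Weight m) :
    IsLowest (VermaLow lam) (wcoord lam) (lwVector lam) where
  gen := smul_mk_one_surjective _ _
  low p q h := toU_smul_mk_one _ _ (slUnit_mem_nNeg h)
  weight p := by
    rw [slUnit_self]
    exact toU_cartan_smul_mk_one _ _ (xCartan p)

lemma toIrrLow_smul (lam : Weight m) (u : Usl m) (v : VermaLow lam) :
    toIrrLow lam (u • v) = u • toIrrLow lam v := rfl

lemma toIrrLow_actHom (lam : Weight m) (x : Slm m) (v : VermaLow lam) :
    toIrrLow lam (actHom _ x v) = actHom _ x (toIrrLow lam v) := by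
  rw [actHom_apply, actHom_apply, toIrrLow_smul]

lemma toIrrLow_surjective (lam : Weight m) : Function.Surjective (toIrrLow lam) :=
  fun v => (Submodule.Quotient.mk_surjective (sumProper (Usl m) (VermaLow lam)) v)

lemma isLowest_toIrrLow (lam : Weight m) :
    IsLowest (IrrLow lam) (wcoord lam) (toIrrLow lam (lwVector lam)) where
  gen v := by
    obtain ⟨v, rfl⟩ := toIrrLow_surjective lam v
    obtain ⟨u, rfl⟩ := (isLowest_lwVector lam).gen v
    exact ⟨u, rfl⟩
  low p q h := by rw [← toIrrLow_actHom, (isLowest_lwVector lam).low p q h, map_zero]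
  weight p := by rw [← toIrrLow_actHom, (isLowest_lwVector lam).weight p, map_smul]

lemma verma_eq_top (μ : Weight m) (D : Submodule ℂ (Verma μ)) (hv : hwVector μ ∈ D)
    (hD : ∀ p q : Fin m, q < p → ∀ a ∈ D, actHom (Verma μ) (slUnit p q) a ∈ D) : D = ⊤ := by
  refine eq_top_of_stable (actHom (m := m) (Verma μ)) _ _
    (span_slUnit_union (fun p q => q < p) (fun p q => p ≤ q) fun p q => lt_or_ge q p)
    (hwVector μ) ?_ ?_ D hv ?_
  · rintro _ ⟨p, q, hpq, rfl⟩
    rcases hpq.lt_or_eq with hpq | rfl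
    · exact ⟨0, by rw [zero_smul]; exact toU_smul_mk_one _ _ (slUnit_mem_nPos hpq)⟩
    · exact ⟨_, by rw [slUnit_self]; exact toU_cartan_smul_mk_one _ _ (xCartan p)⟩
  · intro E hE hE'
    rw [eq_top_iff]
    intro u _
    obtain ⟨x, rfl⟩ := smul_mk_one_surjective _ _ u
    exact smul_mem_of_stable E hE' x _ hE
  · rintro _ ⟨p, q, hpq, rfl⟩
    exact hD p q hpq

lemma actHom_slUnit_self_hwVector (μ : Weight m) (p : Fin m) :
    actHom (Verma μ) (slUnit p p) (hwVector μ) = wcoord μ p • hwVector μ := by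
  rw [slUnit_self]
  exact toU_cartan_smul_mk_one _ _ (xCartan p)

lemma actHom_slUnit_hwVector (μ : Weight m) {p q : Fin m} (h : p < q) :
    actHom (Verma μ) (slUnit p q) (hwVector μ) = 0 :=
  toU_smul_mk_one _ _ (slUnit_mem_nPos h)

end

/-! ### Linear forms on coinvariants -/

section

variable {m N : ℕ} {A B : Type} [AddCommGroup A] [Module ℂ A] [Module (Usl m) A]
  [IsScalarTower ℂ (Usl m) A] [AddCommGroup B] [Module ℂ B] [Module (Usl m) B]
  [IsScalarTower ℂ (Usl m) B]

/-- The form on words attached to a linear form on coinvariants. -/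
def wordForm (g : Func (m := m) N A B →ₗ[ℂ] ℂ) : WordForm m N A B := fun c =>
  LinearMap.mk₂ ℂ (fun a b => g (cls N A B (wordTens a c b)))
    (fun a a' b => by rw [wordTens_add_left, cls_eq, map_add, map_add]; rfl)
    (fun r a b => by rw [wordTens_smul_left, cls_eq, map_smul, map_smul]; rfl)
    (fun a b b' => by rw [wordTens_add_right, cls_eq, map_add, map_add]; rfl)
    (fun r a b => by rw [wordTens_smul_right, cls_eq, map_smul, map_smul]; rfl)

lemma wordForm_apply (g : Func (m := m) N A B →ₗ[ℂ] ℂ) (c : Fin N → Fin m) (a : A) (b : B) :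
    wordForm g c a b = g (cls N A B (wordTens a c b)) := rfl

lemma wordForm_eq_zero {g : Func (m := m) N A B →ₗ[ℂ] ℂ}
    (h : ∀ c a b, wordForm g c a b = 0) : g = 0 := by
  have : g ∘ₗ (diagImage (m := m) N A B).mkQ = 0 := tens_ext fun a c b => h c a b
  exact LinearMap.ext fun v => Submodule.Quotient.induction_on _ v
    fun w => congrArg (fun F => F w) this

lemma isInvForm_wordForm (g : Func (m := m) N A B →ₗ[ℂ] ℂ) :
    IsInvForm (actHom A) (actHom B) (wordForm g) := by
  intro x c a b
  have h := congrArg g (mkQ_diagAct x (wordTens a c b))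
  rw [diagAct_wordTens] at h
  simp only [wordForm_apply, cls_eq]
  simpa only [map_add, map_sum, map_smul, map_zero, smul_eq_mul] using h

lemma form_funcY (g : Func (m := m) N A B →ₗ[ℂ] ℂ) (i : Fin N) (a : A) (c : Fin N → Fin m) (b : B) :
    g (funcY N A B i (cls N A B (wordTens a c b))) =
      - ∑ j ∈ Finset.univ.filter (i < ·), wordForm g (c ∘ Equiv.swap i j) a b -
      ∑ d, wordForm g (Function.update c i d) a (actHom B (slUnit (c i) d) b) +
      yShift m N * wordForm g c a b := by
  have h1 : cls (m := m) N A B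
      (- ∑ j ∈ Finset.univ.filter (i < ·), wordTens a (c ∘ Equiv.swap i j) b -
      ∑ d, wordTens a (Function.update c i d) (actHom B (slUnit (c i) d) b)) =
      - ∑ j ∈ Finset.univ.filter (i < ·), cls (m := m) N A B (wordTens a (c ∘ Equiv.swap i j) b) -
      ∑ d, cls (m := m) N A B
        (wordTens a (Function.update c i d) (actHom B (slUnit (c i) d) b)) := by
    simp only [cls_eq]
    rw [← map_sum, ← map_sum, ← map_neg, ← map_sub]
  rw [funcY_cls, opY_wordTens, map_add, map_smul, smul_eq_mul, h1, map_sub, map_neg, map_sum,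
    map_sum]
  rfl

lemma isEigenForm_wordForm {g : Func (m := m) N A B →ₗ[ℂ] ℂ} {χ : Fin N → ℂ}
    (hg : ∀ i v, g (funcY N A B i v) = χ i * g v) :
    IsEigenForm (actHom B) (wordForm g) (fun i => χ i - yShift m N) := by
  intro i c a b
  have h := hg i (cls N A B (wordTens a c b))
  rw [form_funcY, ← wordForm_apply] at h
  linear_combination h

end

section

variable {m N : ℕ}

lemma sum_diag_slUnit {S : Type*} [Fintype S] (c : S → Fin m) (p : Fin m) :
    ∑ i, (slUnit p p).1 (c i) (c i) =
      (Finset.univ.filter fun i => c i = p).card - Fintype.card S / (m : ℂ) := by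
  simp only [slUnit_apply, Finset.sum_sub_distrib]
  simp only [and_self, if_true, Finset.sum_boole, Finset.sum_const, Finset.card_univ,
    nsmul_eq_mul]
  simp only [eq_comm]
  ring

/-- An invariant form is nonzero only on tensors of total weight zero. The term `N / m` comes from
the trace correction of the `N` letters. -/
lemma card_eq_of_wordForm_ne_zero {A B : Type*} [AddCommGroup A] [Module ℂ A] [AddCommGroup B]
    [Module ℂ B] {ρA : Slm m →ₗ⁅ℂ⁆ Module.End ℂ A} {ρB : Slm m →ₗ⁅ℂ⁆ Module.End ℂ B}
    {f : WordForm m N A B} (hf : IsInvForm ρA ρB f) {a : A} {b : B} {μ lam : Fin m → ℂ}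
    (ha : ∀ p, ρA (slUnit p p) a = μ p • a) (hb : ∀ p, ρB (slUnit p p) b = -lam p • b)
    {c : Fin N → Fin m} (h : f c a b ≠ 0) (p : Fin m) :
    ((Finset.univ.filter fun i => c i = p).card : ℂ) = lam p - μ p + N / m := by
  have h1 := hf (slUnit p p) c a b
  have h2 : ∀ i, ∑ d, (slUnit p p).1 d (c i) * f (Function.update c i d) a b =
      (slUnit p p).1 (c i) (c i) * f c a b := by
    intro i
    rw [Finset.sum_eq_single (c i), Function.update_eq_self]
    · intro d _ hd
      have : ¬ (p = d ∧ p = c i) := fun h' => hd (h'.1.symm.trans h'.2)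
      rw [slUnit_apply, if_neg this, if_neg fun h' => hd h'.2, sub_zero, zero_mul]
    · simp
  simp only [h2] at h1
  rw [← Finset.sum_mul, sum_diag_slUnit, Fintype.card_fin, ha, hb, map_smul, map_smul, LinearMap.smul_apply,
    smul_eq_mul, smul_eq_mul] at h1
  refine mul_right_cancel₀ h ?_
  linear_combination h1

variable {μ : Weight m} {B : Type} [AddCommGroup B] [Module ℂ B] [Module (Usl m) B]
  [IsScalarTower ℂ (Usl m) B] {lam : Fin m → ℂ} {b : B}

/-- A linear form on coinvariants is determined by its values on the extremal vectors. -/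
lemma form_eq_zero (hB : IsLowest B lam b) {g : Func (m := m) N (Verma μ) B →ₗ[ℂ] ℂ}
    (h : ∀ c, g (cls N _ B (wordTens (hwVector μ) c b)) = 0) : g = 0 := by
  have h1 : b ∈ formRad (wordForm g) := by
    -- With `b` fixed, invariance under a lowering operator has no term in `B`, so the vectors of
    -- `A` orthogonal to all words tensored with `b` are stable under lowering. Afterwards the
    -- argument `b` is moved through `B`.
    have hD := verma_eq_top μ (⨅ c, LinearMap.ker ((wordForm g c).flip b))
      ((Submodule.mem_iInf _).2 h) fun p q hpq a ha => by
        simp only [Submodule.mem_iInf, LinearMap.mem_ker, LinearMap.flip_apply] at ha ⊢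
        intro c
        have := isInvForm_wordForm g (slUnit p q) c a b
        rw [hB.low p q hpq] at this
        simpa [ha] using this
    rw [mem_formRad]
    intro c a
    have ha : a ∈ ⨅ c, LinearMap.ker ((wordForm g c).flip b) := hD ▸ Submodule.mem_top
    exact (Submodule.mem_iInf _).1 ha c
  have h2 := hB.eq_top (formRad (wordForm g)) h1
    fun x b hb => (isInvForm_wordForm g).apply_mem_formRad x hb
  refine wordForm_eq_zero fun c a b' => ?_
  exact mem_formRad.1 (h2 ▸ Submodule.mem_top : b' ∈ formRad (wordForm g)) c a

lemma span_cls_eq_top (hB : IsLowest B lam b) : Submodule.span ℂ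
    (Set.range fun c => cls (m := m) N (Verma μ) B (wordTens (hwVector μ) c b)) = ⊤ := by
  by_contra hne
  obtain ⟨g, hg, hg'⟩ := Submodule.exists_le_ker_of_lt_top _ (lt_top_iff_ne_top.2 hne)
  exact hg (form_eq_zero hB fun c => hg' (Submodule.subset_span ⟨c, rfl⟩))

lemma finiteDimensional_func (hB : IsLowest B lam b) :
    FiniteDimensional ℂ (Func (m := m) N (Verma μ) B) :=
  ⟨Submodule.fg_def.2 ⟨_, Set.finite_range _, span_cls_eq_top hB⟩⟩

end

/-! ### Functions on words -/

section

variable {m : ℕ} {S : Type} [DecidableEq S]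

/-- The action of a matrix on the `i`-th factor, in coordinates. -/
def wordOp (i : S) (x : Matrix (Fin m) (Fin m) ℂ) : Module.End ℂ ((S → Fin m) → ℂ) where
  toFun g c := ∑ d, x (c i) d * g (Function.update c i d)
  map_add' g h := by
    ext c
    simp [mul_add, Finset.sum_add_distrib]
  map_smul' r g := by
    ext c
    simp [Finset.mul_sum, mul_left_comm]

lemma wordOp_apply (i : S) (x : Matrix (Fin m) (Fin m) ℂ) (g : (S → Fin m) → ℂ) (c : S → Fin m) :
    wordOp i x g c = ∑ d, x (c i) d * g (Function.update c i d) := rfl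

lemma wordOp_mul_self (i : S) (x y : Matrix (Fin m) (Fin m) ℂ) :
    wordOp i x * wordOp i y = wordOp i (x * y) := by
  refine LinearMap.ext fun g => funext fun c => ?_
  simp only [Module.End.mul_apply, wordOp_apply, Function.update_self, Function.update_idem,
    Matrix.mul_apply, Finset.mul_sum, Finset.sum_mul]
  rw [Finset.sum_comm]
  simp only [mul_assoc]

lemma wordOp_comm {i j : S} (h : i ≠ j) (x y : Matrix (Fin m) (Fin m) ℂ) :
    wordOp i x * wordOp j y = wordOp j y * wordOp i x := by
  refine LinearMap.ext fun g => funext fun c => ?_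
  simp only [Module.End.mul_apply, wordOp_apply, Function.update_of_ne h, Function.update_of_ne h.symm,
    Finset.mul_sum]
  rw [Finset.sum_comm]
  simp only [Function.update_comm h, mul_left_comm]

variable [Fintype S]

/-- The diagonal action of a matrix on functions on words. -/
def wordSum (S : Type) [Fintype S] [DecidableEq S] :
    Matrix (Fin m) (Fin m) ℂ →ₗ[ℂ] Module.End ℂ ((S → Fin m) → ℂ) where
  toFun x := ∑ i, wordOp i x
  map_add' x y := by
    refine LinearMap.ext fun g => funext fun c => ?_
    simp [wordOp_apply, LinearMap.sum_apply, add_mul, Finset.sum_add_distrib]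
  map_smul' r x := by
    refine LinearMap.ext fun g => funext fun c => ?_
    simp [wordOp_apply, LinearMap.sum_apply, Finset.mul_sum, mul_assoc]

lemma wordSum_apply (x : Matrix (Fin m) (Fin m) ℂ) (g : (S → Fin m) → ℂ) (c : S → Fin m) :
    wordSum S x g c = ∑ i, ∑ d, x (c i) d * g (Function.update c i d) := by
  simp [wordSum, LinearMap.sum_apply, wordOp_apply]

lemma wordSum_lie (x y : Matrix (Fin m) (Fin m) ℂ) :
    wordSum S (x * y - y * x) = wordSum S x * wordSum S y - wordSum S y * wordSum S x := by
  have h : ∀ i, wordOp i x * ∑ j, wordOp j y - (∑ j, wordOp j y) * wordOp (S := S) i x =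
      wordOp i (x * y) - wordOp i (y * x) := by
    intro i
    rw [Finset.mul_sum, Finset.sum_mul, ← Finset.sum_sub_distrib, Finset.sum_eq_single i,
      wordOp_mul_self, wordOp_mul_self]
    · intro j _ hj
      rw [wordOp_comm hj.symm, sub_self]
    · simp
  rw [map_sub]
  change ∑ i, wordOp i (x * y) - ∑ i, wordOp i (y * x) =
    (∑ i, wordOp i x) * (∑ i, wordOp i y) - (∑ i, wordOp i y) * ∑ i, wordOp i x
  rw [← Finset.sum_sub_distrib, Finset.sum_mul, Finset.mul_sum (Finset.univ : Finset S),
    ← Finset.sum_sub_distrib]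
  exact Finset.sum_congr rfl fun i _ => (h i).symm

lemma wordSum_comp (x : Matrix (Fin m) (Fin m) ℂ) (g : (S → Fin m) → ℂ) (π : Equiv.Perm S)
    (c : S → Fin m) : wordSum S x g (c ∘ π) = wordSum S x (fun c => g (c ∘ π)) c := by
  rw [wordSum_apply, wordSum_apply]
  refine Fintype.sum_equiv π _ _ fun i => Finset.sum_congr rfl fun d _ => ?_
  rw [Function.update_comp_equiv, Equiv.symm_apply_apply, Function.comp_apply]

/-- For the standard bilinear form on functions, the transposed matrix acts as the adjoint.
Contravariance of the hermitian form used below rests on this. -/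
lemma sum_wordSum_mul (x : Matrix (Fin m) (Fin m) ℂ) (g h : (S → Fin m) → ℂ) :
    ∑ c, wordSum S x g c * h c = ∑ c, g c * wordSum S x.transpose h c := by
  simp only [wordSum_apply, Finset.sum_mul, Finset.mul_sum]
  rw [Finset.sum_comm]
  conv_rhs => rw [Finset.sum_comm]
  refine Finset.sum_congr rfl fun i _ => ?_
  rw [← Finset.sum_product', ← Finset.sum_product']
  refine Finset.sum_nbij' (fun q => (Function.update q.1 i q.2, q.1 i))
    (fun q => (Function.update q.1 i q.2, q.1 i)) ?_ ?_ ?_ ?_ ?_ <;>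
  simp [mul_assoc, mul_comm]

lemma star_wordSum_slUnit (p q : Fin m) (g : (S → Fin m) → ℂ) :
    star (wordSum S (slUnit p q).1 g) = wordSum S (slUnit p q).1 (star g) := by
  ext c
  simp only [Pi.star_apply, wordSum_apply, star_sum, star_mul', slUnit_apply, star_sub]
  refine Finset.sum_congr rfl fun i _ => Finset.sum_congr rfl fun d _ => ?_
  congr 1
  split_ifs <;> simp

lemma wordSum_slUnit_self (p : Fin m) (g : (S → Fin m) → ℂ) (c : S → Fin m) :
    wordSum S (slUnit p p).1 g c =
      ((Finset.univ.filter fun i => c i = p).card - Fintype.card S / (m : ℂ)) * g c := by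
  rw [wordSum_apply, ← sum_diag_slUnit, Finset.sum_mul]
  refine Finset.sum_congr rfl fun i _ => ?_
  rw [Finset.sum_eq_single (c i), Function.update_eq_self]
  · intro d _ hd
    rw [slUnit_apply, if_neg, if_neg fun h => hd h.2.symm, sub_zero, zero_mul]
    exact fun h => hd (h.2.symm.trans h.1)
  · simp

lemma wordSum_slUnit_of_ne {p q : Fin m} (h : p ≠ q) (g : (S → Fin m) → ℂ) (c : S → Fin m) :
    wordSum S (slUnit p q).1 g c =
      ∑ i ∈ Finset.univ.filter (fun i => c i = p), g (Function.update c i q) := by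
  rw [wordSum_apply, Finset.sum_filter]
  refine Finset.sum_congr rfl fun i _ => ?_
  rw [Finset.sum_eq_single q, slUnit_apply, if_neg (c := p = q ∧ _) fun h' => h h'.1, sub_zero]
  · simp [eq_comm]
  · intro d _ hd
    rw [slUnit_apply, if_neg fun h' => hd h'.2.symm, if_neg fun h' => h h'.1, sub_zero, zero_mul]
  · simp

/-- Each application evaluates the function at words with one letter `p` changed to `q`, and the
letters `p` run out. -/
lemma wordSum_slUnit_pow_apply {p q : Fin m} (h : p ≠ q) (g : (S → Fin m) → ℂ) (k : ℕ)
    (c : S → Fin m) (hc : (Finset.univ.filter fun i => c i = p).card < k) :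
    (wordSum S (slUnit p q).1 ^ k) g c = 0 := by
  induction k generalizing c with
  | zero => omega
  | succ k ih =>
    rw [pow_succ', Module.End.mul_apply, wordSum_slUnit_of_ne h]
    refine Finset.sum_eq_zero fun i hi => ih _ ?_
    have h1 : (Finset.univ.filter fun j => Function.update c i q j = p) ⊆
        (Finset.univ.filter fun j => c j = p).erase i := by
      intro j hj
      rw [Finset.mem_filter] at hj
      have hji : j ≠ i := by
        rintro rfl
        rw [Function.update_self] at hj
        exact h hj.2.symm
      rw [Function.update_of_ne hji] at hj
      exact Finset.mem_erase.2 ⟨hji, Finset.mem_filter.2 ⟨Finset.mem_univ _, hj.2⟩⟩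
    have h2 := Finset.card_le_card h1
    rw [Finset.card_erase_of_mem hi] at h2
    have := Finset.card_pos.2 ⟨i, hi⟩
    omega

lemma wordSum_slUnit_pow_eq_zero {p q : Fin m} (h : p ≠ q) :
    wordSum S (slUnit p q).1 ^ (Fintype.card S + 1) = 0 := by
  refine LinearMap.ext fun g => funext fun c => ?_
  exact wordSum_slUnit_pow_apply h g _ c (Nat.lt_succ_of_le (Finset.card_le_univ _))

/-- The representation of `sl_m` on functions on words. -/
def wordRep (m : ℕ) (S : Type) [Fintype S] [DecidableEq S] :
    Slm m →ₗ⁅ℂ⁆ Module.End ℂ ((S → Fin m) → ℂ) where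
  toFun x := wordSum S x.1
  map_add' x y := map_add (wordSum S) x.1 y.1
  map_smul' r x := map_smul (wordSum S) r x.1
  map_lie' {x y} := wordSum_lie x.1 y.1

/-- The dual representation of `sl_m` on functions on words. -/
def wordDual (m : ℕ) (S : Type) [Fintype S] [DecidableEq S] :
    Slm m →ₗ⁅ℂ⁆ Module.End ℂ ((S → Fin m) → ℂ) where
  toFun x := -wordSum S x.1.transpose
  map_add' x y := by
    rw [← neg_add, ← map_add]
    rfl
  map_smul' r x := by
    rw [RingHom.id_apply, smul_neg, ← map_smul]
    rfl
  map_lie' {x y} := by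
    have h := wordSum_lie (S := S) y.1.transpose x.1.transpose
    have h1 : ⁅x, y⁆.1.transpose =
      y.1.transpose * x.1.transpose - x.1.transpose * y.1.transpose := by
      rw [← Matrix.transpose_mul, ← Matrix.transpose_mul, ← Matrix.transpose_sub]
      rfl
    have key : ∀ {R : Type} [Ring R] (a b : R), -(a * b - b * a) = -b * -a - -a * -b := by
      intro R _ a b
      noncomm_ring
    rw [h1, h, LieRing.of_associative_ring_bracket]
    exact key _ _

lemma wordRep_apply (x : Slm m) : wordRep m S x = wordSum S x.1 := rfl

lemma wordDual_apply (x : Slm m) : wordDual m S x = -wordSum S x.1.transpose := rfl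

lemma slUnit_transpose (p q : Fin m) : (slUnit p q).1.transpose = (slUnit q p).1 := by
  ext a b
  simp only [Matrix.transpose_apply, slUnit_apply]
  simp only [and_comm, eq_comm]

/-! ### Column antisymmetrization -/

/-- The diagram with rows `row` and columns `col` has no repeated cells, and its columns start in
the first row. -/
structure IsDiagram (row : S → Fin m) (col : S → ℕ) : Prop where
  inj : ∀ s t, row s = row t → col s = col t → s = t
  up : ∀ s, ∀ p < row s, ∃ t, row t = p ∧ col t = col s

/-- The column antisymmetrization of the row word of a diagram. -/
def colAnti (row : S → Fin m) (col : S → ℕ) (c : S → Fin m) : ℂ :=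
  ∑ σ : Equiv.Perm S, if col ∘ σ = col ∧ c = row ∘ σ then ((Equiv.Perm.sign σ : ℤ) : ℂ) else 0

lemma colAnti_comp (row : S → Fin m) (col : S → ℕ) {π : Equiv.Perm S} (hπ : col ∘ π = col)
    (c : S → Fin m) : colAnti row col (c ∘ π) = (Equiv.Perm.sign π : ℤ) * colAnti row col c := by
  rw [colAnti, colAnti, Finset.mul_sum, eq_comm]
  refine Fintype.sum_equiv (Equiv.mulRight π) _ _ fun σ => ?_
  have h1 : col ∘ (σ * π : Equiv.Perm S) = col ↔ col ∘ σ = col := by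
    rw [Equiv.Perm.coe_mul, ← Function.comp_assoc]
    nth_rw 2 [← hπ]
    exact π.surjective.injective_comp_right.eq_iff
  have h2 : c ∘ π = row ∘ (σ * π : Equiv.Perm S) ↔ c = row ∘ σ := by
    rw [Equiv.Perm.coe_mul, ← Function.comp_assoc]
    exact π.surjective.injective_comp_right.eq_iff
  simp only [Equiv.coe_mulRight, h1, h2, mul_ite, mul_zero, map_mul, Units.val_mul, Int.cast_mul]
  rw [mul_comm]

lemma exists_of_colAnti_ne_zero {row : S → Fin m} {col : S → ℕ} {c : S → Fin m}
    (h : colAnti row col c ≠ 0) : ∃ σ : Equiv.Perm S, col ∘ σ = col ∧ c = row ∘ σ := by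
  by_contra hcon
  push Not at hcon
  refine h (Finset.sum_eq_zero fun σ _ => if_neg ?_)
  exact fun hσ => hcon σ hσ.1 hσ.2

lemma colAnti_row {row : S → Fin m} {col : S → ℕ} (h : IsDiagram row col) :
    colAnti row col row = 1 := by
  rw [colAnti, Finset.sum_eq_single 1]
  · simp
  · intro σ _ hσ
    refine if_neg fun h' => hσ (Equiv.ext fun s => h.inj _ _ ?_ ?_)
    · exact (congrFun h'.2 s).symm
    · exact congrFun h'.1 s
  · simp

lemma star_colAnti (row : S → Fin m) (col : S → ℕ) :
    star (colAnti row col) = colAnti row col := by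
  ext c
  simp only [Pi.star_apply, colAnti, star_sum, apply_ite star, star_zero]
  simp

/-- If a letter `p` of `c` can be changed to `q` within the support, the same column already holds
another letter `p`, because columns start in the first row. Exchanging these two positions fixes `c`
but changes the sign of the antisymmetrizer, so the value at `c` is its own negative. -/
lemma wordSum_colAnti_of_lt {row : S → Fin m} {col : S → ℕ} (h : IsDiagram row col) {p q : Fin m}
    (hpq : p < q) : wordSum S (slUnit p q).1 (colAnti row col) = 0 := by
  ext c
  by_contra hne
  have hne' := hne
  rw [wordSum_slUnit_of_ne hpq.ne] at hne
  obtain ⟨i, hi, hi'⟩ := Finset.exists_ne_zero_of_sum_ne_zero hne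
  obtain ⟨σ, hσ, hc⟩ := exists_of_colAnti_ne_zero hi'
  have hrow : row (σ i) = q := by
    have := congrFun hc i
    rwa [Function.update_self, Function.comp_apply, eq_comm] at this
  obtain ⟨t, ht, ht'⟩ := h.up (σ i) p (hrow ▸ hpq)
  obtain ⟨j, rfl⟩ := σ.surjective t
  have hji : j ≠ i := by
    rintro rfl
    exact hpq.ne (ht.symm.trans hrow)
  have hcj : c j = c i := by
    have := congrFun hc j
    rw [Function.update_of_ne hji, Function.comp_apply, ht] at this
    rw [this, (Finset.mem_filter.1 hi).2]
  have hcol : col i = col j := by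
    rw [← congrFun hσ i, ← congrFun hσ j]
    exact ht'.symm
  have h1 : c ∘ Equiv.swap i j = c := by
    ext k
    rw [Function.comp_apply, Equiv.swap_apply_def]
    split_ifs with h h
    · rw [h, hcj]
    · rw [h, hcj]
    · rfl
  have h2 : col ∘ Equiv.swap i j = col := by
    ext k
    rw [Function.comp_apply, Equiv.swap_apply_def]
    split_ifs with h h
    · rw [h, hcol]
    · rw [h, hcol]
    · rfl
  have h3 := wordSum_comp (slUnit p q).1 (colAnti row col) (Equiv.swap i j) c
  simp only [colAnti_comp row col h2, Equiv.Perm.sign_swap hji.symm, h1] at h3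
  have h4 : (fun c => (((-1 : ℤˣ) : ℤ) : ℂ) * colAnti row col c) = (-1 : ℂ) • colAnti row col := by
    ext c
    simp
  rw [h4, map_smul, Pi.smul_apply, smul_eq_mul] at h3
  refine hne' ?_
  rw [Pi.zero_apply]
  linear_combination (1 / 2 : ℂ) * h3

lemma wordSum_colAnti_self (row : S → Fin m) (col : S → ℕ) (p : Fin m) :
    wordSum S (slUnit p p).1 (colAnti row col) =
      ((Finset.univ.filter fun i => row i = p).card - Fintype.card S / (m : ℂ)) •
        colAnti row col := by
  ext c
  rw [wordSum_slUnit_self, Pi.smul_apply, smul_eq_mul]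
  by_cases hc : colAnti row col c = 0
  · rw [hc, mul_zero, mul_zero]
  · obtain ⟨σ, -, rfl⟩ := exists_of_colAnti_ne_zero hc
    congr 3
    refine Finset.card_equiv σ fun i => ?_
    simp

end

/-! ### Maps out of Verma modules -/

section

variable {m : ℕ}

lemma lieHom_apply_eq_sum {W : Type*} [AddCommGroup W] [Module ℂ W]
    (ρ : Slm m →ₗ⁅ℂ⁆ Module.End ℂ W) (x : Slm m) (w : W) :
    ρ x w = ∑ p, ∑ q, x.1 p q • ρ (slUnit p q) w := by
  conv_lhs => rw [eq_sum_slUnit x]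
  simp only [map_sum, map_smul, LinearMap.sum_apply, LinearMap.smul_apply]

lemma lieHom_apply_cartan {W : Type*} [AddCommGroup W] [Module ℂ W]
    (ρ : Slm m →ₗ⁅ℂ⁆ Module.End ℂ W) {x : Slm m} (hx : ∀ p q, p ≠ q → x.1 p q = 0) {w : W}
    {χ : Fin m → ℂ} (h : ∀ p, ρ (slUnit p p) w = χ p • w) :
    ρ x w = (∑ p, x.1 p p * χ p) • w := by
  rw [lieHom_apply_eq_sum, Finset.sum_smul]
  refine Finset.sum_congr rfl fun p _ => ?_
  rw [Finset.sum_eq_single p, h, smul_smul]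
  · intro q _ hq
    rw [hx p q hq.symm, zero_smul]
  · simp

lemma weight_eq_sum (χ : Weight m) (x : cartan m) : χ x = ∑ p, x.1.1 p p * wcoord χ p := by
  have h : x = ∑ p, x.1.1 p p • xCartan p := by
    apply Subtype.ext
    have h1 : ((∑ p, x.1.1 p p • xCartan p : cartan m) : Slm m) =
        ∑ p, x.1.1 p p • slUnit p p := by
      simp only [slUnit_self]
      exact map_sum (cartan m).subtype _ _
    rw [h1]
    conv_lhs => rw [eq_sum_slUnit x.1]
    refine Finset.sum_congr rfl fun p _ => Finset.sum_eq_single p ?_ (by simp)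
    intro q _ hq
    rw [x.2 p q hq.symm, zero_smul]
  conv_lhs => rw [h]
  simp [wcoord]

/-- The universal property of Verma modules, for a Lie algebra representation `W` without a module
structure over `U(sl_m)`. -/
lemma exists_vermaHom (n : Set (Slm m)) (χ : Weight m) {W : Type*} [AddCommGroup W] [Module ℂ W]
    (ρ : Slm m →ₗ⁅ℂ⁆ Module.End ℂ W) (z : W) (hn : ∀ x ∈ n, ρ x z = 0)
    (hχ : ∀ h : cartan m, ρ h.1 z = χ h • z) :
    ∃ γ : (Usl m ⧸ vermaIdeal n χ) →ₗ[ℂ] W, γ (Submodule.Quotient.mk 1) = z ∧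
      ∀ x v, γ (toU x • v) = ρ x (γ v) := by
  let F : Usl m →ₐ[ℂ] Module.End ℂ W := UniversalEnvelopingAlgebra.lift ℂ ρ
  have hF : ∀ x, F (toU x) = ρ x := fun x => UniversalEnvelopingAlgebra.lift_ι_apply ℂ ρ x
  let I : Submodule (Usl m) (Usl m) :=
    { carrier := {u | F u z = 0}
      add_mem' := fun {u v} hu hv => by
        rw [Set.mem_ofPred_eq] at *
        rw [map_add, LinearMap.add_apply, hu, hv, add_zero]
      zero_mem' := by rw [Set.mem_ofPred_eq, map_zero, LinearMap.zero_apply]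
      smul_mem' := fun r u hu => by
        rw [Set.mem_ofPred_eq] at *
        rw [smul_eq_mul, map_mul, Module.End.mul_apply, hu, map_zero] }
  have hI : vermaIdeal n χ ≤ I := by
    refine Submodule.span_le.2 ?_
    rintro _ (⟨x, hx, rfl⟩ | ⟨h, rfl⟩)
    · exact (congrArg (fun T => T z) (hF x)).trans (hn x hx)
    · change F _ z = 0
      rw [map_sub, hF, AlgHom.commutes, LinearMap.sub_apply, hχ, Module.algebraMap_end_apply,
        sub_self]
  let γ₀ : Usl m →ₗ[ℂ] W := LinearMap.applyₗ z ∘ₗ F.toLinearMap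
  have hγ₀ : ∀ u, γ₀ u = F u z := fun u => rfl
  -- The map is `u ↦ F(u) z` on a `ℂ`-linear choice of representatives. The choice is immaterial,
  -- since the ideal annihilates `z`.
  obtain ⟨s, hs⟩ := LinearMap.exists_rightInverse_of_surjective
    ((vermaIdeal n χ).mkQ.restrictScalars ℂ)
    (LinearMap.range_eq_top.2 (Submodule.mkQ_surjective (vermaIdeal n χ)))
  have hs' : ∀ v, Submodule.Quotient.mk (s v) = v := fun v => congrArg (fun T => T v) hs
  have hmk : ∀ u, γ₀ (s (Submodule.Quotient.mk u)) = F u z := by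
    intro u
    have h1 : s (Submodule.Quotient.mk u) - u ∈ vermaIdeal n χ := by
      rw [← Submodule.Quotient.mk_eq_zero, Submodule.Quotient.mk_sub, hs', sub_self]
    have h2 : F (s (Submodule.Quotient.mk u) - u) z = 0 := hI h1
    rwa [map_sub, LinearMap.sub_apply, sub_eq_zero] at h2
  refine ⟨γ₀ ∘ₗ s, ?_, fun x v => ?_⟩
  · rw [LinearMap.comp_apply, hmk, map_one, Module.End.one_apply]
  · obtain ⟨u, rfl⟩ := Submodule.Quotient.mk_surjective _ v
    rw [← Submodule.Quotient.mk_smul, LinearMap.comp_apply γ₀ s, LinearMap.comp_apply γ₀ s, hmk, hmk,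
      smul_eq_mul, map_mul, hF, Module.End.mul_apply]

lemma exists_verma_hom (μ : Weight m) {W : Type*} [AddCommGroup W] [Module ℂ W]
    (ρ : Slm m →ₗ⁅ℂ⁆ Module.End ℂ W) (z : W) (hn : ∀ p q, p < q → ρ (slUnit p q) z = 0)
    (hχ : ∀ p, ρ (slUnit p p) z = wcoord μ p • z) :
    ∃ γ : Verma μ →ₗ[ℂ] W, γ (hwVector μ) = z ∧ ∀ x v, γ (actHom _ x v) = ρ x (γ v) := by
  refine exists_vermaHom (nPos m) μ ρ z (fun x hx => ?_) fun h => ?_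
  · rw [lieHom_apply_eq_sum]
    refine Finset.sum_eq_zero fun p _ => Finset.sum_eq_zero fun q _ => ?_
    rcases lt_or_ge p q with h | h
    · rw [hn p q h, smul_zero]
    · rw [hx p q h, zero_smul]
  · rw [weight_eq_sum, lieHom_apply_cartan ρ h.2 hχ]

lemma exists_vermaLow_hom (lam : Weight m) {W : Type*} [AddCommGroup W] [Module ℂ W]
    (ρ : Slm m →ₗ⁅ℂ⁆ Module.End ℂ W) (z : W) (hn : ∀ p q, q < p → ρ (slUnit p q) z = 0)
    (hχ : ∀ p, ρ (slUnit p p) z = -wcoord lam p • z) :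
    ∃ γ : VermaLow lam →ₗ[ℂ] W, γ (lwVector lam) = z ∧ ∀ x v, γ (actHom _ x v) = ρ x (γ v) := by
  refine exists_vermaHom (nNeg m) (-lam) ρ z (fun x hx => ?_) fun h => ?_
  · rw [lieHom_apply_eq_sum]
    refine Finset.sum_eq_zero fun p _ => Finset.sum_eq_zero fun q _ => ?_
    rcases lt_or_ge q p with h | h
    · rw [hn p q h, smul_zero]
    · rw [hx p q h, zero_smul]
  · rw [weight_eq_sum, lieHom_apply_cartan ρ h.2 hχ]
    rfl

/-! ### The grading of a lowest weight module -/

/-- `ρ^∨` defines the principal grading, in which raising operators have positive integral degree.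
-/
lemma lie_rhoCheck_slUnit (p q : Fin m) :
    ⁅rhoCheck m, slUnit p q⁆ = (((q : ℕ) : ℂ) - ((p : ℕ) : ℂ)) • slUnit p q := by
  rw [lie_slUnit]
  simp only [rhoCheck_val, ite_smul, zero_smul, Finset.sum_ite_eq, Finset.sum_ite_eq',
    Finset.mem_univ, if_true]
  rw [← sub_smul]
  congr 1
  ring

section

variable {B : Type} [AddCommGroup B] [Module ℂ B] [Module (Usl m) B]
  [IsScalarTower ℂ (Usl m) B]

/-- The sum of the graded components of positive degree, where `e` is the eigenvalue of `ρ^∨` in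
degree zero. -/
def posDegree (m : ℕ) (B : Type) [AddCommGroup B] [Module ℂ B] [Module (Usl m) B]
    [IsScalarTower ℂ (Usl m) B] (e : ℂ) : Submodule ℂ B :=
  ⨆ k : ℕ, Module.End.eigenspace (actHom B (rhoCheck m)) (e + (k + 1))

lemma actHom_raising_mem_posDegree {p q : Fin m} (hpq : p < q) {e : ℂ} {k : ℕ} {b : B}
    (hb : actHom B (rhoCheck m) b = (e + k) • b) :
    actHom B (slUnit p q) b ∈ posDegree m B e := by
  obtain ⟨h, hh⟩ := Nat.exists_eq_add_of_lt (Fin.lt_def.1 hpq)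
  refine Submodule.mem_iSup_of_mem (k + h) (Module.End.mem_eigenspace_iff.2 ?_)
  have h1 := congrArg (fun T => T b) (LieHom.map_lie (actHom B) (rhoCheck m) (slUnit p q))
  rw [lie_rhoCheck_slUnit, map_smul, LieRing.of_associative_ring_bracket] at h1
  simp only [LinearMap.smul_apply, LinearMap.sub_apply, Module.End.mul_apply, hb, map_smul] at h1
  rw [eq_comm, sub_eq_iff_eq_add, ← add_smul] at h1
  rw [h1, hh]
  congr 1
  push_cast
  ring

/-- The line of `b` together with the positive degrees is stable under raising operators, which
generate the module from `b`. -/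
lemma IsLowest.exists_sub_smul_mem {lam : Fin m → ℂ} {b : B} (h : IsLowest B lam b) {e : ℂ}
    (he : actHom B (rhoCheck m) b = e • b) (v : B) : ∃ r : ℂ, v - r • b ∈ posDegree m B e := by
  have hD := h.eq_top_of_raising (Submodule.span ℂ {b} ⊔ posDegree m B e)
    (Submodule.mem_sup_left (Submodule.mem_span_singleton_self b)) fun p q hpq a ha => by
      obtain ⟨y, hy, z, hz, rfl⟩ := Submodule.mem_sup.1 ha
      obtain ⟨r, rfl⟩ := Submodule.mem_span_singleton.1 hy
      rw [map_add, map_smul]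
      refine Submodule.mem_sup_right (Submodule.add_mem _ (Submodule.smul_mem _ _ ?_) ?_)
      · exact actHom_raising_mem_posDegree hpq (k := 0) (by rw [he, Nat.cast_zero, add_zero])
      · have h1 : posDegree m B e ≤ (posDegree m B e).comap (actHom B (slUnit p q)) := by
          refine iSup_le fun k b hb => ?_
          refine actHom_raising_mem_posDegree hpq (k := k + 1) ?_
          rw [Module.End.mem_eigenspace_iff.1 hb]
          push_cast
          rfl
        exact h1 hz
  obtain ⟨y, hy, z, hz, hv⟩ := Submodule.mem_sup.1 (hD ▸ Submodule.mem_top : v ∈ _)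
  obtain ⟨r, rfl⟩ := Submodule.mem_span_singleton.1 hy
  exact ⟨r, by rwa [← hv, add_sub_cancel_left]⟩

/-- A product of factors `X - (e + k + 1)` over the degrees that occur. It isolates the component of
degree zero without a direct sum decomposition. -/
lemma exists_polynomial_of_mem_posDegree {e : ℂ} {y : B} (hy : y ∈ posDegree m B e) :
    ∃ Q : Polynomial ℂ, Q.eval e ≠ 0 ∧ Polynomial.aeval (actHom B (rhoCheck m)) Q y = 0 := by
  induction hy using Submodule.iSup_induction' with
  | mem k y hy =>
    refine ⟨Polynomial.X - Polynomial.C (e + (k + 1)), ?_, ?_⟩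
    · rw [Polynomial.eval_sub, Polynomial.eval_X, Polynomial.eval_C, sub_add_cancel_left, neg_ne_zero]
      exact Nat.cast_add_one_ne_zero k
    · rw [map_sub, Polynomial.aeval_X, Polynomial.aeval_C, LinearMap.sub_apply,
        Module.algebraMap_end_apply, Module.End.mem_eigenspace_iff.1 hy, sub_self]
  | zero => exact ⟨1, by simp, by simp⟩
  | add y z _ _ hy hz =>
    obtain ⟨Q, hQ, hQ'⟩ := hy
    obtain ⟨Q', hQ1, hQ1'⟩ := hz
    refine ⟨Q * Q', by rw [Polynomial.eval_mul]; exact mul_ne_zero hQ hQ1, ?_⟩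
    rw [map_add]
    nth_rw 1 [mul_comm Q Q']
    rw [map_mul, map_mul, Module.End.mul_apply, Module.End.mul_apply, hQ', hQ1', map_zero,
      map_zero, add_zero]

/-- If `v ∈ K` has component `r b` in degree zero, a suitable polynomial in `ρ^∨` maps `v` to a
nonzero multiple of `r b` inside `K`; hence `r = 0`. -/
lemma IsLowest.le_posDegree {lam : Fin m → ℂ} {b : B} (h : IsLowest B lam b) {e : ℂ}
    (he : actHom B (rhoCheck m) b = e • b) (K : Submodule ℂ B)
    (hK : ∀ x : Slm m, ∀ a ∈ K, actHom B x a ∈ K) (hb : b ∉ K) : K ≤ posDegree m B e := by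
  intro v hv
  obtain ⟨r, hr⟩ := h.exists_sub_smul_mem he v
  obtain ⟨Q, hQ, hQ'⟩ := exists_polynomial_of_mem_posDegree hr
  have h1 : Polynomial.aeval (actHom B (rhoCheck m)) Q v = (r * Q.eval e) • b := by
    rw [map_sub, sub_eq_zero, map_smul] at hQ'
    rw [hQ', Module.End.aeval_apply_of_hasEigenvector
      ⟨Module.End.mem_eigenspace_iff.2 he, fun h0 => hb (h0 ▸ K.zero_mem)⟩, smul_smul]
  have h2 : Polynomial.aeval (actHom B (rhoCheck m)) Q v ∈ K :=
    Polynomial.aeval_apply_smul_mem_of_le_comap hv Q _ fun a ha => hK _ a ha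
  rw [h1] at h2
  have hr0 : r = 0 := by
    by_contra hr0
    exact hb ((K.smul_mem_iff (mul_ne_zero hr0 hQ)).1 h2)
  rwa [hr0, zero_smul, sub_zero] at hr

end

end

/-! ### Nonvanishing of the cyclic vector -/

section

variable {m : ℕ} {S : Type} [Fintype S] [DecidableEq S] {B : Type} [AddCommGroup B] [Module ℂ B]
  [Module (Usl m) B] [IsScalarTower ℂ (Usl m) B]

lemma comp_sumElim_sumCongr {X : Type*} {S : Type*} {N : ℕ} (f : S → X) (g : Fin N → X) (σ : Equiv.Perm S) :
    Sum.elim f g ∘ Equiv.sumCongr σ (Equiv.refl (Fin N)) = Sum.elim (f ∘ σ) g := by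
  ext (s | s) <;> rfl

lemma rhoCheck_transpose : (rhoCheck m).1.transpose = (rhoCheck m).1 := by
  ext a b
  rw [Matrix.transpose_apply, rhoCheck_val, rhoCheck_val]
  by_cases h : a = b
  · rw [h]
  · rw [if_neg h, if_neg (Ne.symm h)]

lemma sum_wordDual_mul (x : Slm m) (g h : (S → Fin m) → ℂ) :
    ∑ c, wordDual m S x g c * h c = -∑ c, g c * wordSum S x.1 h c := by
  have := sum_wordSum_mul x.1.transpose g h
  rw [Matrix.transpose_transpose] at this
  rw [← this, ← Finset.sum_neg_distrib]
  refine Finset.sum_congr rfl fun c _ => ?_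
  rw [wordDual_apply, LinearMap.neg_apply, Pi.neg_apply, neg_mul]

lemma sum_mul_wordDual (x : Slm m) (g h : (S → Fin m) → ℂ) :
    ∑ c, g c * wordDual m S x h c = -∑ c, wordSum S x.1 g c * h c := by
  rw [sum_wordSum_mul x.1 g h, ← Finset.sum_neg_distrib]
  refine Finset.sum_congr rfl fun c _ => ?_
  rw [wordDual_apply, LinearMap.neg_apply, Pi.neg_apply, mul_neg]

/-- A map from a lowest weight module to functions on words kills every submodule not containing the
lowest weight vector, since the invariant hermitian form on functions on words is definite. -/
lemma map_eq_zero_of_notMem {lam : Fin m → ℂ} {b : B} (hB : IsLowest B lam b)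
    (γ : B →ₗ[ℂ] (S → Fin m) → ℂ)
    (hγ : ∀ x v, γ (actHom B x v) = wordDual m S x (γ v)) (hb : star (γ b) = γ b)
    (K : Submodule ℂ B) (hK : ∀ x : Slm m, ∀ a ∈ K, actHom B x a ∈ K) (hbK : b ∉ K) :
    ∀ v ∈ K, γ v = 0 := by
  have he := lieHom_apply_cartan (actHom B) (x := rhoCheck m)
    (fun p q h => by rw [rhoCheck_val, if_neg h]) (χ := fun p => -lam p) hB.weight
  set e := ∑ p, (rhoCheck m).1 p p * -lam p with he'
  have hKP := hB.le_posDegree he K hK hbK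
  have hρ : ∀ g, wordSum S (rhoCheck m).1 g = -wordDual m S (rhoCheck m) g := fun g => by
    rw [wordDual_apply, rhoCheck_transpose, LinearMap.neg_apply, neg_neg]
  -- `ρ^∨` is a symmetric matrix, so `γ b` is orthogonal to the images of eigenvectors with
  -- eigenvalue `e + k + 1 ≠ e`.
  have hP : ∀ v ∈ posDegree m B e, ∑ c, γ b c * γ v c = 0 := by
    intro v hv
    induction hv using Submodule.iSup_induction' with
    | mem k v hv =>
      have h1 := sum_wordDual_mul (rhoCheck m) (γ b) (γ v)
      rw [hρ, ← hγ, he, ← hγ, Module.End.mem_eigenspace_iff.1 hv, map_smul, map_smul] at h1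
      simp only [Pi.smul_apply, Pi.neg_apply, smul_eq_mul, mul_neg, Finset.sum_neg_distrib,
        neg_neg, mul_assoc, mul_left_comm (γ b _), ← Finset.mul_sum] at h1
      have h2 : ((k : ℂ) + 1) * ∑ c, γ b c * γ v c = 0 := by linear_combination -h1
      exact (mul_eq_zero.1 h2).resolve_left (Nat.cast_add_one_ne_zero k)
    | zero => simp
    | add v w _ _ hv hw =>
      simp only [map_add, Pi.add_apply, mul_add, Finset.sum_add_distrib, hv, hw, add_zero]
  -- The vectors whose image is hermitian orthogonal to `γ(K)`. It contains `b` because `γ b` is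
  -- real, and it is stable under raising because the adjoint of `E_pq` is `E_qp`, which preserves
  -- `K`.
  let D : Submodule ℂ B :=
    { carrier := {u | ∀ w ∈ K, ∑ c, star (γ u) c * γ w c = 0}
      add_mem' := fun {u v} hu hv w hw => by
        simp only [map_add, star_add, Pi.add_apply, add_mul, Finset.sum_add_distrib]
        rw [hu w hw, hv w hw, add_zero]
      zero_mem' := fun w _ => by simp
      smul_mem' := fun r u hu w hw => by
        simp only [map_smul, star_smul, Pi.smul_apply, smul_eq_mul, mul_assoc, ← Finset.mul_sum]
        rw [hu w hw, mul_zero] }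
  have hD : D = ⊤ := by
    refine hB.eq_top_of_raising D (fun w hw => ?_) fun p q _ u hu w hw => ?_
    · rw [hb]
      exact hP w (hKP hw)
    · have h1 : star (γ (actHom B (slUnit p q) u)) =
          -wordSum S (slUnit q p).1 (star (γ u)) := by
        rw [hγ, wordDual_apply, slUnit_transpose, LinearMap.neg_apply, star_neg,
          star_wordSum_slUnit]
      have h2 := sum_mul_wordDual (slUnit q p) (star (γ u)) (γ w)
      rw [← hγ, hu _ (hK _ w hw)] at h2
      rw [h1]
      simp only [Pi.neg_apply, neg_mul, Finset.sum_neg_distrib]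
      exact h2.symm
  intro v hv
  have h1 : v ∈ D := hD ▸ Submodule.mem_top
  have h2 := h1 v hv
  -- So `γ v` is orthogonal to itself, and definiteness applies.
  have h3 : ∑ c, ‖γ v c‖ ^ 2 = 0 := by
    rw [← Complex.ofReal_inj, Complex.ofReal_zero, ← h2, Complex.ofReal_sum]
    refine Finset.sum_congr rfl fun c _ => ?_
    rw [Pi.star_apply, Complex.ofReal_pow]
    exact (Complex.conj_mul' _).symm
  ext c
  have h4 := (Finset.sum_eq_zero_iff_of_nonneg fun c _ => sq_nonneg ‖γ v c‖).1 h3 c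
    (Finset.mem_univ c)
  simpa using h4

lemma toIrrLow_eq_zero_iff (lam : Weight m) (v : VermaLow lam) :
    toIrrLow lam v = 0 ↔ v ∈ sumProper (Usl m) (VermaLow lam) :=
  Submodule.Quotient.mk_eq_zero _

/-- A nonzero map from a lowest weight Verma module to functions on words, whose value on the lowest
weight vector is real, factors through the irreducible quotient. -/
lemma map_eq_zero_iff {lam : Weight m} (γ : VermaLow lam →ₗ[ℂ] (S → Fin m) → ℂ)
    (hγ : ∀ x v, γ (actHom _ x v) = wordDual m S x (γ v))
    (hb : star (γ (lwVector lam)) = γ (lwVector lam)) (hb' : γ (lwVector lam) ≠ 0)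
    (v : VermaLow lam) : γ v = 0 ↔ toIrrLow lam v = 0 := by
  have hker : ∀ (u : Usl m), ∀ v ∈ LinearMap.ker γ, u • v ∈ LinearMap.ker γ := by
    refine smul_mem_of_stable _ fun x a ha => ?_
    rw [LinearMap.mem_ker, hγ, LinearMap.mem_ker.1 ha, map_zero]
  let K : Submodule (Usl m) (VermaLow lam) :=
    { carrier := {v | γ v = 0}
      add_mem' := fun {u v} hu hv => (LinearMap.ker γ).add_mem hu hv
      zero_mem' := map_zero γ
      smul_mem' := hker }
  rw [toIrrLow_eq_zero_iff]
  constructor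
  · intro hv
    have hK : K ≠ ⊤ := fun h => hb' (h ▸ Submodule.mem_top : lwVector lam ∈ K)
    exact le_sSup (a := K) hK hv
  · intro hv
    have hK : sumProper (Usl m) (VermaLow lam) ≤ K := by
      refine sSup_le fun K' hK' w hw => ?_
      refine map_eq_zero_of_notMem (isLowest_lwVector lam) γ hγ hb (K'.restrictScalars ℂ)
        (fun x a ha => K'.smul_mem _ ha) (fun h => hK' ?_) w hw
      rw [eq_top_iff]
      intro u _
      obtain ⟨x, rfl⟩ := (isLowest_lwVector lam).gen u
      exact K'.smul_mem x h
    exact hK hv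

end

section

variable {m N : ℕ} {A B : Type} [AddCommGroup A] [Module ℂ A] [Module (Usl m) A]
  [IsScalarTower ℂ (Usl m) A] [AddCommGroup B] [Module ℂ B] [Module (Usl m) B]
  [IsScalarTower ℂ (Usl m) B]

/-- An invariant form on words defines a linear form on coinvariants. -/
lemma exists_form {f : WordForm m N A B} (hf : IsInvForm (actHom A) (actHom B) f) :
    ∃ g : Func (m := m) N A B →ₗ[ℂ] ℂ, ∀ c a b, g (cls N A B (wordTens a c b)) = f c a b := by
  let coord : (Fin N → Fin m) → (VPow m N →ₗ[ℂ] ℂ) := fun c =>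
    PiTensorProduct.lift ((MultilinearMap.mkPiAlgebra ℂ (Fin N) ℂ).compLinearMap
      fun i => LinearMap.proj (c i))
  have hcoord : ∀ c c', coord c (wordVec c') = if c = c' then 1 else 0 := by
    intro c c'
    simp only [coord, wordVec, PiTensorProduct.lift.tprod, MultilinearMap.compLinearMap_apply,
      MultilinearMap.mkPiAlgebra_apply, LinearMap.proj_apply, Pi.single_apply]
    rw [Finset.prod_ite_zero]
    simp [funext_iff]
  let F : Tens m N A B →ₗ[ℂ] ℂ := ∑ c, TensorProduct.lift (f c) ∘ₗ
    TensorProduct.map LinearMap.id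
      ((TensorProduct.lid ℂ B).toLinearMap ∘ₗ TensorProduct.map (coord c) LinearMap.id)
  have hF : ∀ a c b, F (wordTens a c b) = f c a b := by
    intro a c b
    simp only [F, LinearMap.sum_apply, LinearMap.comp_apply, wordTens, TensorProduct.map_tmul,
      LinearMap.id_apply, hcoord, LinearEquiv.coe_coe, TensorProduct.lid_tmul,
      TensorProduct.lift.tmul, map_smul, smul_eq_mul, ite_mul, one_mul, zero_mul]
    simp
  have hF' : diagImage (m := m) N A B ≤ LinearMap.ker F := by
    refine diagImage_le fun x v => ?_
    have : F ∘ₗ diagAct x = 0 := tens_ext fun a c b => by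
      rw [LinearMap.comp_apply, diagAct_wordTens, map_add, map_add, map_sum]
      simp only [map_sum, map_smul, hF, smul_eq_mul]
      exact hf x c a b
    exact congrArg (fun T => T v) this
  exact ⟨(diagImage (m := m) N A B).liftQ F hF', fun c a b => hF a c b⟩

end

/-! ### The explicit invariant form on the coinvariants with `L†(λ)` -/

section

variable {m N : ℕ} {S : Type} [Fintype S] [DecidableEq S]

/-- The pairing of column antisymmetrizations of nested diagrams. -/
lemma sum_colAnti_mul_ne_zero {row : S → Fin m} {col : S → ℕ} {row' : Fin N → Fin m}
    {col' : Fin N → ℕ} (h : IsDiagram row col)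
    (h' : IsDiagram (Sum.elim row row') (Sum.elim col col')) :
    ∑ c, colAnti row col c * colAnti (Sum.elim row row') (Sum.elim col col') (Sum.elim c row') ≠
      0 := by
  -- If `c` is the row word rearranged by a column permutation, both factors equal the sign of that
  -- permutation, extended by the identity for the second factor. Each nonzero product is therefore
  -- `1`, and no cancellation can occur.
  have h1 : ∀ c, colAnti row col c *
      colAnti (Sum.elim row row') (Sum.elim col col') (Sum.elim c row') =
      if colAnti row col c ≠ 0 then 1 else 0 := by
    intro c
    split_ifs with hc
    · obtain ⟨σ, hσ, rfl⟩ := exists_of_colAnti_ne_zero hc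
      have hσ' : Sum.elim col col' ∘ Equiv.sumCongr σ (Equiv.refl (Fin N)) = Sum.elim col col' := by
        rw [comp_sumElim_sumCongr, hσ]
      rw [← comp_sumElim_sumCongr, colAnti_comp _ _ hσ', colAnti_comp row col hσ row, colAnti_row h, colAnti_row h', Equiv.Perm.sign_sumCongr,
        Equiv.Perm.sign_refl, mul_one, mul_one, mul_one, ← Int.cast_mul, ← Units.val_mul,
        Int.units_mul_self, Units.val_one, Int.cast_one]
    · rw [not_not.1 hc, zero_mul]
  rw [Finset.sum_congr rfl fun c _ => h1 c, Finset.sum_boole]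
  rw [Nat.cast_ne_zero, ← Nat.pos_iff_ne_zero, Finset.card_pos]
  exact ⟨row, Finset.mem_filter.2 ⟨Finset.mem_univ _, by rw [colAnti_row h]; exact one_ne_zero⟩⟩

/-- The dual action involves the negative transpose, so the highest weight vector `colAnti` of the
word representation becomes a lowest weight vector of weight `-lam`. -/
lemma exists_colAnti_hom {lam : Weight m} {row : S → Fin m} {col : S → ℕ}
    (h : IsDiagram row col) (hlam : ∀ p, wcoord lam p =
      (Finset.univ.filter fun s => row s = p).card - Fintype.card S / (m : ℂ)) :
    ∃ γ : VermaLow lam →ₗ[ℂ] (S → Fin m) → ℂ, γ (lwVector lam) = colAnti row col ∧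
      ∀ x v, γ (actHom _ x v) = wordDual m S x (γ v) := by
  refine exists_vermaLow_hom lam (wordDual m S) _ (fun p q hqp => ?_) fun p => ?_
  · rw [wordDual_apply, slUnit_transpose, LinearMap.neg_apply, wordSum_colAnti_of_lt h hqp,
      neg_zero]
  · rw [wordDual_apply, slUnit_transpose, LinearMap.neg_apply, wordSum_colAnti_self, hlam,
      neg_smul]

lemma wordDual_slUnit_pow_eq_zero {p q : Fin m} (h : p ≠ q) :
    wordDual m S (slUnit p q) ^ (Fintype.card S + 1) = 0 := by
  have key : ∀ {R : Type} [Ring R] (a : R) (n : ℕ), a ^ n = 0 → (-a) ^ n = 0 := by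
    intro R _ a n h
    rw [neg_pow, h, mul_zero]
  rw [wordDual_apply, slUnit_transpose]
  exact key _ _ (wordSum_slUnit_pow_eq_zero h.symm)

/-- Raising operators are nilpotent on the lowest weight vector of the irreducible module. -/
lemma exists_pow_toIrrLow_eq_zero {lam : Weight m} {row : S → Fin m} {col : S → ℕ}
    (h : IsDiagram row col) (hlam : ∀ p, wcoord lam p =
      (Finset.univ.filter fun s => row s = p).card - Fintype.card S / (m : ℂ)) {p q : Fin m}
    (hpq : p ≠ q) :
    (actHom (IrrLow lam) (slUnit p q) ^ (Fintype.card S + 1)) (toIrrLow lam (lwVector lam)) =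
      0 := by
  obtain ⟨γ, hγ, hγ'⟩ := exists_colAnti_hom h hlam
  have h1 : ∀ k v, (actHom (IrrLow lam) (slUnit p q) ^ k) (toIrrLow lam v) =
      toIrrLow lam ((actHom _ (slUnit p q) ^ k) v) := by
    intro k v
    induction k with
    | zero => rfl
    | succ k ih =>
      rw [pow_succ', pow_succ', Module.End.mul_apply, Module.End.mul_apply, ih, toIrrLow_actHom]
  have h2 : ∀ k v, γ ((actHom _ (slUnit p q) ^ k) v) = (wordDual m S (slUnit p q) ^ k) (γ v) := by
    intro k v
    induction k with
    | zero => rfl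
    | succ k ih =>
      rw [pow_succ', pow_succ', Module.End.mul_apply, Module.End.mul_apply, hγ', ih]
  rw [h1, ← map_eq_zero_iff γ hγ' (by rw [hγ, star_colAnti]), h2, wordDual_slUnit_pow_eq_zero hpq,
    LinearMap.zero_apply]
  rw [hγ]
  exact fun h0 => one_ne_zero ((colAnti_row h).symm.trans (congrFun h0 row))

/-- The form on words given by pairing functions on words. -/
def wordPairing {A B : Type} [AddCommGroup A] [Module ℂ A] [AddCommGroup B] [Module ℂ B]
    (α : A →ₗ[ℂ] (S → Fin m) → ℂ) (γ : B →ₗ[ℂ] (S ⊕ Fin N → Fin m) → ℂ) : WordForm m N A B :=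
  fun c' => LinearMap.mk₂ ℂ (fun a b => ∑ c, α a c * γ b (Sum.elim c c'))
    (fun a a' b => by simp only [map_add, Pi.add_apply, add_mul, Finset.sum_add_distrib])
    (fun r a b => by simp only [map_smul, Pi.smul_apply, smul_eq_mul, mul_assoc, Finset.mul_sum])
    (fun a b b' => by simp only [map_add, Pi.add_apply, mul_add, Finset.sum_add_distrib])
    (fun r a b => by
      simp only [map_smul, Pi.smul_apply, smul_eq_mul, Finset.mul_sum]
      exact Finset.sum_congr rfl fun c _ => mul_left_comm _ _ _)

lemma wordPairing_apply {A B : Type} [AddCommGroup A] [Module ℂ A] [AddCommGroup B] [Module ℂ B]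
    (α : A →ₗ[ℂ] (S → Fin m) → ℂ) (γ : B →ₗ[ℂ] (S ⊕ Fin N → Fin m) → ℂ) (c' : Fin N → Fin m)
    (a : A) (b : B) : wordPairing α γ c' a b = ∑ c, α a c * γ b (Sum.elim c c') := rfl

/-- The class of the row word of a skew diagram is not zero in the coinvariants. -/
lemma cls_ne_zero {lam μ : Weight m} {row : S → Fin m} {col : S → ℕ} {row' : Fin N → Fin m}
    {col' : Fin N → ℕ} (h : IsDiagram row col)
    (h' : IsDiagram (Sum.elim row row') (Sum.elim col col'))
    (hμ : ∀ p, wcoord μ p =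
      (Finset.univ.filter fun s => row s = p).card - Fintype.card S / (m : ℂ))
    (hlam : ∀ p, wcoord lam p = (Finset.univ.filter fun s => Sum.elim row row' s = p).card -
      Fintype.card (S ⊕ Fin N) / (m : ℂ)) :
    cls (m := m) N (Verma μ) (IrrLow lam)
      (wordTens (hwVector μ) row' (toIrrLow lam (lwVector lam))) ≠ 0 := by
  obtain ⟨γ, hγ, hγ'⟩ := exists_colAnti_hom h' hlam
  obtain ⟨α, hα, hα'⟩ := exists_verma_hom μ (wordRep m S) (colAnti row col)
    (fun p q hpq => wordSum_colAnti_of_lt h hpq) fun p => by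
      rw [wordRep_apply, wordSum_colAnti_self, hμ]
  have hγ0 := map_eq_zero_iff γ hγ' (by rw [hγ, star_colAnti]) (by
    rw [hγ]
    exact fun h0 => one_ne_zero ((colAnti_row h').symm.trans (congrFun h0 _)))
  -- `γ` kills the kernel of the projection, so `γ ∘ s` is the map induced on the irreducible
  -- quotient, whatever the section `s`.
  obtain ⟨s, hs⟩ := LinearMap.exists_rightInverse_of_surjective (toIrrLow lam)
    (LinearMap.range_eq_top.2 (toIrrLow_surjective lam))
  have hs' : ∀ v, γ (s (toIrrLow lam v)) = γ v := by
    intro v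
    rw [← sub_eq_zero, ← map_sub, hγ0, map_sub, sub_eq_zero]
    exact congrArg (fun T => T (toIrrLow lam v)) hs
  let f : WordForm m N (Verma μ) (IrrLow lam) := wordPairing α (γ ∘ₗ s)
  have hf : ∀ c' a b, f c' a (toIrrLow lam b) = ∑ c, α a c * γ b (Sum.elim c c') := by
    intro c' a b
    rw [wordPairing_apply, LinearMap.comp_apply, hs']
  have hinv : IsInvForm (actHom (Verma μ)) (actHom (IrrLow lam)) f := by
    intro x c' a b
    obtain ⟨b, rfl⟩ := toIrrLow_surjective lam b
    rw [← toIrrLow_actHom]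
    simp only [hf]
    -- The action on outer words splits into the letters of the inner shape, which are contracted
    -- and pass to `A` by transposition, and the `N` letters of `c'`, which give the action on
    -- `V^{⊗N}`.
    have h1 : ∑ c, α a c * γ (actHom _ x b) (Sum.elim c c') =
        -(∑ c, α a c * wordSum S x.1.transpose (fun c => γ b (Sum.elim c c')) c) -
        ∑ i, ∑ d, x.1 d (c' i) * ∑ c, α a c * γ b (Sum.elim c (Function.update c' i d)) := by
      have h2 : ∀ c, γ (actHom _ x b) (Sum.elim c c') =
          -wordSum S x.1.transpose (fun c => γ b (Sum.elim c c')) c -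
          ∑ i, ∑ d, x.1 d (c' i) * γ b (Sum.elim c (Function.update c' i d)) := by
        intro c
        rw [hγ', wordDual_apply, LinearMap.neg_apply, Pi.neg_apply, wordSum_apply, wordSum_apply,
          Fintype.sum_sum_type, neg_add]
        simp only [Sum.elim_inl, Sum.elim_inr, Sum.update_elim_inl, Sum.update_elim_inr,
          Matrix.transpose_apply, sub_eq_add_neg]
      simp only [h2, mul_sub, mul_neg, Finset.sum_sub_distrib, Finset.sum_neg_distrib,
        Finset.mul_sum]
      congr 1
      rw [Finset.sum_comm]
      refine Finset.sum_congr rfl fun i _ => ?_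
      rw [Finset.sum_comm]
      exact Finset.sum_congr rfl fun d _ => Finset.sum_congr rfl fun c _ => mul_left_comm _ _ _
    rw [h1, ← sum_wordSum_mul, hα', wordRep_apply]
    ring
  obtain ⟨g, hg⟩ := exists_form hinv
  intro h0
  refine sum_colAnti_mul_ne_zero h h' ?_
  have h1 := hg row' (hwVector μ) (toIrrLow lam (lwVector lam))
  rw [h0, map_zero, hf, hα, hγ] at h1
  exact h1.symm

end

/-! ### Standard tableaux -/

section

variable {m N : ℕ} {β : Fin m → ℕ}

/-- The column of a cell of the skew diagram with inner shape `mu`. -/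
def cellCol (mu : Fin m → ℕ) (c : Cell β) : ℕ := mu c.1 + c.2

lemma cell_ext (mu : Fin m → ℕ) {c c' : Cell β} (h : c.1 = c'.1)
    (h' : cellCol mu c = cellCol mu c') : c = c' := by
  obtain ⟨a, k⟩ := c
  obtain ⟨b, l⟩ := c'
  obtain rfl : a = b := h
  simp only [cellCol, Nat.add_left_cancel_iff] at h'
  rw [Fin.ext h']

lemma exists_cell {mu : Fin m → ℕ} {a : Fin m} {x : ℕ} (h : mu a ≤ x) (h' : x < mu a + β a) :
    ∃ c : Cell β, c.1 = a ∧ cellCol mu c = x :=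
  ⟨⟨a, x - mu a, by omega⟩, rfl, Nat.add_sub_cancel' h⟩

lemma cellCol_lt (mu : Fin m → ℕ) (c : Cell β) : cellCol mu c < mu c.1 + β c.1 :=
  Nat.add_lt_add_left c.2.2 _

lemma le_cellCol (mu : Fin m → ℕ) (c : Cell β) : mu c.1 ≤ cellCol mu c := Nat.le_add_right _ _

/-- The inner and outer shapes of the skew diagram are partitions. -/
structure IsSkewShape (mu : Fin m → ℕ) (β : Fin m → ℕ) : Prop where
  inner : Antitone mu
  outer : Antitone fun a => mu a + β a

variable {μ : Weight m} {mu : Fin m → ℕ} {κ : ℂ} (hmu : ∀ p, wcoord μ p = mu p + κ)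

include hmu in
lemma cellP_eq (c : Cell β) : cellP μ c = cellCol mu c + κ + 1 := by
  rw [cellP, hmu, cellCol]
  push_cast
  ring

include hmu in
lemma isStandard_iff (T : Tableau N β) : IsStandard μ T ↔ ∀ c c' : Cell β,
    (c'.1 = c.1 → cellCol mu c' = cellCol mu c + 1 → T c < T c') ∧
    ((c'.1 : ℕ) = c.1 + 1 → cellCol mu c' = cellCol mu c → T c < T c') := by
  have h1 : ∀ c c' : Cell β, cellP μ c' = cellP μ c + 1 ↔ cellCol mu c' = cellCol mu c + 1 := by
    intro c c'
    rw [cellP_eq hmu, cellP_eq hmu, ← Nat.cast_inj (R := ℂ)]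
    push_cast
    constructor <;> intro h <;> linear_combination h
  have h2 : ∀ c c' : Cell β, cellP μ c' = cellP μ c ↔ cellCol mu c' = cellCol mu c := by
    intro c c'
    rw [cellP_eq hmu, cellP_eq hmu, ← Nat.cast_inj (R := ℂ)]
    constructor <;> intro h <;> linear_combination h
  simp only [IsStandard, h1, h2]

include hmu in
/-- In a standard tableau, entries increase weakly to the south-east. -/
lemma IsStandard.le (hs : IsSkewShape mu β) {T : Tableau N β} (hT : IsStandard μ T) {c c' : Cell β}
    (h : c.1 ≤ c'.1) (h' : cellCol mu c ≤ cellCol mu c') : T c ≤ T c' := by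
  rw [isStandard_iff hmu] at hT
  have hrow : ∀ n : ℕ, ∀ c c' : Cell β, c'.1 = c.1 → cellCol mu c' = cellCol mu c + n →
      T c ≤ T c' := by
    intro n
    induction n with
    | zero => exact fun c c' h h' => (congrArg T (cell_ext mu h.symm h'.symm)).le
    | succ n ih =>
      intro c c' h h'
      obtain ⟨d, hd, hd'⟩ := exists_cell (β := β) (mu := mu) (a := c.1) (x := cellCol mu c + n)
        (by have := le_cellCol mu c; omega) (by have := cellCol_lt mu c'; rw [h] at this; omega)
      exact (ih c d hd hd').trans ((hT d c').1 (h.trans hd.symm) (by omega)).le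
  have hcol : ∀ n : ℕ, ∀ c c' : Cell β, (c'.1 : ℕ) = c.1 + n → cellCol mu c' = cellCol mu c →
      T c ≤ T c' := by
    intro n
    induction n with
    | zero => exact fun c c' h h' => (congrArg T (cell_ext mu (Fin.ext h.symm) h'.symm)).le
    | succ n ih =>
      intro c c' h h'
      have hlt : (c.1 : ℕ) + n < m := by have := c'.1.2; omega
      have h1 := hs.inner (show c.1 ≤ ⟨c.1 + n, hlt⟩ from Nat.le_add_right _ _)
      have h2 := hs.outer (show (⟨c.1 + n, hlt⟩ : Fin m) ≤ c'.1 from by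
        rw [Fin.le_def]; simp only; omega)
      simp only at h2
      obtain ⟨d, hd, hd'⟩ := exists_cell (β := β) (mu := mu) (a := ⟨c.1 + n, hlt⟩)
        (x := cellCol mu c) (by have := le_cellCol mu c; omega)
        (by have := cellCol_lt mu c'; omega)
      exact (ih c d (congrArg Fin.val hd) hd').trans ((hT d c').2 (by rw [hd]; simp only; omega)
        (by omega)).le
  obtain ⟨n, hn⟩ := Nat.exists_eq_add_of_le h'
  obtain ⟨k, hk⟩ := Nat.exists_eq_add_of_le (Fin.le_def.1 h)
  have h1 := hs.outer h
  simp only at h1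
  -- The path goes along the row of `c` to the column of `c'` and then down. The corner lies in the
  -- diagram because the outer shape is a partition.
  obtain ⟨d, hd, hd'⟩ := exists_cell (β := β) (mu := mu) (a := c.1) (x := cellCol mu c')
    (by have := le_cellCol mu c; omega) (by have := cellCol_lt mu c'; omega)
  exact (hrow n c d hd (by omega)).trans (hcol k d c' (by rw [hd]; exact hk) hd'.symm)

/-- The coordinates of the weight of a tableau. -/
def tabWeight (μ : Weight m) (hN : ∑ a, β a = N) (T : Tableau N β) (i : Fin N) : ℂ :=
  zeta μ hN (rowTableau β hN (T.symm i))

lemma tabWeight_rowTableau (μ : Weight m) (hN : ∑ a, β a = N) :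
    tabWeight μ hN (rowTableau β hN) = zeta μ hN := by
  ext i
  rw [tabWeight, Equiv.apply_symm_apply]

lemma tabWeight_eq (hN : ∑ a, β a = N) (T : Tableau N β) (i : Fin N) : tabWeight μ hN T i =
    cellP μ (T.symm i) - (((T.symm i).1 : ℕ) + 1) + ((m : ℂ) ^ 2 - N) / (2 * m) := by
  rw [tabWeight, zeta, Equiv.symm_apply_apply]

include hmu in
lemma tabWeight_sub (hN : ∑ a, β a = N) (T T' : Tableau N β) (i j : Fin N) :
    tabWeight μ hN T i - tabWeight μ hN T' j =
      (((cellCol mu (T.symm i) + (T'.symm j).1 : ℤ) - (cellCol mu (T'.symm j) + (T.symm i).1) : ℤ) :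
        ℂ) := by
  rw [tabWeight_eq, tabWeight_eq, cellP_eq hmu, cellP_eq hmu]
  push_cast
  ring

-- At the smallest entry where `T` and `T'` differ, the two cells have equal content, so one of them
-- is north-west of the other on a diagonal. The tableau whose cell is further south-east then has a
-- smaller entry, or the same one, at the north-west cell, against agreement on smaller entries.
include hmu in
lemma eq_of_tabWeight_eq (hs : IsSkewShape mu β) (hN : ∑ a, β a = N) {T T' : Tableau N β}
    (hT : IsStandard μ T) (hT' : IsStandard μ T') (h : tabWeight μ hN T = tabWeight μ hN T') :
    T = T' := by
  have key : ∀ {T T' : Tableau N β}, IsStandard μ T' → ∀ i : Fin N,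
      (∀ j < i, T.symm j = T'.symm j) → (T.symm i).1 < (T'.symm i).1 →
      cellCol mu (T.symm i) ≤ cellCol mu (T'.symm i) → False := by
    intro T T' hT' i hi h1 h2
    have h3 := hT'.le hmu hs h1.le h2
    rw [Equiv.apply_symm_apply] at h3
    rcases h3.lt_or_eq with h3 | h3
    · have h4 := hi _ h3
      rw [Equiv.symm_apply_apply, EmbeddingLike.apply_eq_iff_eq] at h4
      exact h3.ne h4
    · rw [← h3, Equiv.symm_apply_apply] at h1
      exact lt_irrefl _ (h3 ▸ h1)
  have hsymm : ∀ n : ℕ, ∀ i : Fin N, (i : ℕ) = n → T.symm i = T'.symm i := by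
    intro n
    induction n using Nat.strong_induction_on with
    | _ n ih =>
      rintro i rfl
      have hi : ∀ j < i, T.symm j = T'.symm j := fun j hj => ih j hj j rfl
      have h1 := tabWeight_sub hmu hN T T' i i
      rw [h, sub_self, eq_comm, Int.cast_eq_zero] at h1
      rcases lt_trichotomy (T.symm i).1 (T'.symm i).1 with h2 | h2 | h2
      · exact (key hT' i hi h2 (by have := Fin.lt_def.1 h2; omega)).elim
      · exact cell_ext mu h2 (by rw [h2] at h1; omega)
      · exact (key hT i (fun j hj => (hi j hj).symm) h2 (by have := Fin.lt_def.1 h2; omega)).elim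
  have : T.symm = T'.symm := Equiv.ext fun i => hsymm i i rfl
  rw [← Equiv.symm_symm T, this, Equiv.symm_symm]

lemma rowTableau_lt_of_row_lt (hN : ∑ a, β a = N) {c c' : Cell β} (h : c.1 < c'.1) :
    rowTableau β hN c < rowTableau β hN c' := by
  obtain ⟨a, k⟩ := c
  obtain ⟨b, l⟩ := c'
  let g : ℕ → ℕ := fun x => if hx : x < m then β ⟨x, hx⟩ else 0
  have hg : ∀ a : Fin m, ∑ i : Fin a, β (Fin.castLE a.2.le i) = ∑ i ∈ Finset.range a, g i := by
    intro a
    rw [← Fin.sum_univ_eq_sum_range g a]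
    refine Finset.sum_congr rfl fun i _ => ?_
    simp only [g, dif_pos (i.2.trans a.2)]
    rfl
  rw [Fin.lt_def]
  simp only [rowTableau, Equiv.trans_apply, finCongr_apply, Fin.val_cast, finSigmaFinEquiv_apply, hg]
  have h1 : ∑ i ∈ Finset.range (a + 1), g i ≤ ∑ i ∈ Finset.range b, g i :=
    Finset.sum_le_sum_of_subset (Finset.range_mono (Nat.succ_le_of_lt (Fin.lt_def.1 h)))
  have h2 : g a = β a := dif_pos a.2
  rw [Finset.sum_range_succ, h2] at h1
  have := k.2
  omega

lemma rowTableau_lt_of_snd_lt (hN : ∑ a, β a = N) {c c' : Cell β} (h : c.1 = c'.1)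
    (h' : (c.2 : ℕ) < c'.2) : rowTableau β hN c < rowTableau β hN c' := by
  obtain ⟨a, k⟩ := c
  obtain ⟨b, l⟩ := c'
  obtain rfl : a = b := h
  rw [Fin.lt_def]
  simp only [rowTableau, Equiv.trans_apply, finCongr_apply, Fin.val_cast, finSigmaFinEquiv_apply]
  exact Nat.add_lt_add_left h' _

include hmu in
lemma isStandard_rowTableau (hN : ∑ a, β a = N) : IsStandard μ (rowTableau β hN) := by
  rw [isStandard_iff hmu]
  refine fun c c' => ⟨fun h h' => rowTableau_lt_of_snd_lt hN h.symm ?_,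
    fun h _ => rowTableau_lt_of_row_lt hN (by rw [Fin.lt_def]; omega)⟩
  have := congrArg mu h
  simp only [cellCol] at h'
  omega

include hmu in
/-- A tableau with increasing rows and with the weight of the row reading tableau is the row reading
tableau. -/
lemma eq_rowTableau (hs : IsSkewShape mu β) (hN : ∑ a, β a = N) {T : Tableau N β}
    (hT : ∀ c c' : Cell β, c.1 = c'.1 → (c.2 : ℕ) < c'.2 → T c < T c')
    (h : tabWeight μ hN T = zeta μ hN) : T = rowTableau β hN := by
  rw [← tabWeight_rowTableau] at h
  have hsymm : ∀ n : ℕ, ∀ i : Fin N, (i : ℕ) = n → T.symm i = (rowTableau β hN).symm i := by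
    intro n
    induction n using Nat.strong_induction_on with
    | _ n ih =>
      rintro i rfl
      have hi : ∀ j < i, T.symm j = (rowTableau β hN).symm j := fun j hj => ih j hj j rfl
      have h1 := tabWeight_sub hmu hN T (rowTableau β hN) i i
      rw [h, sub_self, eq_comm, Int.cast_eq_zero] at h1
      rcases lt_trichotomy (T.symm i).1 ((rowTableau β hN).symm i).1 with h2 | h2 | h2
      · have h3 := rowTableau_lt_of_row_lt hN h2
        rw [Equiv.apply_symm_apply] at h3
        have h4 := hi _ h3
        rw [Equiv.symm_apply_apply, EmbeddingLike.apply_eq_iff_eq] at h4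
        exact (h3.ne h4).elim
      · exact cell_ext mu h2 (by rw [h2] at h1; omega)
      -- If the cell of `T` lies in a later row, equality of contents and the inner partition show
      -- that it is not the first of its row. That first cell has a smaller entry in `T`, so both
      -- tableaux agree on it; yet in row reading order it comes after `i`.
      · exfalso
        have h3 := le_cellCol mu ((rowTableau β hN).symm i)
        have h4 := hs.inner h2.le
        have h5 : 0 < ((T.symm i).2 : ℕ) := by
          have := Fin.lt_def.1 h2
          simp only [cellCol] at h1 h3
          omega
        have h6 := hT ⟨(T.symm i).1, 0, h5.trans (T.symm i).2.2⟩ (T.symm i) rfl h5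
        rw [Equiv.apply_symm_apply] at h6
        have h7 := hi _ h6
        rw [Equiv.symm_apply_apply, eq_comm, Equiv.symm_apply_eq] at h7
        have h8 := rowTableau_lt_of_row_lt hN (c := (rowTableau β hN).symm i)
          (c' := ⟨(T.symm i).1, 0, h5.trans (T.symm i).2.2⟩) h2
        rw [Equiv.apply_symm_apply, ← h7] at h8
        exact lt_asymm h6 h8
  have : T.symm = (rowTableau β hN).symm := Equiv.ext fun i => hsymm i i rfl
  rw [← Equiv.symm_symm T, this, Equiv.symm_symm]

include hmu in
/-- The weights at two consecutive positions whose exchange is standard are not adjacent. -/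
lemma tabWeight_sub_sq_ne_one (hs : IsSkewShape mu β) (hN : ∑ a, β a = N) {T : Tableau N β}
    (hT : IsStandard μ T) {i : Fin (N - 1)} (hT' : IsStandard μ (T.trans (simpleRefl i))) :
    (tabWeight μ hN T (lo i) - tabWeight μ hN T (hi i)) ^ 2 ≠ 1 := by
  have hlt : (lo i : Fin N) < hi i := lo_lt_hi i
  intro hsq
  rw [tabWeight_sub hmu, ← Int.cast_pow, ← Int.cast_one (R := ℂ), Int.cast_inj, sq_eq_one_iff] at hsq
  -- Neither cell is weakly south-east of the other, since each order of the two entries is realised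
  -- by a standard tableau. Then row and column differ in opposite directions, and the contents
  -- differ by at least two.
  have h1 : ¬((T.symm (hi i)).1 ≤ (T.symm (lo i)).1 ∧
      cellCol mu (T.symm (hi i)) ≤ cellCol mu (T.symm (lo i))) := by
    rintro ⟨h1, h2⟩
    have := hT.le hmu hs h1 h2
    rw [Equiv.apply_symm_apply, Equiv.apply_symm_apply] at this
    exact absurd hlt (not_lt.2 this)
  have h2 : ¬((T.symm (lo i)).1 ≤ (T.symm (hi i)).1 ∧
      cellCol mu (T.symm (lo i)) ≤ cellCol mu (T.symm (hi i))) := by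
    rintro ⟨h1, h2⟩
    have := hT'.le hmu hs h1 h2
    rw [Equiv.trans_apply, Equiv.trans_apply, Equiv.apply_symm_apply, Equiv.apply_symm_apply,
      simpleRefl_lo, simpleRefl_hi] at this
    exact absurd hlt (not_lt.2 this)
  rw [Fin.le_def] at h1 h2
  omega

end

/-! ### Words and tableaux -/

section

variable {m N : ℕ} {β : Fin m → ℕ}

/-- The map from positions to cells given by a word: the `k`-th occurrence of the letter `a` is sent
to the `k`-th cell of the row `a`. -/
def wordCell (c : Fin N → Fin m) (hc : ∀ a, (Finset.univ.filter fun i => c i = a).card = β a)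
    (i : Fin N) : Cell β :=
  ⟨c i, (Finset.univ.filter fun j => j < i ∧ c j = c i).card, by
    rw [← hc (c i)]
    refine Finset.card_lt_card (Finset.ssubset_iff_of_subset ?_ |>.2 ⟨i, ?_, ?_⟩)
    · exact fun j hj => Finset.mem_filter.2 ⟨Finset.mem_univ _, (Finset.mem_filter.1 hj).2.2⟩
    · simp
    · simp⟩

lemma card_lt_card_of_lt {c : Fin N → Fin m} {i j : Fin N} (hij : i < j) (h : c i = c j) :
    (Finset.univ.filter fun k => k < i ∧ c k = c i).card <
      (Finset.univ.filter fun k => k < j ∧ c k = c j).card := by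
  refine Finset.card_lt_card (Finset.ssubset_iff_of_subset ?_ |>.2 ⟨i, ?_, ?_⟩)
  · intro k hk
    rw [Finset.mem_filter] at hk ⊢
    exact ⟨hk.1, hk.2.1.trans hij, hk.2.2.trans h⟩
  · simp [hij, h]
  · simp

lemma wordCell_bijective (hN : ∑ a, β a = N) (c : Fin N → Fin m)
    (hc : ∀ a, (Finset.univ.filter fun i => c i = a).card = β a) :
    Function.Bijective (wordCell c hc) := by
  rw [Fintype.bijective_iff_injective_and_card]
  refine ⟨fun i j h => ?_, by simp [hN]⟩
  have h1 : c i = c j := congrArg Sigma.fst h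
  have h2 : (Finset.univ.filter fun k => k < i ∧ c k = c i).card =
      (Finset.univ.filter fun k => k < j ∧ c k = c j).card :=
    congrArg (fun x : Cell β => (x.2 : ℕ)) h
  rcases lt_trichotomy i j with h3 | h3 | h3
  · exact absurd h2 (card_lt_card_of_lt h3 h1).ne
  · exact h3
  · exact absurd h2 (card_lt_card_of_lt h3 h1.symm).ne'

/-- The tableau of a word. -/
def wordTableau (hN : ∑ a, β a = N) (c : Fin N → Fin m)
    (hc : ∀ a, (Finset.univ.filter fun i => c i = a).card = β a) : Tableau N β :=
  (Equiv.ofBijective _ (wordCell_bijective hN c hc)).symm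

lemma wordTableau_symm (hN : ∑ a, β a = N) (c : Fin N → Fin m)
    (hc : ∀ a, (Finset.univ.filter fun i => c i = a).card = β a) (i : Fin N) :
    (wordTableau hN c hc).symm i = wordCell c hc i := rfl

lemma wordTableau_lt (hN : ∑ a, β a = N) (c : Fin N → Fin m)
    (hc : ∀ a, (Finset.univ.filter fun i => c i = a).card = β a) {d d' : Cell β} (h : d.1 = d'.1)
    (h' : (d.2 : ℕ) < d'.2) : wordTableau hN c hc d < wordTableau hN c hc d' := by
  obtain ⟨i, rfl⟩ := (wordTableau hN c hc).symm.surjective d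
  obtain ⟨j, rfl⟩ := (wordTableau hN c hc).symm.surjective d'
  rw [Equiv.apply_symm_apply, Equiv.apply_symm_apply]
  rcases lt_trichotomy i j with h3 | h3 | h3
  · exact h3
  · rw [h3] at h'
    exact absurd h' (lt_irrefl _)
  · exact absurd h' (card_lt_card_of_lt h3 h.symm).not_gt

lemma card_lt_add_card_gt (c : Fin N → Fin m)
    (hc : ∀ a, (Finset.univ.filter fun i => c i = a).card = β a) (i : Fin N) :
    (Finset.univ.filter fun j => j < i ∧ c j = c i).card + 1 +
      (Finset.univ.filter fun j => i < j ∧ c j = c i).card = β (c i) := by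
  rw [← hc (c i), ← Finset.card_singleton i, ← Finset.card_union_of_disjoint,
    ← Finset.card_union_of_disjoint]
  · congr 1
    ext j
    simp only [Finset.mem_union, Finset.mem_filter, Finset.mem_univ, true_and,
      Finset.mem_singleton]
    constructor
    · rintro ((h | rfl) | h)
      · exact h.2
      · rfl
      · exact h.2
    · intro h
      rcases lt_trichotomy j i with h1 | h1 | h1
      · exact Or.inl (Or.inl ⟨h1, h⟩)
      · exact Or.inl (Or.inr h1)
      · exact Or.inr ⟨h1, h⟩
  · rw [Finset.disjoint_left]
    intro j hj hj'
    rw [Finset.mem_filter] at hj'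
    rcases Finset.mem_union.1 hj with h | h
    · exact lt_asymm (Finset.mem_filter.1 h).2.1 hj'.2.1
    · exact hj'.2.1.ne (Finset.mem_singleton.1 h).symm
  · simp

lemma card_head_add_tailCount (c : Fin N → Fin m)
    (hc : ∀ a, (Finset.univ.filter fun i => c i = a).card = β a) (t : ℕ) (p : Fin m) :
    (Finset.univ.filter fun j : Fin N => (j : ℕ) < t ∧ c j = p).card + tailCount c t p = β p := by
  rw [← hc p, tailCount, ← Finset.card_union_of_disjoint]
  · congr 1
    ext j
    simp only [Finset.mem_union, Finset.mem_filter, Finset.mem_univ, true_and]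
    rw [← or_and_right, and_iff_right (lt_or_ge _ _)]
  · rw [Finset.disjoint_left]
    intro j hj hj'
    exact absurd (Finset.mem_filter.1 hj).2.1 (not_lt.2 (Finset.mem_filter.1 hj').2.1)

variable {μ lam : Weight m}

/-- The eigenvalue formula for forms counts later occurrences of a letter, while the column of a
cell counts earlier ones. Their sum is `β_a - 1`, and `λ_a - μ_a = β_a - N/m` matches the two. -/
lemma tabWeight_wordTableau (hN : ∑ a, β a = N)
    (hlam : ∀ p, wcoord lam p = wcoord μ p + β p - N / (m : ℂ)) (c : Fin N → Fin m)
    (hc : ∀ a, (Finset.univ.filter fun i => c i = a).card = β a) (i : Fin N) :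
    tabWeight μ hN (wordTableau hN c hc) i = wcoord lam (c i) -
      (Finset.univ.filter fun j => i < j ∧ c j = c i).card + ((m : ℂ) - 1 - (c i : ℕ)) +
      yShift m N := by
  have hm : (m : ℂ) ≠ 0 := by
    have := (c i).pos
    exact_mod_cast this.ne'
  have h1 := congrArg (Nat.cast (R := ℂ)) (card_lt_add_card_gt c hc i)
  push_cast at h1
  rw [tabWeight_eq, wordTableau_symm, cellP, wordCell, hlam, yShift, ← h1]
  field_simp
  ring

variable {mu : Fin m → ℕ} {κ : ℂ} (hmu : ∀ p, wcoord μ p = mu p + κ)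

-- Removing a final segment of letters from `λ` leaves, up to a common constant, the inner shape
-- enlarged by the initial segment. Dominance says that this shape is a partition, so no cell is
-- filled before the one above it.
include hmu in
lemma isStandard_wordTableau (hN : ∑ a, β a = N)
    (hlam : ∀ p, wcoord lam p = wcoord μ p + β p - N / (m : ℂ)) (c : Fin N → Fin m)
    (hc : ∀ a, (Finset.univ.filter fun i => c i = a).card = β a)
    (hdom : ∀ t ≤ N, ∀ p q : Fin m, (p : ℕ) + 1 = q →
      ∃ n : ℕ, (wcoord lam p - tailCount c t p) - (wcoord lam q - tailCount c t q) = n) :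
    IsStandard μ (wordTableau hN c hc) := by
  rw [isStandard_iff hmu]
  refine fun d d' => ⟨fun h h' => wordTableau_lt hN c hc h.symm ?_, fun h h' => ?_⟩
  · have := congrArg mu h
    simp only [cellCol] at h'
    omega
  · obtain ⟨i, rfl⟩ := (wordTableau hN c hc).symm.surjective d
    obtain ⟨j, rfl⟩ := (wordTableau hN c hc).symm.surjective d'
    rw [Equiv.apply_symm_apply, Equiv.apply_symm_apply]
    rw [wordTableau_symm, wordTableau_symm] at h h'
    by_contra hle
    rw [not_lt] at hle
    -- Suppose the lower cell carries an entry `j ≤ i`. After `j + 1` letters the lower row reaches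
    -- past the common column, while the upper row has not yet received its cell there.
    obtain ⟨n, hn⟩ := hdom (j + 1) j.2 (c i) (c j) h.symm
    have h1 := congrArg (Nat.cast (R := ℂ)) (card_head_add_tailCount c hc (j + 1) (c i))
    have h2 := congrArg (Nat.cast (R := ℂ)) (card_head_add_tailCount c hc (j + 1) (c j))
    rw [hlam, hlam, hmu, hmu, ← h1, ← h2] at hn
    have h3 : mu (c i) + (Finset.univ.filter fun k : Fin N => (k : ℕ) < j + 1 ∧ c k = c i).card =
        n + (mu (c j) +
          (Finset.univ.filter fun k : Fin N => (k : ℕ) < j + 1 ∧ c k = c j).card) := by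
      rw [← Nat.cast_inj (R := ℂ)]
      push_cast at hn ⊢
      linear_combination hn
    have h4 : (Finset.univ.filter fun k : Fin N => (k : ℕ) < j + 1 ∧ c k = c i).card ≤
        (Finset.univ.filter fun k => k < i ∧ c k = c i).card := by
      refine Finset.card_le_card fun k hk => ?_
      rw [Finset.mem_filter] at hk ⊢
      have hne : k ≠ j := by
        rintro rfl
        have := congrArg Fin.val hk.2.2
        simp only [wordCell] at h
        omega
      refine ⟨hk.1, lt_of_lt_of_le (lt_of_le_of_ne ?_ hne) hle, hk.2.2⟩
      rw [Fin.le_def]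
      omega
    have h5 : (Finset.univ.filter fun k => k < j ∧ c k = c j).card + 1 ≤
        (Finset.univ.filter fun k : Fin N => (k : ℕ) < j + 1 ∧ c k = c j).card := by
      refine Nat.succ_le_of_lt (Finset.card_lt_card
        (Finset.ssubset_iff_of_subset ?_ |>.2 ⟨j, ?_, ?_⟩))
      · intro k hk
        rw [Finset.mem_filter] at hk ⊢
        have := Fin.lt_def.1 hk.2.1
        exact ⟨hk.1, by omega, hk.2.2⟩
      · simp
      · simp
    simp only [cellCol, wordCell] at h'
    omega

/-! ### Reduced words and standard tableaux -/

lemma permLength_inv (w : Equiv.Perm (Fin N)) : permLength w⁻¹ = permLength w := by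
  refine Finset.card_bij' (fun q _ => (w⁻¹ q.2, w⁻¹ q.1)) (fun q _ => (w q.2, w q.1)) ?_ ?_ ?_ ?_
  · rintro ⟨a, b⟩ h
    simpa [and_comm] using h
  · rintro ⟨a, b⟩ h
    simpa [and_comm] using h
  · rintro ⟨a, b⟩ h
    simp
  · rintro ⟨a, b⟩ h
    simp

lemma simpleRefl_inv (i : Fin (N - 1)) : (simpleRefl i : Equiv.Perm (Fin N))⁻¹ = simpleRefl i :=
  Equiv.swap_inv _ _

lemma permLength_simpleRefl_mul (w : Equiv.Perm (Fin N)) (i : Fin (N - 1))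
    (h : w⁻¹ (hi i) < w⁻¹ (lo i)) : permLength w = permLength (simpleRefl i * w) + 1 := by
  rw [← permLength_inv, permLength_mul_simpleRefl _ i h, ← permLength_inv, mul_inv_rev, inv_inv,
    simpleRefl_inv]

lemma permLength_simpleRefl_mul_le (w : Equiv.Perm (Fin N)) (i : Fin (N - 1)) :
    permLength (simpleRefl i * w) ≤ permLength w + 1 := by
  rcases lt_trichotomy (w⁻¹ (hi i)) (w⁻¹ (lo i)) with h | h | h
  · rw [permLength_simpleRefl_mul w i h]
    omega
  · exact absurd (w⁻¹.injective h) (lo_lt_hi i).ne'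
  · rw [permLength_simpleRefl_mul (simpleRefl i * w) i, ← mul_assoc, simpleRefl_mul_self, one_mul]
    rwa [mul_inv_rev, simpleRefl_inv, Equiv.Perm.mul_apply, Equiv.Perm.mul_apply, simpleRefl_lo,
      simpleRefl_hi]

lemma permLength_one : permLength (1 : Equiv.Perm (Fin N)) = 0 := by
  rw [permLength, Finset.card_eq_zero, Finset.filter_eq_empty_iff]
  exact fun q _ h => lt_asymm h.1 h.2

lemma permLength_prod_le (l : List (Fin (N - 1))) :
    permLength (l.map simpleRefl).prod ≤ l.length := by
  induction l with
  | nil => simp [permLength_one]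
  | cons i l ih =>
    rw [List.map_cons, List.prod_cons, List.length_cons]
    exact (permLength_simpleRefl_mul_le _ i).trans (Nat.succ_le_succ ih)

lemma IsReducedWord.of_cons {i : Fin (N - 1)} {l : List (Fin (N - 1))} {w : Equiv.Perm (Fin N)}
    (h : IsReducedWord (i :: l) w) :
    IsReducedWord l (simpleRefl i * w) ∧ w⁻¹ (hi i) < w⁻¹ (lo i) := by
  obtain ⟨h1, h2⟩ := h
  rw [List.map_cons, List.prod_cons] at h1
  rw [List.length_cons] at h2
  have h3 : (l.map simpleRefl).prod = simpleRefl i * w := by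
    rw [← h1, ← mul_assoc, simpleRefl_mul_self, one_mul]
  have h4 := permLength_prod_le l
  have h5 := permLength_simpleRefl_mul_le (simpleRefl i * w) i
  rw [← mul_assoc, simpleRefl_mul_self, one_mul] at h5
  rw [h3] at h4
  refine ⟨⟨h3, by omega⟩, ?_⟩
  rcases lt_trichotomy (w⁻¹ (hi i)) (w⁻¹ (lo i)) with h | h | h
  · exact h
  · exact absurd (w⁻¹.injective h) (lo_lt_hi i).ne'
  · have h6 := permLength_simpleRefl_mul (simpleRefl i * w) i (by
      rwa [mul_inv_rev, simpleRefl_inv, Equiv.Perm.mul_apply, Equiv.Perm.mul_apply, simpleRefl_lo,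
        simpleRefl_hi])
    rw [← mul_assoc, simpleRefl_mul_self, one_mul] at h6
    omega

lemma tabPerm_inv_apply (hN : ∑ a, β a = N) (T : Tableau N β) (k : Fin N) :
    (tabPerm hN T)⁻¹ k = rowTableau β hN (T.symm k) := rfl

lemma eq_rowTableau_of_tabPerm_eq_one (hN : ∑ a, β a = N) {T : Tableau N β}
    (h : tabPerm hN T = 1) : T = rowTableau β hN := by
  ext1 c
  have := congrArg (fun w => w (rowTableau β hN c)) h
  simpa [tabPerm] using this

-- An exchange of consecutive entries can break standardness only if the cell of the smaller one has
-- to precede the other. The row reading tableau is standard and orders these two cells the opposite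
-- way.
include hmu in
lemma IsStandard.trans_simpleRefl (hN : ∑ a, β a = N) {T : Tableau N β} (hT : IsStandard μ T)
    {i : Fin (N - 1)} (h : (tabPerm hN T)⁻¹ (hi i) < (tabPerm hN T)⁻¹ (lo i)) :
    IsStandard μ (T.trans (simpleRefl i)) := by
  have h0 := isStandard_rowTableau hmu hN
  rw [tabPerm_inv_apply, tabPerm_inv_apply] at h
  have key : ∀ d d', T d < T d' → rowTableau β hN d < rowTableau β hN d' →
      T.trans (simpleRefl i) d < T.trans (simpleRefl i) d' := by
    intro d d' h1 h2
    refine simpleRefl_lt_iff i _ _ (fun h3 => ?_) h1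
    rw [← h3.1, ← h3.2, Equiv.symm_apply_apply, Equiv.symm_apply_apply] at h
    exact lt_asymm h h2
  exact fun d d' => ⟨fun h1 h2 => key d d' ((hT d d').1 h1 h2) ((h0 d d').1 h1 h2),
    fun h1 h2 => key d d' ((hT d d').2 h1 h2) ((h0 d d').2 h1 h2)⟩

/-! ### The skew diagram of a pair of dominant weights -/

/-- The row word `1^{β_1} ⋯ m^{β_m}`. -/
def rowWord (β : Fin m → ℕ) (hN : ∑ a, β a = N) (i : Fin N) : Fin m :=
  ((rowTableau β hN).symm i).1

lemma card_sigma_fst_eq (ν : Fin m → ℕ) (p : Fin m) :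
    (Finset.univ.filter fun s : (a : Fin m) × Fin (ν a) => s.1 = p).card = ν p := by
  have h : (Finset.univ.filter fun s : (a : Fin m) × Fin (ν a) => s.1 = p) =
      Finset.univ.map ⟨fun k : Fin (ν p) => (⟨p, k⟩ : (a : Fin m) × Fin (ν a)),
        fun k l h => by simpa using h⟩ := by
    ext ⟨a, k⟩
    simp only [Finset.mem_filter, Finset.mem_univ, true_and, Finset.mem_map]
    constructor
    · rintro rfl
      exact ⟨k, rfl⟩
    · rintro ⟨l, hl⟩
      exact (congrArg Sigma.fst hl).symm
  rw [h, Finset.card_map, Finset.card_univ, Fintype.card_fin]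

lemma card_rowWord_eq (hN : ∑ a, β a = N) (p : Fin m) :
    (Finset.univ.filter fun i => rowWord β hN i = p).card = β p := by
  rw [← card_sigma_fst_eq β p]
  refine Finset.card_equiv (rowTableau β hN).symm fun i => ?_
  rw [Finset.mem_filter, Finset.mem_filter]
  exact ⟨fun h => ⟨Finset.mem_univ _, h.2⟩, fun h => ⟨Finset.mem_univ _, h.2⟩⟩

lemma wordTableau_eq_rowTableau (hs : IsSkewShape mu β) (hmu : ∀ p, wcoord μ p = mu p + κ)
    (hN : ∑ a, β a = N) (c : Fin N → Fin m)
    (hc : ∀ a, (Finset.univ.filter fun i => c i = a).card = β a)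
    (h : tabWeight μ hN (wordTableau hN c hc) = zeta μ hN) : c = rowWord β hN := by
  have h1 := eq_rowTableau hmu hs hN (fun _ _ => wordTableau_lt hN c hc) h
  ext1 i
  rw [rowWord, ← h1]
  rfl

lemma sum_wcoord (χ : Weight m) : ∑ p, wcoord χ p = 0 := by
  have h : ∑ p, xCartan p = (0 : cartan m) := by
    apply Subtype.ext
    refine (map_sum (cartan m).subtype _ _).trans ?_
    simp only [Submodule.subtype_apply, ← slUnit_self]
    exact sum_slUnit_self
  simp only [wcoord]
  rw [← map_sum, h, map_zero]

lemma wcoord_eq_add (hN : ∑ a, β a = N) (hβ : lam - μ = ∑ a, (β a : ℂ) • eBar a) (p : Fin m) :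
    wcoord lam p = wcoord μ p + β p - N / (m : ℂ) := by
  have h := congrArg (fun χ => χ (xCartan p)) hβ
  have h1 : ∀ a, eBar a (xCartan p) = (if a = p then (1 : ℂ) else 0) - 1 / (m : ℂ) := by
    intro a
    change Matrix.diagonal _ a a = _
    rw [Matrix.diagonal_apply_eq]
  simp only [LinearMap.sub_apply, LinearMap.sum_apply, LinearMap.smul_apply, h1, smul_eq_mul,
    mul_sub, Finset.sum_sub_distrib, mul_ite, mul_one, mul_zero, Finset.sum_ite_eq',
    Finset.mem_univ, if_true, ← Finset.sum_mul] at h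
  rw [← Nat.cast_sum, hN] at h
  rw [wcoord, wcoord]
  linear_combination h

/-- The inner partition is `mu_p = μ_p - μ_m`, normalised to end in zero; the constant `-|mu| / m`
is forced because the coordinates of a weight of `sl_m` sum to zero. Dominance of `μ` and of `λ`
makes the inner and the outer shape partitions. -/
lemma exists_skewShape (hm : 1 ≤ m) (hlam : IsDominantIntegral lam) (hμ : IsDominantIntegral μ)
    (hN : ∑ a, β a = N) (hβ : lam - μ = ∑ a, (β a : ℂ) • eBar a) :
    ∃ mu : Fin m → ℕ, IsSkewShape mu β ∧
      ∀ p, wcoord μ p = mu p + -((∑ a, mu a : ℕ) : ℂ) / (m : ℂ) := by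
  have hm0 : (m : ℂ) ≠ 0 := by exact_mod_cast (by omega : m ≠ 0)
  let last : Fin m := ⟨m - 1, by omega⟩
  have h1 : ∀ p, ∃ n : ℕ, wcoord μ p = n + wcoord μ last := by
    intro p
    rcases eq_or_ne p last with h | h
    · exact ⟨0, by rw [h]; simp⟩
    · obtain ⟨n, hn⟩ := hμ p last (by
        refine lt_of_le_of_ne (Fin.le_def.2 ?_) h
        have := p.2
        change (p : ℕ) ≤ m - 1
        omega)
      refine ⟨n, ?_⟩
      rw [map_sub] at hn
      rw [wcoord, wcoord, ← hn, sub_add_cancel]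
  choose mu hmu using h1
  have h2 : wcoord μ last = -((∑ a, mu a : ℕ) : ℂ) / (m : ℂ) := by
    have h := sum_wcoord μ
    rw [Finset.sum_congr rfl fun p _ => hmu p] at h
    simp only [Finset.sum_add_distrib, Finset.sum_const, Finset.card_univ, Fintype.card_fin,
      nsmul_eq_mul] at h
    rw [eq_div_iff hm0]
    push_cast
    linear_combination h
  rw [h2] at hmu
  refine ⟨mu, ⟨?_, ?_⟩, hmu⟩
  · intro p q hpq
    rcases hpq.lt_or_eq with h | rfl
    · obtain ⟨n, hn⟩ := hμ p q h
      rw [map_sub] at hn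
      have h3 : (mu p : ℂ) = mu q + n := by
        rw [← hn]
        change _ = _ + (wcoord μ p - wcoord μ q)
        rw [hmu p, hmu q]
        ring
      have h4 : mu p = mu q + n := by exact_mod_cast h3
      omega
    · exact le_rfl
  · intro p q hpq
    rcases hpq.lt_or_eq with h | rfl
    · obtain ⟨n, hn⟩ := hlam p q h
      rw [map_sub] at hn
      have h3 : ((mu p + β p : ℕ) : ℂ) = ((mu q + β q + n : ℕ) : ℂ) := by
        push_cast
        rw [← hn]
        change _ = _ + (wcoord lam p - wcoord lam q)
        rw [wcoord_eq_add hN hβ, wcoord_eq_add hN hβ, hmu p, hmu q]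
        ring
      have h4 : mu p + β p = mu q + β q + n := by exact_mod_cast h3
      simp only
      omega
    · exact le_rfl

lemma isDiagram_inner (hs : IsSkewShape mu β) :
    IsDiagram (fun s : (a : Fin m) × Fin (mu a) => s.1) (fun s => s.2) where
  inj := by
    rintro ⟨a, k⟩ ⟨b, l⟩ h h'
    obtain rfl : a = b := h
    exact congrArg (Sigma.mk a) (Fin.ext h')
  up := by
    rintro ⟨a, k⟩ p hp
    exact ⟨⟨p, k, k.2.trans_le (hs.inner hp.le)⟩, rfl, rfl⟩

lemma isDiagram_outer (hs : IsSkewShape mu β) (hN : ∑ a, β a = N) :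
    IsDiagram (Sum.elim (fun s : (a : Fin m) × Fin (mu a) => s.1) (rowWord β hN))
      (Sum.elim (fun s => (s.2 : ℕ)) fun i => cellCol mu ((rowTableau β hN).symm i)) where
  inj := by
    have h1 : ∀ (s : (a : Fin m) × Fin (mu a)) (i : Fin N), s.1 = rowWord β hN i →
        (s.2 : ℕ) = cellCol mu ((rowTableau β hN).symm i) → False := by
      rintro ⟨a, k⟩ i h h'
      obtain rfl : a = _ := h
      have := le_cellCol mu ((rowTableau β hN).symm i)
      have h2 : (k : ℕ) < mu ((rowTableau β hN).symm i).1 := k.2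
      simp only at h'
      omega
    rintro (s | i) (t | j) h h'
    · exact congrArg Sum.inl ((isDiagram_inner hs).inj s t h h')
    · exact (h1 s j h h').elim
    · exact (h1 t i h.symm h'.symm).elim
    · exact congrArg Sum.inr ((rowTableau β hN).symm.injective (cell_ext mu h h'))
  up := by
    rintro (s | i) p hp
    · obtain ⟨t, ht⟩ := (isDiagram_inner hs).up s p hp
      exact ⟨Sum.inl t, ht⟩
    · have hp' : p < ((rowTableau β hN).symm i).1 := hp
      have h1 := hs.outer hp'.le
      have h2 := cellCol_lt mu ((rowTableau β hN).symm i)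
      -- The cell above a skew cell belongs either to the inner shape or to the skew part.
      rcases lt_or_ge (cellCol mu ((rowTableau β hN).symm i)) (mu p) with h | h
      · exact ⟨Sum.inl ⟨p, _, h⟩, rfl, rfl⟩
      · obtain ⟨d, hd, hd'⟩ := exists_cell (β := β) h (h2.trans_le h1)
        refine ⟨Sum.inr (rowTableau β hN d), ?_, ?_⟩
        · simpa [rowWord] using hd
        · simpa using hd'

end

/-! ### Common eigenvectors of commuting operators -/

section

variable {ι V : Type*} [AddCommGroup V] [Module ℂ V] [FiniteDimensional ℂ V]

/-- If every operator is scalar on `W`, any nonzero vector works. Otherwise an eigenspace of a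
nonscalar one is a smaller nonzero stable subspace, and the dimension drops. -/
lemma exists_common_eigenvector (f : ι → Module.End ℂ V) (hf : ∀ i j, f i * f j = f j * f i)
    (W : Submodule ℂ V) (hW : W ≠ ⊥) (hs : ∀ i, ∀ w ∈ W, f i w ∈ W) :
    ∃ w ∈ W, w ≠ 0 ∧ ∃ χ : ι → ℂ, ∀ i, f i w = χ i • w := by
  induction hn : Module.finrank ℂ W using Nat.strong_induction_on generalizing W with
  | _ n ih =>
    by_cases hscal : ∀ i, ∃ r : ℂ, ∀ w ∈ W, f i w = r • w
    · choose χ hχ using hscal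
      obtain ⟨w, hw, hw0⟩ := W.ne_bot_iff.1 hW
      exact ⟨w, hw, hw0, χ, fun i => hχ i w hw⟩
    · push Not at hscal
      obtain ⟨i, hi⟩ := hscal
      have : Nontrivial W := W.nontrivial_iff_ne_bot.2 hW
      obtain ⟨r, hr⟩ := Module.End.exists_eigenvalue ((f i).restrict (hs i))
      obtain ⟨u, hu⟩ := hr.exists_hasEigenvector
      have hu1 : f i u = r • (u : V) := congrArg Subtype.val hu.apply_eq_smul
      have hu0 : (u : V) ≠ 0 := fun h => hu.2 (Subtype.ext h)
      have hlt : W ⊓ Module.End.eigenspace (f i) r < W := by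
        refine lt_of_le_of_ne inf_le_left fun h => ?_
        obtain ⟨w, hw, hw'⟩ := hi r
        rw [← h] at hw
        exact hw' (Module.End.mem_eigenspace_iff.1 hw.2)
      obtain ⟨w, hw, hw'⟩ := ih _ (hn ▸ Submodule.finrank_lt_finrank_of_lt hlt)
        (W ⊓ Module.End.eigenspace (f i) r)
        ((Submodule.ne_bot_iff _).2 ⟨u, ⟨u.2, Module.End.mem_eigenspace_iff.2 hu1⟩, hu0⟩)
        (fun j w hw => ⟨hs j w hw.1, Module.End.mem_eigenspace_iff.2 (by
          have := congrArg (fun T => T w) (hf i j)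
          simp only [Module.End.mul_apply] at this
          rw [this, Module.End.mem_eigenspace_iff.1 hw.2, map_smul])⟩) rfl
      exact ⟨w, hw.1, hw'⟩

/-- A common eigenvector of the transposes of commuting operators, vanishing on a given proper stable
subspace. -/
lemma exists_common_eigenform (f : ι → Module.End ℂ V) (hf : ∀ i j, f i * f j = f j * f i)
    (W : Submodule ℂ V) (hW : W ≠ ⊤) (hs : ∀ i, ∀ w ∈ W, f i w ∈ W) :
    ∃ g : V →ₗ[ℂ] ℂ, g ≠ 0 ∧ (∀ w ∈ W, g w = 0) ∧
      ∃ χ : ι → ℂ, ∀ i v, g (f i v) = χ i * g v := by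
  obtain ⟨g, hg, hg0, χ, hχ⟩ := exists_common_eigenvector
    (fun i => Module.Dual.transpose (R := ℂ) (f i))
    (fun i j => by
      ext g v
      have := congrArg (fun T => g (T v)) (hf j i)
      exact this)
    W.dualAnnihilator
    (fun h => by
      obtain ⟨g, hg, hg'⟩ := Submodule.exists_le_ker_of_lt_top W (lt_top_iff_ne_top.2 hW)
      have h1 : g ∈ W.dualAnnihilator := (Submodule.mem_dualAnnihilator g).2 fun w hw => hg' hw
      rw [h] at h1
      exact hg ((Submodule.mem_bot ℂ).1 h1))
    (fun i g hg => by
      rw [Submodule.mem_dualAnnihilator] at hg ⊢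
      exact fun w hw => hg _ (hs i w hw))
  refine ⟨g, hg0, (Submodule.mem_dualAnnihilator g).1 hg, χ, fun i v => ?_⟩
  exact congrArg (fun T => T v) (hχ i)

/-- A common eigenvector outside a stable subspace gives a common eigenvector of the transposes with
the same eigenvalues, vanishing on this subspace. -/
lemma exists_eigenform_of_eigenvector (f : ι → Module.End ℂ V)
    (hf : ∀ i j, f i * f j = f j * f i) (W : Submodule ℂ V) (hs : ∀ i, ∀ w ∈ W, f i w ∈ W) {v : V}
    (hv : v ∉ W) {ζ : ι → ℂ} (hζ : ∀ i, f i v = ζ i • v) :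
    ∃ g : V →ₗ[ℂ] ℂ, g ≠ 0 ∧ (∀ w ∈ W, g w = 0) ∧ ∀ i v, g (f i v) = ζ i * g v := by
  -- Take `X` maximal among the stable subspaces containing `W` and avoiding `v`; any eigenform
  -- vanishing on `X` will turn out to have the eigenvalues of `v`.
  obtain ⟨X, ⟨hWX, hXs, hvX⟩, hmax⟩ := wellFounded_gt.has_min
    {X : Submodule ℂ V | W ≤ X ∧ (∀ i, ∀ w ∈ X, f i w ∈ X) ∧ v ∉ X} ⟨W, le_rfl, hs, hv⟩
  obtain ⟨g, hg0, hg, χ, hχ⟩ := exists_common_eigenform f hf X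
    (fun h => hvX (h ▸ Submodule.mem_top)) hXs
  refine ⟨g, hg0, fun w hw => hg w (hWX hw), ?_⟩
  have hχζ : ∀ i, χ i = ζ i := by
    intro i
    by_contra hne
    let h : Module.End ℂ V := f i - χ i • 1
    have hh : ∀ w, h w = f i w - χ i • w := fun w => rfl
    have hXh : X ≤ X.comap h := fun w hw => X.sub_mem (hXs i w hw) (X.smul_mem _ hw)
    have hle : X.comap h ≤ X := by
      by_contra hle
      refine hmax (X.comap h) ⟨hWX.trans hXh, fun j w hw => ?_, fun hvh => ?_⟩
        (lt_of_le_not_ge hXh hle)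
      · have h1 := congrArg (fun T => T w) (hf i j)
        simp only [Module.End.mul_apply] at h1
        rw [Submodule.mem_comap, hh, h1, ← map_smul, ← map_sub, ← hh]
        exact hXs j _ hw
      · rw [Submodule.mem_comap, hh, hζ, ← sub_smul] at hvh
        exact hvX ((X.smul_mem_iff (sub_ne_zero.2 (Ne.symm hne))).1 hvh)
    -- If `χ_i ≠ ζ_i`, the preimage of `X` under `f_i - χ_i` still avoids `v`, so it equals `X` by
    -- maximality. Hence `f_i - χ_i` is bijective on the finite-dimensional quotient by `X`; as `g`
    -- vanishes on its image, `g = 0`.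
    have hinj : Function.Injective (X.mapQ X h hXh) := by
      rw [← LinearMap.ker_eq_bot, LinearMap.ker_eq_bot']
      intro y hy
      obtain ⟨y, rfl⟩ := Submodule.Quotient.mk_surjective X y
      rw [Submodule.mapQ_apply, Submodule.Quotient.mk_eq_zero] at hy
      exact (Submodule.Quotient.mk_eq_zero X).2 (hle hy)
    refine hg0 (LinearMap.ext fun y => ?_)
    obtain ⟨z, hz⟩ := LinearMap.injective_iff_surjective.1 hinj (Submodule.Quotient.mk y)
    obtain ⟨z, rfl⟩ := Submodule.Quotient.mk_surjective X z
    rw [Submodule.mapQ_apply, Submodule.Quotient.eq] at hz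
    have h1 := hg _ hz
    rw [map_sub, hh, map_sub, hχ, map_smul, smul_eq_mul, sub_self, zero_sub, neg_eq_zero] at h1
    exact h1
  simpa only [hχζ] using hχ

end

/-! ### Relations in the degenerate affine Hecke algebra -/

section

variable {N : ℕ}

lemma permH_one : permH (1 : Equiv.Perm (Fin N)) = 1 := by
  rw [permH, RingQuot.mkAlgHom_rel ℂ HeckeRel.one, map_one]

lemma permH_mul (w w' : Equiv.Perm (Fin N)) : permH (w * w') = permH w * permH w' := by
  rw [permH, RingQuot.mkAlgHom_rel ℂ (HeckeRel.mul w w'), map_mul]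
  rfl

lemma epsH_comm (j k : Fin N) : epsH j * epsH k = epsH k * epsH j := by
  have h := RingQuot.mkAlgHom_rel ℂ (HeckeRel.comm j k)
  rwa [map_mul, map_mul] at h

lemma permH_mul_epsH (i : Fin (N - 1)) (j : Fin N) :
    permH (simpleRefl i) * epsH j = epsH (simpleRefl i j) * permH (simpleRefl i) -
      algebraMap ℂ (Hecke N) ((if j = lo i then 1 else 0) - (if j = hi i then 1 else 0)) := by
  have h := RingQuot.mkAlgHom_rel ℂ (HeckeRel.cross i j)
  rw [map_sub, map_mul, map_mul, map_neg, AlgHom.commutes] at h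
  rw [sub_eq_iff_eq_add] at h
  exact h.trans (by rw [neg_add_eq_sub]; rfl)

lemma permH_simpleRefl_mul_self (i : Fin (N - 1)) :
    permH (simpleRefl i) * permH (simpleRefl i) = (1 : Hecke N) := by
  rw [← permH_mul, simpleRefl_mul_self, permH_one]

lemma permH_mul_epsH_lo (i : Fin (N - 1)) :
    permH (simpleRefl i) * epsH (lo i) = epsH (hi i) * permH (simpleRefl i) - 1 := by
  rw [permH_mul_epsH, simpleRefl_lo, if_pos rfl, if_neg (lo_lt_hi i).ne, sub_zero, map_one]

lemma permH_mul_epsH_hi (i : Fin (N - 1)) :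
    permH (simpleRefl i) * epsH (hi i) = epsH (lo i) * permH (simpleRefl i) + 1 := by
  rw [permH_mul_epsH, simpleRefl_hi, if_neg (lo_lt_hi i).ne', if_pos rfl, zero_sub, map_neg, map_one,
    sub_neg_eq_add]

/-- The cross relation gives `(a - b) s = -s (a - b) - 2` for `a = ε_i^∨`, `b = ε_{i+1}^∨`; the
linear terms of the square then cancel. -/
lemma simpleIntertwiner_mul_self (i : Fin (N - 1)) :
    simpleIntertwiner i * simpleIntertwiner i = 1 - (epsH (lo i) - epsH (hi i)) ^ 2 := by
  have key : ∀ {R : Type} [Ring R] (s a b : R), s * s = 1 → s * a = b * s - 1 → s * b = a * s + 1 →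
      (1 + s * (a - b)) * (1 + s * (a - b)) = 1 - (a - b) ^ 2 := by
    intro R _ s a b h1 h2 h3
    have h4 : (a - b) * s = -(s * (a - b)) - 1 - 1 := by
      rw [mul_sub, h2, h3]
      noncomm_ring
    have h5 : s * (a - b) * (s * (a - b)) = -(a - b) ^ 2 - s * (a - b) - s * (a - b) := by
      calc s * (a - b) * (s * (a - b)) = s * ((a - b) * s) * (a - b) := by noncomm_ring
        _ = -((s * s) * (a - b) * (a - b)) - s * (a - b) - s * (a - b) := by
          rw [h4]
          noncomm_ring
        _ = _ := by rw [h1]; noncomm_ring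
    calc (1 + s * (a - b)) * (1 + s * (a - b)) =
        1 + s * (a - b) + s * (a - b) + s * (a - b) * (s * (a - b)) := by noncomm_ring
      _ = _ := by rw [h5]; noncomm_ring
  exact key _ _ _ (permH_simpleRefl_mul_self i) (permH_mul_epsH_lo i) (permH_mul_epsH_hi i)

lemma epsH_mul_simpleIntertwiner (i : Fin (N - 1)) (j : Fin N) :
    epsH j * simpleIntertwiner i = simpleIntertwiner i * epsH (simpleRefl i j) := by
  have hc : ∀ k, epsH k * (epsH (lo i) - epsH (hi i)) =
      (epsH (lo i) - epsH (hi i)) * epsH (N := N) k := fun k => by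
    rw [mul_sub, sub_mul, epsH_comm k, epsH_comm k]
  rcases eq_or_ne j (lo i) with rfl | h1
  · have key : ∀ {R : Type} [Ring R] (s a b : R), a * b = b * a → s * b = a * s + 1 →
        a * (1 + s * (a - b)) = (1 + s * (a - b)) * b := by
      intro R _ s a b h1 h2
      have h3 : (a - b) * b = b * (a - b) := by rw [sub_mul, h1, mul_sub]
      calc a * (1 + s * (a - b)) = a + (a * s) * (a - b) := by noncomm_ring
        _ = a + (s * b - 1) * (a - b) := by rw [h2]; noncomm_ring
        _ = b + s * (b * (a - b)) := by noncomm_ring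
        _ = _ := by rw [← h3]; noncomm_ring
    rw [simpleRefl_lo]
    exact key _ _ _ (epsH_comm _ _) (permH_mul_epsH_hi i)
  rcases eq_or_ne j (hi i) with rfl | h2
  · have key : ∀ {R : Type} [Ring R] (s a b : R), a * b = b * a → s * a = b * s - 1 →
        b * (1 + s * (a - b)) = (1 + s * (a - b)) * a := by
      intro R _ s a b h1 h2
      have h3 : (a - b) * a = a * (a - b) := by rw [sub_mul, mul_sub, h1]
      calc b * (1 + s * (a - b)) = b + (b * s) * (a - b) := by noncomm_ring
        _ = b + (s * a + 1) * (a - b) := by rw [h2]; noncomm_ring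
        _ = a + s * (a * (a - b)) := by noncomm_ring
        _ = _ := by rw [← h3]; noncomm_ring
    rw [simpleRefl_hi]
    exact key _ _ _ (epsH_comm _ _) (permH_mul_epsH_lo i)
  · have h3 : simpleRefl i j = j := Equiv.swap_apply_of_ne_of_ne h1 h2
    have h4 := permH_mul_epsH i j
    rw [h3, if_neg h1, if_neg h2, sub_zero, map_zero, sub_zero] at h4
    rw [h3, simpleIntertwiner, mul_add, add_mul, mul_one, one_mul, ← mul_assoc, ← h4, mul_assoc,
      hc, mul_assoc]

lemma hecke_induction {P : Hecke N → Prop} (halg : ∀ r : ℂ, P (algebraMap ℂ (Hecke N) r))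
    (hadd : ∀ x y, P x → P y → P (x + y)) (hmul : ∀ x y, P x → P y → P (x * y))
    (hperm : ∀ w, P (permH w)) (heps : ∀ i, P (epsH i)) (x : Hecke N) : P x := by
  obtain ⟨x, rfl⟩ := RingQuot.mkAlgHom_surjective ℂ (HeckeRel N) x
  induction x using FreeAlgebra.induction with
  | grade0 r => rw [AlgHom.commutes]; exact halg r
  | grade1 x =>
    rcases x with w | i
    · exact hperm w
    · exact heps i
  | mul a b ha hb => rw [map_mul]; exact hmul _ _ ha hb
  | add a b ha hb => rw [map_add]; exact hadd _ _ ha hb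

end

/-! ### Weight vectors of modules over the Hecke algebra -/

section

variable {N : ℕ} {E : Type} [AddCommGroup E] [Module ℂ E] [Module (Hecke N) E]
  [IsScalarTower ℂ (Hecke N) E]

/-- The vector has the given weight with respect to the polynomial subalgebra. -/
def HasWeight (χ : Fin N → ℂ) (v : E) : Prop := ∀ i : Fin N, epsH i • v = χ i • v

/-- The linear form has the given weight with respect to the polynomial subalgebra. -/
def FormHasWeight (χ : Fin N → ℂ) (g : E →ₗ[ℂ] ℂ) : Prop :=
  ∀ (i : Fin N) v, g (epsH i • v) = χ i * g v

lemma smul_hecke_comm (r : ℂ) (x : Hecke N) (v : E) :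
    x • r • v = r • x • v := by
  rw [← algebraMap_smul (Hecke N) r v, ← algebraMap_smul (Hecke N) r (x • v), smul_smul, smul_smul,
    Algebra.commutes]

lemma HasWeight.sub_sq_smul {χ : Fin N → ℂ} {v : E} (h : HasWeight χ v) (j k : Fin N) :
    (1 - (epsH j - epsH k) ^ 2 : Hecke N) • v = (1 - (χ j - χ k) ^ 2) • v := by
  have h1 : (epsH j - epsH k) • v = (χ j - χ k) • v := by rw [sub_smul, h, h, ← sub_smul]
  rw [sub_smul, one_smul, pow_two, mul_smul, h1, smul_hecke_comm, h1, smul_smul, sub_smul, one_smul,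
    pow_two]

lemma HasWeight.simpleIntertwiner_smul {χ : Fin N → ℂ} {v : E} (h : HasWeight χ v)
    (i : Fin (N - 1)) : HasWeight (χ ∘ simpleRefl i) (simpleIntertwiner i • v) := fun j => by
  rw [smul_smul, epsH_mul_simpleIntertwiner, mul_smul, h, smul_hecke_comm, Function.comp_apply]

lemma HasWeight.simpleIntertwiner_sq_smul {χ : Fin N → ℂ} {v : E} (h : HasWeight χ v)
    (i : Fin (N - 1)) : simpleIntertwiner i • simpleIntertwiner i • v =
      (1 - (χ (lo i) - χ (hi i)) ^ 2) • v := by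
  rw [smul_smul, simpleIntertwiner_mul_self, h.sub_sq_smul]

/-- The linear form `v ↦ g (x v)`. -/
def formComp (g : E →ₗ[ℂ] ℂ) (x : Hecke N) : E →ₗ[ℂ] ℂ where
  toFun v := g (x • v)
  map_add' v w := by rw [smul_add, map_add]
  map_smul' r v := by rw [smul_hecke_comm, map_smul, RingHom.id_apply]

lemma formComp_apply (g : E →ₗ[ℂ] ℂ) (x : Hecke N) (v : E) : formComp g x v = g (x • v) := rfl

lemma FormHasWeight.simpleIntertwiner {χ : Fin N → ℂ} {g : E →ₗ[ℂ] ℂ} (h : FormHasWeight χ g)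
    (i : Fin (N - 1)) : FormHasWeight (χ ∘ simpleRefl i) (formComp g (simpleIntertwiner i)) := by
  intro j v
  have h1 : simpleRefl i (simpleRefl i j) = j :=
    congrArg (fun w => w j) (simpleRefl_mul_self i)
  rw [formComp_apply, formComp_apply, smul_smul, Function.comp_apply, ← h (simpleRefl i j),
    smul_smul, epsH_mul_simpleIntertwiner, h1]

omit [IsScalarTower ℂ (Hecke N) E] in
lemma FormHasWeight.sub_sq {χ : Fin N → ℂ} {g : E →ₗ[ℂ] ℂ} (h : FormHasWeight χ g) (j k : Fin N)
    (v : E) : g ((1 - (epsH j - epsH k) ^ 2 : Hecke N) • v) = (1 - (χ j - χ k) ^ 2) * g v := by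
  rw [pow_two, sub_smul, one_smul, mul_smul, sub_smul, map_sub, map_sub, h, h, sub_smul, map_sub,
    h, h]
  ring

/-- Polynomials in the `ε_i^∨` separating finitely many weights. -/
lemma exists_separating (E : Type) [AddCommGroup E] [Module ℂ E] [Module (Hecke N) E]
    [IsScalarTower ℂ (Hecke N) E] (s : Finset (Fin N → ℂ)) {χ : Fin N → ℂ} (hχ : χ ∉ s) :
    ∃ q : Hecke N, (∀ v : E, HasWeight χ v → q • v = v) ∧
      ∀ ψ ∈ s, ∀ v : E, HasWeight ψ v → q • v = 0 := by
  induction s using Finset.induction with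
  | empty => exact ⟨1, fun v _ => one_smul _ v, by simp⟩
  | insert ψ s _ ih =>
    rw [Finset.mem_insert, not_or] at hχ
    obtain ⟨q, hq, hq'⟩ := ih hχ.2
    obtain ⟨i, hi⟩ := Function.ne_iff.1 hχ.1
    have hi' : χ i - ψ i ≠ 0 := sub_ne_zero.2 hi
    refine ⟨(χ i - ψ i)⁻¹ • q * (epsH i - algebraMap ℂ _ (ψ i)), fun v hv => ?_, fun θ hθ v hv => ?_⟩
    · rw [mul_smul, sub_smul, hv i, algebraMap_smul, ← sub_smul, smul_assoc, smul_hecke_comm, hq v hv,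
        inv_smul_smul₀ hi']
    · rw [mul_smul, sub_smul, hv i, algebraMap_smul, ← sub_smul, smul_assoc, smul_hecke_comm]
      rcases Finset.mem_insert.1 hθ with rfl | hθ
      · rw [sub_self, zero_smul, smul_zero]
      · rw [hq' θ hθ v hv, smul_zero, smul_zero]

end

/-! ### Modules over the Hecke algebra and standard tableaux -/

/-- By the first condition each `R w_i` is zero or simple, and a sum of such submodules is
semisimple. -/
lemma isSemisimpleModule_of_lines {R E ι : Type*} [Ring R] [AddCommGroup E] [Module R E] (w : ι → E)
    (hw : ∀ i, ∀ q : R, q • w i ≠ 0 → ∃ q' : R, q' • q • w i = w i)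
    (hspan : ∀ y, ∃ (s : Finset ι) (r : ι → R), ∑ i ∈ s, r i • w i = y) :
    IsSemisimpleModule R E := by
  refine isSemisimpleModule_of_isSemisimpleModule_submodule'
    (p := fun i => Submodule.span R {w i}) (fun i => ?_) ?_
  · rcases subsingleton_or_nontrivial (Submodule.span R {w i}) with h | h
    · have := (Submodule.subsingleton_iff R).2 h
      exact (isSemisimpleModule_iff _ _).2 Subsingleton.instComplementedLattice
    · have : IsSimpleModule R (Submodule.span R {w i}) := by
        refine isSimpleModule_iff_toSpanSingleton_surjective.2 ⟨h, fun x hx y => ?_⟩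
        obtain ⟨q, hq⟩ := Submodule.mem_span_singleton.1 x.2
        obtain ⟨r, hr⟩ := Submodule.mem_span_singleton.1 y.2
        obtain ⟨q', hq'⟩ := hw i q (fun h0 => hx (Subtype.ext (hq.symm.trans h0)))
        refine ⟨r * q', Subtype.ext ?_⟩
        rw [LinearMap.toSpanSingleton_apply, Submodule.coe_smul, ← hq, mul_smul, hq', hr]
      infer_instance
  · rw [eq_top_iff]
    intro y _
    obtain ⟨s, r, rfl⟩ := hspan y
    exact Submodule.sum_mem _ fun i _ => Submodule.smul_mem _ _
      (Submodule.mem_iSup_of_mem i (Submodule.mem_span_singleton_self _))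

section

variable {m N : ℕ} {β : Fin m → ℕ} {μ : Weight m} {mu : Fin m → ℕ} {κ : ℂ}
  (hmu : ∀ p, wcoord μ p = mu p + κ) (hs : IsSkewShape mu β) (hN : ∑ a, β a = N)
  {E : Type} [AddCommGroup E] [Module ℂ E] [Module (Hecke N) E] [IsScalarTower ℂ (Hecke N) E]

lemma tabWeight_trans (T : Tableau N β) (i : Fin (N - 1)) :
    tabWeight μ hN (T.trans (simpleRefl i)) = tabWeight μ hN T ∘ simpleRefl i := by
  ext k
  rw [Function.comp_apply, tabWeight, tabWeight, Equiv.symm_trans_apply, simpleRefl, Equiv.symm_swap]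

lemma trans_simpleRefl_trans (T : Tableau N β) (i : Fin (N - 1)) :
    (T.trans (simpleRefl i)).trans (simpleRefl i) = T := by
  ext1 c
  exact congrArg (fun w => w (T c)) (simpleRefl_mul_self i)

lemma wordIntertwiner_cons (i : Fin (N - 1)) (l : List (Fin (N - 1))) :
    wordIntertwiner (i :: l) = simpleIntertwiner i * wordIntertwiner l := by
  rw [wordIntertwiner, List.map_cons, List.prod_cons, wordIntertwiner]

lemma wordIntertwiner_nil : wordIntertwiner ([] : List (Fin (N - 1))) = 1 := rfl

lemma IsReducedWord.eq_rowTableau {T : Tableau N β} (h : IsReducedWord [] (tabPerm hN T)) :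
    T = rowTableau β hN :=
  eq_rowTableau_of_tabPerm_eq_one hN h.1.symm

include hmu

lemma hasWeight_wordIntertwiner {l : List (Fin (N - 1))} {T : Tableau N β} (hT : IsStandard μ T)
    (hl : IsReducedWord l (tabPerm hN T)) {v : E} (hv : HasWeight (zeta μ hN) v) :
    HasWeight (tabWeight μ hN T) (wordIntertwiner l • v) := by
  induction l generalizing T with
  | nil => rwa [wordIntertwiner_nil, one_smul, hl.eq_rowTableau hN, tabWeight_rowTableau]
  | cons i l ih =>
    obtain ⟨hl1, hl2⟩ := hl.of_cons
    have h1 := (ih (hT.trans_simpleRefl hmu hN hl2) hl1).simpleIntertwiner_smul i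
    rwa [← tabWeight_trans, trans_simpleRefl_trans, smul_smul, ← wordIntertwiner_cons] at h1

include hs

lemma one_sub_tabWeight_sq_ne_zero {T : Tableau N β} (hT : IsStandard μ T) {i : Fin (N - 1)}
    (hT' : IsStandard μ (T.trans (simpleRefl i))) :
    1 - (tabWeight μ hN T (lo i) - tabWeight μ hN T (hi i)) ^ 2 ≠ 0 :=
  sub_ne_zero.2 (tabWeight_sub_sq_ne_one hmu hs hN hT hT').symm

/-- Every tableau on the way from `T` to the row reading one is standard, so `φ_i²` acts by a
nonzero scalar at each step, and the intertwiners can be undone inside a submodule. -/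
lemma mem_of_wordIntertwiner_smul_mem {l : List (Fin (N - 1))} {T : Tableau N β}
    (hT : IsStandard μ T) (hl : IsReducedWord l (tabPerm hN T)) {v : E}
    (hv : HasWeight (zeta μ hN) v) (K : Submodule (Hecke N) E) (hK : wordIntertwiner l • v ∈ K) :
    v ∈ K := by
  induction l generalizing T with
  | nil => rwa [wordIntertwiner_nil, one_smul] at hK
  | cons i l ih =>
    obtain ⟨hl1, hl2⟩ := hl.of_cons
    have hT' := hT.trans_simpleRefl hmu hN hl2
    refine ih hT' hl1 ?_
    have h1 := (hasWeight_wordIntertwiner hmu hN hT' hl1 hv).simpleIntertwiner_sq_smul i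
    rw [smul_smul (simpleIntertwiner i) (wordIntertwiner l), ← wordIntertwiner_cons] at h1
    have h2 := K.smul_mem (simpleIntertwiner i) hK
    rw [h1, ← algebraMap_smul (Hecke N)] at h2
    have h3 := K.smul_mem (algebraMap ℂ (Hecke N) (1 - (tabWeight μ hN (T.trans (simpleRefl i)) (lo i)
      - tabWeight μ hN (T.trans (simpleRefl i)) (hi i)) ^ 2)⁻¹) h2
    rwa [smul_smul, ← map_mul, inv_mul_cancel₀ (one_sub_tabWeight_sq_ne_zero hmu hs hN hT' (by
      rwa [trans_simpleRefl_trans])), map_one, one_smul] at h3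

lemma wordIntertwiner_smul_ne_zero {l : List (Fin (N - 1))} {T : Tableau N β}
    (hT : IsStandard μ T) (hl : IsReducedWord l (tabPerm hN T)) {v : E}
    (hv : HasWeight (zeta μ hN) v) (hv0 : v ≠ 0) : wordIntertwiner l • v ≠ 0 := fun h =>
  hv0 ((Submodule.mem_bot (Hecke N)).1
    (mem_of_wordIntertwiner_smul_mem hmu hs hN hT hl hv ⊥ ((Submodule.mem_bot _).2 h)))

lemma formComp_wordIntertwiner {l : List (Fin (N - 1))} {T : Tableau N β} (hT : IsStandard μ T)
    (hl : IsReducedWord l (tabPerm hN T)) {g : E →ₗ[ℂ] ℂ} (hg : FormHasWeight (tabWeight μ hN T) g)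
    (hg0 : g ≠ 0) : FormHasWeight (zeta μ hN) (formComp g (wordIntertwiner l)) ∧
      formComp g (wordIntertwiner l) ≠ 0 := by
  induction l generalizing T g with
  | nil =>
    have h1 : formComp g (wordIntertwiner [] : Hecke N) = g := by
      ext v
      rw [formComp_apply, wordIntertwiner_nil, one_smul]
    rw [h1, ← tabWeight_rowTableau, ← hl.eq_rowTableau hN]
    exact ⟨hg, hg0⟩
  | cons i l ih =>
    obtain ⟨hl1, hl2⟩ := hl.of_cons
    have hT' := hT.trans_simpleRefl hmu hN hl2
    have h1 : formComp g (wordIntertwiner (i :: l)) =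
        formComp (formComp g (simpleIntertwiner i)) (wordIntertwiner l) := by
      ext v
      rw [formComp_apply, formComp_apply, formComp_apply, wordIntertwiner_cons, smul_smul]
    have h2 := hg.simpleIntertwiner i
    rw [← tabWeight_trans] at h2
    rw [h1]
    -- The composite with `φ_i` is nonzero, because composing once more gives `g` times a nonzero
    -- scalar.
    refine ih hT' hl1 h2 fun h3 => hg0 (LinearMap.ext fun v => ?_)
    have h4 := congrArg (fun g => g (simpleIntertwiner i • v)) h3
    simp only [formComp_apply, LinearMap.zero_apply] at h4
    rw [smul_smul, simpleIntertwiner_mul_self, hg.sub_sq] at h4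
    exact (mul_eq_zero.1 h4).resolve_left (one_sub_tabWeight_sq_ne_zero hmu hs hN hT hT')

lemma exists_separating_tableau (E : Type) [AddCommGroup E] [Module ℂ E] [Module (Hecke N) E]
    [IsScalarTower ℂ (Hecke N) E] {T : Tableau N β} (hT : IsStandard μ T) :
    ∃ q : Hecke N, (∀ v : E, HasWeight (tabWeight μ hN T) v → q • v = v) ∧
      ∀ T', IsStandard μ T' → T' ≠ T → ∀ v : E, HasWeight (tabWeight μ hN T') v → q • v = 0 := by
  classical
  obtain ⟨q, hq, hq'⟩ := exists_separating E
    (s := (Finset.univ.filter fun T' : Tableau N β => IsStandard μ T' ∧ T' ≠ T).image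
      (tabWeight μ hN)) (χ := tabWeight μ hN T) (by
    rw [Finset.mem_image]
    rintro ⟨T', hT', h⟩
    have h1 := (Finset.mem_filter.1 hT').2
    exact h1.2 (eq_of_tabWeight_eq hmu hs hN h1.1 hT h))
  exact ⟨q, hq, fun T' hT' hne => hq' _
    (Finset.mem_image_of_mem _ (Finset.mem_filter.2 ⟨Finset.mem_univ _, hT', hne⟩))⟩

variable {v : E} (hv : HasWeight (zeta μ hN) v)
  (word : {T : Tableau N β // IsStandard μ T} → List (Fin (N - 1)))
  (hword : ∀ T, IsReducedWord (word T) (tabPerm hN T.1))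

include hv hword

lemma linearIndependent_wordIntertwiner (hv0 : v ≠ 0) :
    LinearIndependent ℂ fun T => wordIntertwiner (word T) • v := by
  classical
  rw [linearIndependent_iff']
  intro s r hr T hT
  obtain ⟨q, hq, hq'⟩ := exists_separating_tableau hmu hs hN E T.2
  have h1 := congrArg (q • ·) hr
  simp only [Finset.smul_sum, smul_zero, smul_hecke_comm] at h1
  rw [Finset.sum_eq_single T, hq _ (hasWeight_wordIntertwiner hmu hN T.2 (hword T) hv)] at h1
  · exact (smul_eq_zero.1 h1).resolve_right
      (wordIntertwiner_smul_ne_zero hmu hs hN T.2 (hword T) hv hv0)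
  · intro T' _ hne
    rw [hq' T'.1 T'.2 (fun h => hne (Subtype.ext h)) _
      (hasWeight_wordIntertwiner hmu hN T'.2 (hword T') hv), smul_zero]
  · exact fun h => (h hT).elim

/-- Otherwise some nonzero eigenform vanishes on the span. Its weight is that of a standard `T`, and
its composite with `φ_{w_T}` is a nonzero form of weight `ζ` vanishing on `v`, against `hzeta`. -/
lemma span_wordIntertwiner_eq_top [FiniteDimensional ℂ E]
    (hstd : ∀ χ (g : E →ₗ[ℂ] ℂ), g ≠ 0 → FormHasWeight χ g →
      ∃ T, IsStandard μ T ∧ χ = tabWeight μ hN T)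
    (hzeta : ∀ g : E →ₗ[ℂ] ℂ, FormHasWeight (zeta μ hN) g → g v = 0 → g = 0) :
    Submodule.span ℂ (Set.range fun T => wordIntertwiner (word T) • v) = ⊤ := by
  by_contra hne
  obtain ⟨g, hg0, hg, χ, hχ⟩ := exists_common_eigenform
    (fun i : Fin N => Algebra.lsmul ℂ ℂ E (epsH i))
    (fun i j => by rw [← map_mul, epsH_comm, map_mul]) _ hne (fun i w hw => by
      induction hw using Submodule.span_induction with
      | mem w hw =>
        obtain ⟨T, rfl⟩ := hw
        rw [Algebra.lsmul_coe]
        simp only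
        rw [hasWeight_wordIntertwiner hmu hN T.2 (hword T) hv i]
        exact Submodule.smul_mem _ _ (Submodule.subset_span ⟨T, rfl⟩)
      | zero => rw [map_zero]; exact Submodule.zero_mem _
      | add x y _ _ hx hy => rw [map_add]; exact Submodule.add_mem _ hx hy
      | smul r x _ hx => rw [map_smul]; exact Submodule.smul_mem _ _ hx)
  obtain ⟨T, hT, rfl⟩ := hstd χ g hg0 hχ
  obtain ⟨h1, h2⟩ := formComp_wordIntertwiner hmu hs hN hT (hword ⟨T, hT⟩) hχ hg0
  exact h2 (hzeta _ h1 (hg _ (Submodule.subset_span ⟨⟨T, hT⟩, rfl⟩)))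

/-- A polynomial in the `ε_i^∨` extracts one basis vector from any nonzero vector. Undoing its
intertwiners recovers `v`, which generates. -/
lemma isSimpleModule_of_span_eq_top (hv0 : v ≠ 0)
    (hspan : Submodule.span ℂ (Set.range fun T => wordIntertwiner (word T) • v) = ⊤) :
    IsSimpleModule (Hecke N) E := by
  classical
  rw [isSimpleModule_iff_toSpanSingleton_surjective]
  refine ⟨⟨v, 0, hv0⟩, fun x hx => ?_⟩
  rw [← LinearMap.range_eq_top]
  set K := LinearMap.range (LinearMap.toSpanSingleton (Hecke N) E x) with hK
  have hxK : x ∈ K := ⟨1, by simp⟩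
  have hx' : x ∈ Submodule.span ℂ (Set.range fun T => wordIntertwiner (word T) • v) :=
    hspan ▸ Submodule.mem_top
  obtain ⟨r, hr⟩ := (Submodule.mem_span_range_iff_exists_fun ℂ).1 hx'
  obtain ⟨T, hT⟩ : ∃ T, r T ≠ 0 := by
    by_contra! h
    refine hx (hr ▸ Finset.sum_eq_zero fun T _ => ?_)
    rw [h T, zero_smul]
  obtain ⟨q, hq, hq'⟩ := exists_separating_tableau hmu hs hN E T.2
  have h1 : q • x = r T • wordIntertwiner (word T) • v := by
    rw [← hr, Finset.smul_sum, Finset.sum_eq_single T]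
    · rw [smul_hecke_comm, hq _ (hasWeight_wordIntertwiner hmu hN T.2 (hword T) hv)]
    · intro T' _ hne
      rw [smul_hecke_comm, hq' T'.1 T'.2 (fun h => hne (Subtype.ext h)) _
        (hasWeight_wordIntertwiner hmu hN T'.2 (hword T') hv), smul_zero]
    · simp
  have h2 : wordIntertwiner (word T) • v ∈ K := by
    have h3 := K.smul_mem (algebraMap ℂ (Hecke N) (r T)⁻¹) (K.smul_mem q hxK)
    rwa [h1, algebraMap_smul, smul_smul, inv_mul_cancel₀ hT, one_smul] at h3
  have h4 := mem_of_wordIntertwiner_smul_mem hmu hs hN T.2 (hword T) hv K h2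
  rw [eq_top_iff]
  intro y _
  have hy : y ∈ Submodule.span ℂ (Set.range fun T => wordIntertwiner (word T) • v) :=
    hspan ▸ Submodule.mem_top
  obtain ⟨r', rfl⟩ := (Submodule.mem_span_range_iff_exists_fun ℂ).1 hy
  refine Submodule.sum_mem _ fun T' _ => ?_
  rw [← algebraMap_smul (Hecke N)]
  exact K.smul_mem _ (K.smul_mem _ h4)

omit hs in
lemma isSemisimpleModule_polyH_of_span_eq_top
    (hspan : Submodule.span ℂ (Set.range fun T => wordIntertwiner (word T) • v) = ⊤) :
    IsSemisimpleModule (polyH N) E := by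
  classical
  have hline : ∀ T, ∀ q : polyH N, ∃ r : ℂ,
      q • wordIntertwiner (word T) • v = r • wordIntertwiner (word T) • v := by
    rintro T ⟨q, hq⟩
    have hw := hasWeight_wordIntertwiner hmu hN T.2 (hword T) hv
    change ∃ r : ℂ, q • wordIntertwiner (word T) • v = r • wordIntertwiner (word T) • v
    induction hq using Algebra.adjoin_induction with
    | mem q hq =>
      obtain ⟨i, rfl⟩ := hq
      exact ⟨_, hw i⟩
    | algebraMap r => exact ⟨r, algebraMap_smul _ _ _⟩
    | add a b _ _ ha hb =>
      obtain ⟨r, hr⟩ := ha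
      obtain ⟨r', hr'⟩ := hb
      exact ⟨r + r', by rw [add_smul, hr, hr', add_smul]⟩
    | mul a b _ _ ha hb =>
      obtain ⟨r, hr⟩ := ha
      obtain ⟨r', hr'⟩ := hb
      exact ⟨r * r', by rw [mul_smul, hr', smul_hecke_comm, hr, smul_smul, mul_comm]⟩
  have hscal : ∀ (r : ℂ) (w : E), algebraMap ℂ (polyH N) r • w = r • w :=
    fun r w => algebraMap_smul (Hecke N) r w
  refine isSemisimpleModule_of_lines (fun T => wordIntertwiner (word T) • v) (fun T q hq => ?_)
    fun y => ?_
  · obtain ⟨r, hr⟩ := hline T q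
    simp only [hr] at hq ⊢
    have hr0 : r ≠ 0 := by
      rintro rfl
      exact hq (zero_smul _ _)
    exact ⟨algebraMap ℂ (polyH N) r⁻¹, by rw [hscal, smul_smul, inv_mul_cancel₀ hr0, one_smul]⟩
  · have hy : y ∈ Submodule.span ℂ (Set.range fun T => wordIntertwiner (word T) • v) :=
      hspan ▸ Submodule.mem_top
    obtain ⟨r, hr⟩ := (Submodule.mem_span_range_iff_exists_fun ℂ).1 hy
    refine ⟨Finset.univ, fun T => algebraMap ℂ (polyH N) (r T), ?_⟩
    rw [← hr]
    exact Finset.sum_congr rfl fun T _ => hscal _ _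

end

/-- Proper submodules of a finite-dimensional cyclic module whose cyclic vector is a weight vector
detected by linear forms of the same weight have proper sum. -/
lemma sup_ne_top {N : ℕ} {E : Type} [AddCommGroup E] [Module ℂ E] [Module (Hecke N) E]
    [IsScalarTower ℂ (Hecke N) E] [FiniteDimensional ℂ E] {ζ : Fin N → ℂ} {v : E}
    (hv : HasWeight ζ v) (hgen : Submodule.span (Hecke N) {v} = ⊤)
    (hzeta : ∀ g : E →ₗ[ℂ] ℂ, FormHasWeight ζ g → g v = 0 → g = 0)
    {K K' : Submodule (Hecke N) E} (hK : K ≠ ⊤) (hK' : K' ≠ ⊤) : K ⊔ K' ≠ ⊤ := by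
  have key : ∀ K : Submodule (Hecke N) E, K ≠ ⊤ →
      ∃ g : E →ₗ[ℂ] ℂ, g ≠ 0 ∧ (∀ w ∈ K, g w = 0) ∧ FormHasWeight ζ g := by
    intro K hK
    exact exists_eigenform_of_eigenvector (fun i : Fin N => Algebra.lsmul ℂ ℂ E (epsH i))
      (fun i j => by rw [← map_mul, epsH_comm, map_mul]) (K.restrictScalars ℂ)
      (fun i w hw => K.smul_mem _ hw) (v := v) (fun h => hK (by
        rw [eq_top_iff, ← hgen, Submodule.span_singleton_le_iff_mem]
        exact h)) hv
  obtain ⟨g, hg0, hg, hgw⟩ := key K hK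
  obtain ⟨g', hg0', hg', hgw'⟩ := key K' hK'
  -- Both forms have weight `ζ`, and this combination vanishes on `v`, so the forms are
  -- proportional.
  have h1 : g' v • g - g v • g' = 0 := by
    refine hzeta _ (fun i w => ?_) ?_
    · simp only [LinearMap.sub_apply, LinearMap.smul_apply, smul_eq_mul, hgw i w, hgw' i w]
      ring
    · simp only [LinearMap.sub_apply, LinearMap.smul_apply, smul_eq_mul]
      ring
  have h2 : g' v ≠ 0 := fun h => hg0' (hzeta _ hgw' h)
  intro htop
  refine hg0 (LinearMap.ext fun x => ?_)
  -- By proportionality `g` also vanishes on `K'`, hence on the sum, which therefore cannot be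
  -- everything.
  obtain ⟨y, hy, z, hz, rfl⟩ := Submodule.mem_sup.1 (htop ▸ Submodule.mem_top : x ∈ K ⊔ K')
  have h3 := congrArg (fun g => g z) h1
  simp only [LinearMap.sub_apply, LinearMap.smul_apply, smul_eq_mul, hg' z hz, mul_zero, sub_zero,
    LinearMap.zero_apply] at h3
  rw [map_add, hg y hy, (mul_eq_zero.1 h3).resolve_left h2, add_zero, LinearMap.zero_apply]

/-! ### Eigenforms on coinvariants -/

section

variable {m N : ℕ} {β : Fin m → ℕ} {lam μ : Weight m} (hN : ∑ a, β a = N)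
  (hlam : ∀ p, wcoord lam p = wcoord μ p + β p - N / (m : ℂ))
  {B : Type} [AddCommGroup B] [Module ℂ B] [Module (Usl m) B] [IsScalarTower ℂ (Usl m) B] {b : B}

include hlam in
lemma card_letter_eq (hB : IsLowest B (wcoord lam) b) {g : Func (m := m) N (Verma μ) B →ₗ[ℂ] ℂ}
    {c : Fin N → Fin m} (h : g (cls N (Verma μ) B (wordTens (hwVector μ) c b)) ≠ 0) (p : Fin m) :
    (Finset.univ.filter fun i => c i = p).card = β p := by
  have h1 := card_eq_of_wordForm_ne_zero (isInvForm_wordForm g) (actHom_slUnit_self_hwVector μ)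
    hB.weight h p
  rw [hlam] at h1
  have h2 : ((Finset.univ.filter fun i => c i = p).card : ℂ) = β p := by
    rw [h1]
    ring
  exact_mod_cast h2

include hlam in
/-- The weights of eigenforms on coinvariants are weights of words. -/
lemma exists_word_of_form (hB : IsLowest B (wcoord lam) b)
    {g : Func (m := m) N (Verma μ) B →ₗ[ℂ] ℂ} (hg0 : g ≠ 0) {χ : Fin N → ℂ}
    (hg : ∀ i v, g (funcY N (Verma μ) B i v) = χ i * g v) :
    ∃ (c : Fin N → Fin m) (hc : ∀ p, (Finset.univ.filter fun i => c i = p).card = β p),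
      g (cls N (Verma μ) B (wordTens (hwVector μ) c b)) ≠ 0 ∧
      χ = tabWeight μ hN (wordTableau hN c hc) ∧
      ((∀ p q : Fin m, (p : ℕ) + 1 = q → ∃ k, (actHom B (slUnit p q) ^ k) b = 0) →
        ∀ t ≤ N, ∀ p q : Fin m, (p : ℕ) + 1 = q →
          ∃ n : ℕ, (wcoord lam p - tailCount c t p) - (wcoord lam q - tailCount c t q) = n) := by
  have hb : b ∉ formRad (wordForm g) := fun hb =>
    hg0 (form_eq_zero hB fun c => mem_formRad.1 hb c _)
  obtain ⟨c, h1, h2, h3⟩ := exists_word_of_isEigenForm (actHom (Verma μ)) (hwVector μ)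
    (verma_eq_top μ) (actHom B) (wordForm g) _ (wcoord lam) b (isInvForm_wordForm g)
    (isEigenForm_wordForm hg) (fun p q h => by rw [hB.low p q h]; exact Submodule.zero_mem _)
    (fun p => by rw [hB.weight, neg_smul, neg_add_cancel]; exact Submodule.zero_mem _) hb
  refine ⟨c, card_letter_eq hlam hB h1, h1, funext fun i => ?_, fun hk => h3 fun p q hpq => ?_⟩
  · rw [tabWeight_wordTableau hN hlam, ← h2 i, sub_add_cancel]
  · obtain ⟨k, hk⟩ := hk p q hpq
    exact ⟨k, by rw [hk]; exact Submodule.zero_mem _⟩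

-- A nonzero form of weight `ζ` is nonzero on some word whose tableau has weight `ζ`. Such a tableau
-- has increasing rows and must be the row reading one, so the word is the row word.
include hlam in
lemma form_eq_zero_of_zeta {mu : Fin m → ℕ} {κ : ℂ} (hmu : ∀ p, wcoord μ p = mu p + κ)
    (hs : IsSkewShape mu β) (hB : IsLowest B (wcoord lam) b)
    {g : Func (m := m) N (Verma μ) B →ₗ[ℂ] ℂ}
    (hg : ∀ i v, g (funcY N (Verma μ) B i v) = zeta μ hN i * g v)
    (h0 : g (cls N (Verma μ) B (wordTens (hwVector μ) (rowWord β hN) b)) = 0) : g = 0 := by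
  by_contra hg0
  obtain ⟨c, hc, h1, h2, -⟩ := exists_word_of_form hN hlam hB hg0 hg
  rw [wordTableau_eq_rowTableau hs hmu hN c hc h2.symm] at h1
  exact h1 h0

/-! ### The cyclic vector -/

lemma rowWord_le {i j : Fin N} (h : i < j) : rowWord β hN i ≤ rowWord β hN j := by
  by_contra hlt
  have h1 := rowTableau_lt_of_row_lt hN (not_le.1 hlt)
  rw [Equiv.apply_symm_apply, Equiv.apply_symm_apply] at h1
  exact lt_asymm h h1

lemma update_update_eq_comp_swap (c : Fin N → Fin m) {i k : Fin N} (h : k ≠ i) :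
    Function.update (Function.update c i (c k)) k (c i) = c ∘ Equiv.swap i k := by
  ext1 j
  rw [Function.comp_apply, Equiv.swap_apply_def]
  split_ifs with h1 h2
  · rw [h1, Function.update_of_ne h.symm, Function.update_self]
  · rw [h2, Function.update_self]
  · rw [Function.update_of_ne h2, Function.update_of_ne h1]

/-- The raising operator kills `v(μ)`, so invariance transfers it from `b` to the letters `d` of the
modified word. At position `i` it restores `c`; at another position it produces an exchange. -/
lemma wordForm_raising (g : Func (m := m) N (Verma μ) B →ₗ[ℂ] ℂ) (c : Fin N → Fin m) (i : Fin N)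
    {d : Fin m} (hd : c i < d) (b : B) :
    wordForm g (Function.update c i d) (hwVector μ) (actHom B (slUnit (c i) d) b) =
      -(wordForm g c (hwVector μ) b + ∑ k ∈ Finset.univ.filter (fun k => c k = d),
        wordForm g (c ∘ Equiv.swap i k) (hwVector μ) b) := by
  have h1 := isInvForm_wordForm g (slUnit (c i) d) (Function.update c i d) (hwVector μ) b
  rw [actHom_slUnit_hwVector μ hd, map_zero, LinearMap.zero_apply, zero_add] at h1
  rw [eq_neg_iff_add_eq_zero, add_comm, ← h1]
  congr 1
  have h2 : ∀ k, ∑ e, (slUnit (c i) d).1 e (Function.update c i d k) *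
      wordForm g (Function.update (Function.update c i d) k e) (hwVector μ) b =
      if Function.update c i d k = d then
        wordForm g (Function.update (Function.update c i d) k (c i)) (hwVector μ) b else 0 := by
    intro k
    rw [Finset.sum_eq_single (c i), slUnit_apply, if_neg (c := c i = d ∧ _) fun h => hd.ne h.1,
      sub_zero]
    · simp [eq_comm]
    · intro e _ he
      rw [slUnit_apply, if_neg fun h => he h.1.symm, if_neg fun h => hd.ne h.1, sub_zero, zero_mul]
    · simp
  simp only [h2]
  rw [Finset.sum_filter, ← Finset.add_sum_erase _ _ (Finset.mem_univ i),
    ← Finset.add_sum_erase _ _ (Finset.mem_univ i), if_neg hd.ne, zero_add, Function.update_self,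
    if_pos rfl, Function.update_idem, Function.update_eq_self]
  congr 1
  refine Finset.sum_congr rfl fun k hk => ?_
  have hki := Finset.ne_of_mem_erase hk
  rw [Function.update_of_ne hki]
  split_ifs with h
  · rw [← h, update_update_eq_comp_swap c hki]
  · rfl

lemma sum_wordForm_raising (hB : IsLowest B (wcoord lam) b)
    (g : Func (m := m) N (Verma μ) B →ₗ[ℂ] ℂ) (c : Fin N → Fin m) (i : Fin N) :
    ∑ d, wordForm g (Function.update c i d) (hwVector μ) (actHom B (slUnit (c i) d) b) =
      -(wcoord lam (c i) + ((m : ℂ) - 1 - (c i : ℕ))) * wordForm g c (hwVector μ) b -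
      ∑ k ∈ Finset.univ.filter (fun k => c i < c k),
        wordForm g (c ∘ Equiv.swap i k) (hwVector μ) b := by
  have h1 : ∀ d, wordForm g (Function.update c i d) (hwVector μ) (actHom B (slUnit (c i) d) b) =
      (if d = c i then -wcoord lam (c i) * wordForm g c (hwVector μ) b else 0) -
      (if c i < d then wordForm g c (hwVector μ) b + ∑ k ∈ Finset.univ.filter (fun k => c k = d),
        wordForm g (c ∘ Equiv.swap i k) (hwVector μ) b else 0) := by
    intro d
    rcases lt_trichotomy d (c i) with h | rfl | h
    · rw [if_neg h.ne, if_neg h.not_gt, hB.low _ _ h, map_zero, sub_zero]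
    · rw [if_pos rfl, if_neg (lt_irrefl _), Function.update_eq_self, hB.weight, map_smul,
        smul_eq_mul, sub_zero]
    · rw [if_neg h.ne', if_pos h, wordForm_raising g c i h, zero_sub]
  have h2 : ∀ d ∈ Finset.univ.filter (c i < ·), Finset.univ.filter (fun k => c k = d) =
      (Finset.univ.filter (fun k => c i < c k)).filter (fun k => c k = d) := by
    intro d hd
    ext k
    simp only [Finset.mem_filter, Finset.mem_univ, true_and]
    exact ⟨fun h => ⟨h ▸ (Finset.mem_filter.1 hd).2, h⟩, fun h => h.2⟩
  have h3 : ((Finset.univ.filter (c i < ·)).card : ℂ) = (m : ℂ) - 1 - (c i : ℕ) := by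
    have h4 : Finset.univ.filter (c i < ·) = Finset.Ioi (c i) := by
      ext d
      simp
    have h5 : (Finset.Ioi (c i)).card + (1 + (c i : ℕ)) = m := by
      rw [Fin.card_Ioi]
      have := (c i).2
      omega
    have h6 := congrArg (Nat.cast (R := ℂ)) h5
    push_cast at h6
    rw [h4]
    linear_combination h6
  rw [Finset.sum_congr rfl fun d _ => h1 d, Finset.sum_sub_distrib, Finset.sum_ite_eq' Finset.univ,
    if_pos (Finset.mem_univ _), ← Finset.sum_filter, Finset.sum_add_distrib, Finset.sum_const,
    nsmul_eq_mul, h3, Finset.sum_congr rfl fun d hd => by rw [h2 d hd],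
    Finset.sum_fiberwise_of_maps_to fun k hk => by simpa using hk]
  ring

lemma card_rowWord_lt (d : Cell β) : (Finset.univ.filter fun j =>
    j < rowTableau β hN d ∧ rowWord β hN j = d.1).card = d.2 := by
  obtain ⟨a, k⟩ := d
  have h : (Finset.univ.filter fun j => j < rowTableau β hN ⟨a, k⟩ ∧ rowWord β hN j = a) =
      (Finset.Iio k).map ⟨fun l => rowTableau β hN ⟨a, l⟩, fun l l' h => by simpa using h⟩ := by
    ext j
    obtain ⟨⟨a', l⟩, rfl⟩ := (rowTableau β hN).surjective j
    have hrow : rowWord β hN (rowTableau β hN ⟨a', l⟩) = a' := by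
      rw [rowWord, Equiv.symm_apply_apply]
    rw [Finset.mem_filter, Finset.mem_map, hrow]
    constructor
    · rintro ⟨-, h, rfl⟩
      refine ⟨l, Finset.mem_Iio.2 ?_, rfl⟩
      by_contra hle
      rcases (not_lt.1 hle).lt_or_eq with h1 | rfl
      · exact lt_asymm h (rowTableau_lt_of_snd_lt hN rfl h1)
      · exact lt_irrefl _ h
    · rintro ⟨l', h, h'⟩
      obtain ⟨rfl, h'⟩ := Sigma.mk.inj ((rowTableau β hN).injective h')
      obtain rfl := eq_of_heq h'
      exact ⟨Finset.mem_univ _,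
        rowTableau_lt_of_snd_lt hN rfl (Fin.lt_def.1 (Finset.mem_Iio.1 h)), rfl⟩
  simp only [h, Finset.card_map, Fin.card_Iio]

lemma wordTableau_rowWord :
    wordTableau hN (rowWord β hN) (card_rowWord_eq hN) = rowTableau β hN := by
  have h : (wordTableau hN (rowWord β hN) (card_rowWord_eq hN)).symm = (rowTableau β hN).symm := by
    ext1 i
    have h1 := card_rowWord_lt hN ((rowTableau β hN).symm i)
    rw [Equiv.apply_symm_apply] at h1
    rw [wordTableau_symm]
    exact Sigma.ext rfl (heq_of_eq (Fin.ext h1))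
  rw [← Equiv.symm_symm (wordTableau _ _ _), h, Equiv.symm_symm]

/-- The row word gives an eigenvector. -/
lemma funcY_rowWord (hB : IsLowest B (wcoord lam) b)
    (hlam : ∀ p, wcoord lam p = wcoord μ p + β p - N / (m : ℂ)) (i : Fin N) :
    funcY N (Verma μ) B i (cls N (Verma μ) B (wordTens (hwVector μ) (rowWord β hN) b)) =
      zeta μ hN i • cls N (Verma μ) B (wordTens (hwVector μ) (rowWord β hN) b) := by
  rw [← sub_eq_zero, ← Module.forall_dual_apply_eq_zero_iff ℂ]
  intro g
  have hζ := tabWeight_wordTableau hN hlam (rowWord β hN) (card_rowWord_eq hN) i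
  rw [wordTableau_rowWord, tabWeight_rowTableau] at hζ
  rw [map_sub, map_smul, form_funcY, ← wordForm_apply, sum_wordForm_raising hB, hζ, smul_eq_mul]
  set c := rowWord β hN with hc
  -- The row word is nondecreasing, so the later positions with a different letter are exactly the
  -- positions with a larger letter. Their exchanges cancel those coming from the raising operators.
  have h1 : ∑ j ∈ Finset.univ.filter (i < ·), wordForm g (c ∘ Equiv.swap i j) (hwVector μ) b =
      (Finset.univ.filter fun j => i < j ∧ c j = c i).card * wordForm g c (hwVector μ) b +
      ∑ k ∈ Finset.univ.filter (fun k => c i < c k),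
        wordForm g (c ∘ Equiv.swap i k) (hwVector μ) b := by
    rw [← Finset.sum_filter_add_sum_filter_not _ (fun j => c j = c i), Finset.filter_filter,
      Finset.filter_filter]
    congr 1
    · rw [← nsmul_eq_mul, ← Finset.sum_const]
      refine Finset.sum_congr rfl fun j hj => ?_
      have hj' := (Finset.mem_filter.1 hj).2.2
      congr 3
      ext1 k
      rw [Function.comp_apply, Equiv.swap_apply_def]
      split_ifs with h h
      · rw [h, hj']
      · rw [h, hj']
      · rfl
    · refine Finset.sum_congr (Finset.ext fun j => ?_) fun _ _ => rfl
      simp only [Finset.mem_filter, Finset.mem_univ, true_and]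
      constructor
      · exact fun h => lt_of_le_of_ne (rowWord_le hN h.1) (Ne.symm h.2)
      · intro h
        refine ⟨?_, h.ne'⟩
        rcases lt_trichotomy i j with h2 | rfl | h2
        · exact h2
        · exact absurd h (lt_irrefl _)
        · exact absurd (rowWord_le hN h2) (not_le.2 h)
  rw [h1]
  ring

end

/-! ### The projection to the irreducible quotient -/

section

variable {m N : ℕ} {lam μ : Weight m}

lemma tensProj_wordTens (a : Verma μ) (c : Fin N → Fin m) (b : VermaLow lam) :
    tensProj N lam μ (wordTens a c b) = wordTens a c (toIrrLow lam b) := rfl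

lemma tensProj_comp_diagAct (x : Slm m) :
    tensProj N lam μ ∘ₗ diagAct x = diagAct x ∘ₗ tensProj N lam μ := by
  apply tens_ext
  intro a c b
  simp only [LinearMap.comp_apply, diagAct_wordTens, tensProj_wordTens, map_add, map_sum, map_smul,
    toIrrLow_actHom]

lemma tensProj_comp_opPerm (w : Equiv.Perm (Fin N)) :
    tensProj N lam μ ∘ₗ opPerm m _ _ w = opPerm m _ _ w ∘ₗ tensProj N lam μ := by
  apply tens_ext
  intro a c b
  simp only [LinearMap.comp_apply, opPerm_wordTens, tensProj_wordTens]

lemma tensProj_comp_opY (i : Fin N) :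
    tensProj N lam μ ∘ₗ opY N _ _ i = opY N _ _ i ∘ₗ tensProj N lam μ := by
  apply tens_ext
  intro a c b
  rw [LinearMap.comp_apply, LinearMap.comp_apply, tensProj_wordTens, opY_wordTens, opY_wordTens]
  have key : ∀ {V W : Type} [AddCommGroup V] [Module ℂ V] [AddCommGroup W] [Module ℂ W]
      (F : V →ₗ[ℂ] W) {ι κ : Type} (s : Finset ι) (t : Finset κ) (x : ι → V) (y : κ → V),
      F (-∑ j ∈ s, x j - ∑ d ∈ t, y d) = -∑ j ∈ s, F (x j) - ∑ d ∈ t, F (y d) := by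
    intro V W _ _ _ _ F ι κ s t x y
    rw [map_sub, map_neg, map_sum, map_sum]
  refine (key (tensProj N lam μ) _ _ _ _).trans ?_
  simp only [tensProj_wordTens, toIrrLow_actHom]

variable (N lam μ) in
/-- The projection of coinvariants. -/
def funcProj : MBar N lam μ →ₗ[ℂ] VBar N lam μ :=
  Submodule.mapQ _ _ (tensProj N lam μ) (diagImage_le fun x v => by
    rw [Submodule.mem_comap]
    have := congrArg (fun T => T v) (tensProj_comp_diagAct (N := N) (lam := lam) (μ := μ) x)
    simp only [LinearMap.comp_apply] at this
    rw [this]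
    exact diagAct_mem _ _)

lemma funcProj_cls (v : Tens m N (Verma μ) (VermaLow lam)) :
    funcProj N lam μ (cls N _ _ v) = cls N _ _ (tensProj N lam μ v) := rfl

lemma funcProj_funcPerm (w : Equiv.Perm (Fin N)) (v : MBar N lam μ) :
    funcProj N lam μ (funcPerm N _ _ w v) = funcPerm N _ _ w (funcProj N lam μ v) := by
  obtain ⟨v, rfl⟩ := Submodule.Quotient.mk_surjective _ v
  have := congrArg (fun T => cls (m := m) N (Verma μ) (IrrLow lam) (T v))
    (tensProj_comp_opPerm (lam := lam) (μ := μ) w)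
  exact this

lemma funcProj_funcY (i : Fin N) (v : MBar N lam μ) :
    funcProj N lam μ (funcY N _ _ i v) = funcY N _ _ i (funcProj N lam μ v) := by
  obtain ⟨v, rfl⟩ := Submodule.Quotient.mk_surjective _ v
  have := congrArg (fun T => cls (m := m) N (Verma μ) (IrrLow lam) (T v))
    (tensProj_comp_opY (lam := lam) (μ := μ) i)
  change funcProj N lam μ (funcY N _ _ i (cls N _ _ v)) =
    funcY N _ _ i (funcProj N lam μ (cls N _ _ v))
  rw [funcY_cls, map_add, map_smul, funcProj_cls, funcProj_cls, funcY_cls]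
  congr 1

lemma funcProj_surjective : Function.Surjective (funcProj N lam μ) := by
  intro v
  obtain ⟨v, rfl⟩ := Submodule.Quotient.mk_surjective _ v
  have hs : Function.Surjective (tensProj N lam μ) :=
    TensorProduct.map_surjective Function.surjective_id
      (TensorProduct.map_surjective Function.surjective_id (toIrrLow_surjective lam))
  obtain ⟨w, rfl⟩ := hs v
  exact ⟨cls N _ _ w, rfl⟩

end

section

variable {m N : ℕ} {β : Fin m → ℕ} {lam μ : Weight m}

/-! ### Numbers of boxes -/

lemma wcoord_eq_inner {mu : Fin m → ℕ}
    (hmu : ∀ p, wcoord μ p = mu p + -((∑ a, mu a : ℕ) : ℂ) / (m : ℂ)) (p : Fin m) :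
    wcoord μ p = (Finset.univ.filter fun s : (a : Fin m) × Fin (mu a) => s.1 = p).card -
      Fintype.card ((a : Fin m) × Fin (mu a)) / (m : ℂ) := by
  rw [card_sigma_fst_eq, hmu, Fintype.card_sigma]
  simp only [Fintype.card_fin]
  ring

lemma wcoord_eq_outer {mu : Fin m → ℕ}
    (hmu : ∀ p, wcoord μ p = mu p + -((∑ a, mu a : ℕ) : ℂ) / (m : ℂ)) (hN : ∑ a, β a = N)
    (hlam : ∀ p, wcoord lam p = wcoord μ p + β p - N / (m : ℂ)) (p : Fin m) :
    wcoord lam p = (Finset.univ.filter fun s =>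
        Sum.elim (fun s : (a : Fin m) × Fin (mu a) => s.1) (rowWord β hN) s = p).card -
      Fintype.card (((a : Fin m) × Fin (mu a)) ⊕ Fin N) / (m : ℂ) := by
  have h : (Finset.univ.filter fun s =>
      Sum.elim (fun s : (a : Fin m) × Fin (mu a) => s.1) (rowWord β hN) s = p).card =
      mu p + β p := by
    rw [Finset.card_filter, Fintype.sum_sum_type, ← Finset.card_filter, ← Finset.card_filter]
    exact congrArg₂ _ (card_sigma_fst_eq mu p) (card_rowWord_eq hN p)
  rw [h, hlam, hmu, Fintype.card_sum, Fintype.card_sigma]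
  simp only [Fintype.card_fin]
  push_cast
  ring

/-! ### The action on the cyclic vector -/

lemma exists_perm_of_card_eq (hN : ∑ a, β a = N) {c : Fin N → Fin m}
    (hc : ∀ p, (Finset.univ.filter fun i => c i = p).card = β p) :
    ∃ w : Equiv.Perm (Fin N), c = rowWord β hN ∘ w.symm := by
  refine ⟨((wordTableau hN c hc).symm.trans (rowTableau β hN)).symm, funext fun i => ?_⟩
  rw [Equiv.symm_symm, Function.comp_apply, rowWord, Equiv.trans_apply, Equiv.symm_apply_apply,
    wordTableau_symm]
  rfl

lemma funcPerm_cls_wordTens {A B : Type} [AddCommGroup A] [Module ℂ A] [Module (Usl m) A]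
    [IsScalarTower ℂ (Usl m) A] [AddCommGroup B] [Module ℂ B] [Module (Usl m) B]
    [IsScalarTower ℂ (Usl m) B] (w : Equiv.Perm (Fin N)) (a : A) (c : Fin N → Fin m) (b : B) :
    funcPerm N A B w (cls (m := m) N A B (wordTens a c b)) =
      cls (m := m) N A B (wordTens a (c ∘ w.symm) b) := by
  rw [funcPerm_cls, opPerm_wordTens]

/-- The cyclic vector generates under place permutations. -/
lemma span_funcPerm_eq_top (hN : ∑ a, β a = N)
    (hlam : ∀ p, wcoord lam p = wcoord μ p + β p - N / (m : ℂ)) :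
    Submodule.span ℂ (Set.range fun w => funcPerm N _ _ w (cyclicVector lam μ hN)) = ⊤ := by
  rw [eq_top_iff, ← span_cls_eq_top (isLowest_lwVector lam), Submodule.span_le]
  rintro _ ⟨c, rfl⟩
  by_cases h : cls (m := m) N (Verma μ) (VermaLow lam) (wordTens (hwVector μ) c (lwVector lam)) = 0
  · simp only [h]
    exact Submodule.zero_mem _
  · rw [← Module.forall_dual_apply_eq_zero_iff ℂ] at h
    push Not at h
    obtain ⟨g, hg⟩ := h
    obtain ⟨w, rfl⟩ := exists_perm_of_card_eq hN (card_letter_eq hlam (isLowest_lwVector lam) hg)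
    exact Submodule.subset_span ⟨w, funcPerm_cls_wordTens w _ _ _⟩

lemma funcPerm_cyclicVector (hN : ∑ a, β a = N) {w : Equiv.Perm (Fin N)}
    (hw : w ∈ youngSubgroup hN) :
    funcPerm N _ _ w (cyclicVector lam μ hN) = cyclicVector lam μ hN := by
  have h : rowWord β hN ∘ w.symm = rowWord β hN := by
    ext1 k
    have h1 := hw (w.symm k)
    rw [Equiv.apply_symm_apply] at h1
    exact h1.symm
  exact (funcPerm_cls_wordTens w _ (rowWord β hN) _).trans (congrArg (fun c =>
    cls N (Verma μ) (VermaLow lam) (wordTens (hwVector μ) c (lwVector lam))) h)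

end

/-! ### Coinvariants as modules over the Hecke algebra -/

/-- A linear map commuting with the generators of the Hecke algebra is a homomorphism. -/
def heckeLinear {N : ℕ} {E E' : Type} [AddCommGroup E] [Module ℂ E] [Module (Hecke N) E]
    [IsScalarTower ℂ (Hecke N) E] [AddCommGroup E'] [Module ℂ E'] [Module (Hecke N) E']
    [IsScalarTower ℂ (Hecke N) E'] (f : E →ₗ[ℂ] E')
    (hperm : ∀ (w : Equiv.Perm (Fin N)) v, f (permH w • v) = permH w • f v)
    (heps : ∀ (i : Fin N) v, f (epsH i • v) = epsH i • f v) : E →ₗ[Hecke N] E' where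
  toFun := f
  map_add' := map_add f
  map_smul' x v := by
    revert v
    exact hecke_induction (P := fun x => ∀ v, f (x • v) = x • f v)
      (fun r v => by rw [algebraMap_smul, algebraMap_smul, map_smul])
      (fun x y hx hy v => by rw [add_smul, add_smul, map_add, hx, hy])
      (fun x y hx hy v => by rw [mul_smul, mul_smul, hx, hy]) hperm heps x

section

attribute [local instance] heckeModule

variable {m N : ℕ} {β : Fin m → ℕ} {lam μ : Weight m}

instance isScalarTower_func (A B : Type) [AddCommGroup A] [Module ℂ A] [Module (Usl m) A]
    [IsScalarTower ℂ (Usl m) A] [AddCommGroup B] [Module ℂ B] [Module (Usl m) B]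
    [IsScalarTower ℂ (Usl m) B] : IsScalarTower ℂ (Hecke N) (Func (m := m) N A B) :=
  (isHeckeAction_heckeModule (m := m) (N := N) (A := A) (B := B)).tower

lemma permH_smul_func {A B : Type} [AddCommGroup A] [Module ℂ A] [Module (Usl m) A]
    [IsScalarTower ℂ (Usl m) A] [AddCommGroup B] [Module ℂ B] [Module (Usl m) B]
    [IsScalarTower ℂ (Usl m) B] (w : Equiv.Perm (Fin N)) (v : Func (m := m) N A B) :
    permH w • v = funcPerm N A B w v :=
  congrArg (fun T => T v) (heckeHom_permH w)

lemma epsH_smul_func {A B : Type} [AddCommGroup A] [Module ℂ A] [Module (Usl m) A]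
    [IsScalarTower ℂ (Usl m) A] [AddCommGroup B] [Module ℂ B] [Module (Usl m) B]
    [IsScalarTower ℂ (Usl m) B] (i : Fin N) (v : Func (m := m) N A B) :
    epsH i • v = funcY N A B i v :=
  congrArg (fun T => T v) (heckeHom_epsH i)

/-- The projection of coinvariants as a homomorphism of modules over the Hecke algebra. -/
def heckeProj (N : ℕ) (lam μ : Weight m) : MBar N lam μ →ₗ[Hecke N] VBar N lam μ :=
  heckeLinear (funcProj N lam μ)
    (fun w v => by rw [permH_smul_func, permH_smul_func, funcProj_funcPerm])
    (fun i v => by rw [epsH_smul_func, epsH_smul_func, funcProj_funcY])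

lemma span_cyclicVector_eq_top (hN : ∑ a, β a = N)
    (hlam : ∀ p, wcoord lam p = wcoord μ p + β p - N / (m : ℂ)) :
    Submodule.span (Hecke N) {cyclicVector lam μ hN} = ⊤ := by
  rw [eq_top_iff]
  intro v _
  have hv : v ∈ Submodule.span ℂ (Set.range fun w => funcPerm N _ _ w (cyclicVector lam μ hN)) :=
    span_funcPerm_eq_top hN hlam ▸ Submodule.mem_top
  have hle : Submodule.span ℂ (Set.range fun w => funcPerm N _ _ w (cyclicVector lam μ hN)) ≤
      (Submodule.span (Hecke N) {cyclicVector lam μ hN}).restrictScalars ℂ := by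
    rw [Submodule.span_le]
    rintro _ ⟨w, rfl⟩
    simp only [← permH_smul_func]
    exact Submodule.smul_mem _ _ (Submodule.mem_span_singleton_self _)
  exact hle hv

lemma hasWeight_func {B : Type} [AddCommGroup B] [Module ℂ B] [Module (Usl m) B]
    [IsScalarTower ℂ (Usl m) B] {b : B} (hN : ∑ a, β a = N)
    (hlam : ∀ p, wcoord lam p = wcoord μ p + β p - N / (m : ℂ))
    (hB : IsLowest B (wcoord lam) b) : HasWeight (zeta μ hN)
      (cls (m := m) N (Verma μ) B (wordTens (hwVector μ) (rowWord β hN) b)) := fun i => by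
  rw [epsH_smul_func, funcY_rowWord hN hB hlam]

lemma funcY_of_formHasWeight {A B : Type} [AddCommGroup A] [Module ℂ A] [Module (Usl m) A]
    [IsScalarTower ℂ (Usl m) A] [AddCommGroup B] [Module ℂ B] [Module (Usl m) B]
    [IsScalarTower ℂ (Usl m) B] {χ : Fin N → ℂ} {g : Func (m := m) N A B →ₗ[ℂ] ℂ}
    (hg : FormHasWeight χ g) (i : Fin N) (v : Func (m := m) N A B) :
    g (funcY N A B i v) = χ i * g v := by
  rw [← epsH_smul_func, hg]

end

end

end SkewHecke

/-! ### Proof of the theorem -/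

open SkewHecke in
theorem mainTheorem10 (m N : ℕ) (hm : 1 ≤ m) (lam μ : Weight m)
    (hlam : IsDominantIntegral lam) (hμ : IsDominantIntegral μ)
    (β : Fin m → ℕ) (hN : ∑ a, β a = N) (hβ : lam - μ = ∑ a, (β a : ℂ) • eBar a) :
    ∃ (_ : Module (Hecke N) (MBar N lam μ)) (_ : Module (Hecke N) (VBar N lam μ)),
      IsHeckeAction (m := m) N (Verma μ) (VermaLow lam) ∧
      IsHeckeAction (m := m) N (Verma μ) (IrrLow lam) ∧
      -- the vector `1_ζ` generates, has weight `ζ` and is fixed by `W_β`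
      Submodule.span (Hecke N) {cyclicVector lam μ hN} = ⊤ ∧
      (∀ i : Fin N, epsH i • cyclicVector lam μ hN = zeta μ hN i • cyclicVector lam μ hN) ∧
      (∀ w ∈ youngSubgroup (N := N) hN,
        permH w • cyclicVector lam μ hN = cyclicVector lam μ hN) ∧
      ∃ π : MBar N lam μ →ₗ[Hecke N] VBar N lam μ,
        (∀ v, π (cls (m := m) N (Verma μ) (VermaLow lam) v) =
          cls (m := m) N (Verma μ) (IrrLow lam) (tensProj N lam μ v)) ∧
        -- the quotient `V(λ, μ)` of `M(λ, μ)` is its unique irreducible quotient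
        Function.Surjective π ∧
        IsSimpleModule (Hecke N) (VBar N lam μ) ∧
        (∀ K : Submodule (Hecke N) (MBar N lam μ),
          IsSimpleModule (Hecke N) (MBar N lam μ ⧸ K) → K = LinearMap.ker π) ∧
        -- the vectors `φ_{w_T} 1_ζ` form a basis, for any reduced expressions of the `w_T`
        (∀ word : {T : Tableau N β // IsStandard μ T} → List (Fin (N - 1)),
          (∀ T, IsReducedWord (word T) (tabPerm hN T.1)) →
          ∃ b : Module.Basis {T : Tableau N β // IsStandard μ T} ℂ (VBar N lam μ),
            ∀ T, b T = π (wordIntertwiner (word T) • cyclicVector lam μ hN)) ∧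
        -- `S[t]` acts semisimply
        IsSemisimpleModule (polyH N) (VBar N lam μ) := by
  obtain ⟨mu, hs, hmu⟩ := exists_skewShape hm hlam hμ hN hβ
  have hwt := wcoord_eq_add hN hβ
  have hin := isDiagram_inner hs
  have hout := isDiagram_outer hs hN
  have hinner := wcoord_eq_inner hmu
  have houter := wcoord_eq_outer hmu hN hwt
  have hlow := isLowest_lwVector lam
  have hirr := isLowest_toIrrLow lam
  have hfin := finiteDimensional_func (N := N) (μ := μ) hlow
  have hfin' := finiteDimensional_func (N := N) (μ := μ) hirr
  let _ := heckeModule m N (Verma μ) (VermaLow lam)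
  let _ := heckeModule m N (Verma μ) (IrrLow lam)
  have htow := (isHeckeAction_heckeModule (m := m) (N := N) (A := Verma μ) (B := VermaLow lam)).tower
  have htow' := (isHeckeAction_heckeModule (m := m) (N := N) (A := Verma μ) (B := IrrLow lam)).tower
  have hv : HasWeight (zeta μ hN) (cyclicVector lam μ hN) := hasWeight_func hN hwt hlow
  have hv' : HasWeight (zeta μ hN) (heckeProj N lam μ (cyclicVector lam μ hN)) :=
    hasWeight_func hN hwt hirr
  have hv0 : heckeProj N lam μ (cyclicVector lam μ hN) ≠ 0 :=
    cls_ne_zero hin hout hinner houter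
  have hgen := span_cyclicVector_eq_top (lam := lam) (μ := μ) hN hwt
  have hsurj : Function.Surjective (heckeProj N lam μ) := funcProj_surjective
  have hzeta : ∀ g : MBar N lam μ →ₗ[ℂ] ℂ, FormHasWeight (zeta μ hN) g →
      g (cyclicVector lam μ hN) = 0 → g = 0 := fun g hg h0 =>
    form_eq_zero_of_zeta hN hwt hmu hs hlow (funcY_of_formHasWeight hg) h0
  have hzeta' : ∀ g : VBar N lam μ →ₗ[ℂ] ℂ, FormHasWeight (zeta μ hN) g →
      g (heckeProj N lam μ (cyclicVector lam μ hN)) = 0 → g = 0 := fun g hg h0 =>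
    form_eq_zero_of_zeta hN hwt hmu hs hirr (funcY_of_formHasWeight hg) h0
  -- Only here must `B` be the irreducible module for the weights themselves: nilpotency of the
  -- raising operators on its lowest weight vector gives dominance, hence standardness.
  have hstd : ∀ χ (g : VBar N lam μ →ₗ[ℂ] ℂ), g ≠ 0 → FormHasWeight χ g →
      ∃ T, IsStandard μ T ∧ χ = tabWeight μ hN T := by
    intro χ g hg0 hg
    obtain ⟨c, hc, -, h2, h3⟩ := exists_word_of_form hN hwt hirr hg0 (funcY_of_formHasWeight hg)
    exact ⟨_, isStandard_wordTableau hmu hN hwt c hc (h3 fun p q hpq =>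
      ⟨_, exists_pow_toIrrLow_eq_zero hout houter (by rintro rfl; omega)⟩), h2⟩
  have hspan := fun word hword =>
    span_wordIntertwiner_eq_top hmu hs hN hv' word hword hstd hzeta'
  -- Simplicity and semisimplicity do not refer to reduced words, so one fixed choice suffices for
  -- them.
  choose word hword using fun T : {T : Tableau N β // IsStandard μ T} =>
    exists_isReducedWord (tabPerm hN T.1)
  have hsimple := isSimpleModule_of_span_eq_top hmu hs hN hv' word hword hv0 (hspan word hword)
  refine ⟨inferInstance, inferInstance, isHeckeAction_heckeModule, isHeckeAction_heckeModule, hgen,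
    hv, fun w hw => (permH_smul_func w _).trans (funcPerm_cyclicVector hN hw),
    heckeProj N lam μ, fun v => rfl, hsurj, hsimple, fun K hK => ?_, fun word hword => ?_, ?_⟩
  -- Both `K` and the kernel are maximal submodules; if they were distinct, their sum would be
  -- everything, but sums of proper submodules are proper.
  · have hker : IsCoatom (LinearMap.ker (heckeProj N lam μ)) := by
      rw [← isSimpleModule_iff_isCoatom]
      exact IsSimpleModule.congr (LinearMap.quotKerEquivOfSurjective _ hsurj)
    have hK' := isSimpleModule_iff_isCoatom.1 hK
    have hsup := sup_ne_top hv hgen hzeta hK'.1 hker.1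
    by_contra hne
    exact hsup (hK'.sup_eq_top_of_ne hker hne)
  · refine ⟨Module.Basis.mk (linearIndependent_wordIntertwiner hmu hs hN hv' word hword hv0)
      (hspan word hword).ge, fun T => ?_⟩
    rw [Module.Basis.mk_apply, map_smul]
  · exact isSemisimpleModule_polyH_of_span_eq_top hmu hN hv' word hword (hspan word hword)
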